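/- For $t\in\mathbb R$ let $e^{it\partial_s^2}$ be the free Schrödinger group on $L^2(\mathbb R)$, that is, the Fourier multiplier by $e^{-it\xi^2}$ for the convention $\hat f(\xi)=\int_{\mathbb R} e^{-is\xi}f(s)\,ds$. Fix a sign $\pm$ and let $t_0>0$. There exist constants $a_0>0$ and $\delta>0$ (with $\delta$ depending only on $a_0$, $t_0$ and the sign) such that for all real $a$ with $|a|<a_0$ and all $u_+\in L^1(\mathbb R)\cap L^2(\mathbb R)$ with $\|u_+\|_{L^1}+\|u_+\|_{L^2}<\delta$ the following holds. Put $$v_1(t,s)=a+e^{\pm ia^2\log t}\,\big(e^{it\partial_s^2}u_+\big)(s).$$ Then the equation $$iv_t+v_{ss}\pm\frac1t\left(|v|^2-a^2\right)v=0,\qquad t\ge t_0,\ s\in\mathbb R,$$ has a solution $v$ with $$v-v_1\in C([t_0,\infty),L^2(\mathbb R))\cap L^4([t_0,\infty),L^\infty(\mathbb R))$$ which satisfies, as $t\to\infty$, $$\|v(t)-v_1(t)\|_{L^2}+\|v-v_1\|_{L^4((t,\infty),L^\infty)}=\mathcal O(t^{-1/4}),$$ and $v$ is the only solution with these two properties (up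 to equality almost everywhere in $s$, for every $t\ge t_0$). Here the same sign is taken throughout, and the equation is understood as the associated integral equation: $v-a\in C([t_0,\infty),L^2(\mathbb R))$, the function $\tau\mapsto\frac1\tau(|v(\tau)|^2-a^2)v(\tau)$ belongs to $L^1_{loc}([t_0,\infty),L^2(\mathbb R))$, and for all $t\ge t_0$ $$v(t)-a=e^{i(t-t_0)\partial_s^2}\big(v(t_0)-a\big)\pm i\int_{t_0}^t e^{i(t-\tau)\partial_s^2}\,\frac{(|v(\tau)|^2-a^2)v(\tau)}{\tau}\,d\tau .$$ -/

import Mathlib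

open MeasureTheory Set Filter FourierTransform
open scoped ENNReal

noncomputable section

/-- The complex space `L²(ℝ)`. -/
abbrev L2R : Type := Lp ℂ 2 (volume : Measure ℝ)

/-- The Fourier symbol of `e^{it∂ₛ²}`, for the convention `𝓕 f ξ = ∫ e^{-2πisξ} f(s) ds`. -/
def schrodingerSymbol (t ξ : ℝ) : ℂ :=
  Complex.exp (((-(4 * Real.pi ^ 2 * t * ξ ^ 2) : ℝ) : ℂ) * Complex.I)

theorem norm_schrodingerSymbol (t ξ : ℝ) : ‖schrodingerSymbol t ξ‖ = 1 :=
  Complex.norm_exp_ofReal_mul_I _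

theorem continuous_schrodingerSymbol (t : ℝ) : Continuous (schrodingerSymbol t) := by
  unfold schrodingerSymbol
  fun_prop

theorem memLp_schrodingerSymbol_mul (t : ℝ) (g : L2R) :
    MemLp (fun ξ => schrodingerSymbol t ξ * g ξ) 2 (volume : Measure ℝ) := by
  refine (Lp.memLp g).of_le
    ((continuous_schrodingerSymbol t).aestronglyMeasurable.mul (Lp.memLp g).1) ?_
  refine Eventually.of_forall fun ξ => ?_
  simp [norm_schrodingerSymbol]

/-- The free Schrödinger evolution `e^{it∂ₛ²} f` of `f ∈ L²(ℝ)`, as a Fourier multiplier. -/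
def freeSchrodinger (t : ℝ) (f : L2R) : L2R :=
  𝓕⁻ ((memLp_schrodingerSymbol_mul t (𝓕 f)).toLp _)

/-- The nonlinear term `(σ/t)(|v|² - a²)v`, where `σ = ±1`. -/
def gpNonlinearity (σ a : ℝ) (v : ℝ → ℝ → ℂ) (t s : ℝ) : ℂ :=
  ((σ / t * (‖v t s‖ ^ 2 - a ^ 2) : ℝ) : ℂ) * v t s

/-- `r ∈ C([t₀, ∞), L²(ℝ))`, represented by the curve `R` in `L²(ℝ)`. -/
def RepresentsL2Curve (t₀ : ℝ) (r : ℝ → ℝ → ℂ) (R : ℝ → L2R) : Prop :=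
  ContinuousOn R (Ici t₀) ∧ ∀ t ∈ Ici t₀, r t =ᵐ[volume] R t

/-- The mixed norm `‖r‖_{L⁴((t,∞), L^∞(ℝ))}`. -/
def normL4Linfty (t : ℝ) (r : ℝ → ℝ → ℂ) : ℝ≥0∞ :=
  (∫⁻ τ in Ioi t, eLpNorm (r τ) ∞ volume ^ (4 : ℝ)) ^ (1 / 4 : ℝ)

/-- `v` solves `i vₜ + vₛₛ + (σ/t)(|v|² - a²)v = 0` on `[t₀, ∞)`, in the usual integral (Duhamel)
sense for solutions in `a + C([t₀, ∞), L²)`: since `e^{it∂ₛ²}` fixes constants, `w = v - a`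
satisfies `w(t) = e^{i(t-t₀)∂ₛ²} w(t₀) + i ∫_{t₀}^t e^{i(t-τ)∂ₛ²} (σ/τ)(|v(τ)|² - a²)v(τ) dτ`.
Here `G` is the nonlinear term, as a locally integrable function of time with values in `L²`. -/
def IsGPSolution (σ a t₀ : ℝ) (v : ℝ → ℝ → ℂ) : Prop :=
  ∃ w G : ℝ → L2R,
    RepresentsL2Curve t₀ (fun t s => v t s - (a : ℂ)) w ∧
    (∀ᵐ τ ∂(volume.restrict (Ici t₀)), G τ =ᵐ[volume] gpNonlinearity σ a v τ) ∧
    (∀ t ∈ Ici t₀, IntervalIntegrable G volume t₀ t) ∧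
    ∀ t ∈ Ici t₀,
      w t = freeSchrodinger (t - t₀) (w t₀)
        + Complex.I • ∫ τ in t₀..t, freeSchrodinger (t - τ) (G τ)

/-- The long range profile `v₁(t) = a + e^{iσa² log t} e^{it∂ₛ²} u₊`. -/
def longRangeProfile (σ a : ℝ) (u : L2R) (t s : ℝ) : ℂ :=
  (a : ℂ) + Complex.exp (((σ * a ^ 2 * Real.log t : ℝ) : ℂ) * Complex.I) * freeSchrodinger t u s

/-- `v` solves the equation on `[t₀, ∞)`, with
`v - v₁ ∈ C([t₀, ∞), L²) ∩ L⁴([t₀, ∞), L^∞)` and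
`‖v(t) - v₁(t)‖_{L²} + ‖v - v₁‖_{L⁴((t,∞), L^∞)} = O(t^{-1/4})` as `t → ∞`. -/
structure IsLongRangeSolution (σ a t₀ : ℝ) (u : L2R) (v : ℝ → ℝ → ℂ) : Prop where
  solves : IsGPSolution σ a t₀ v
  continuous_L2 : ∃ R : ℝ → L2R,
    RepresentsL2Curve t₀ (fun t s => v t s - longRangeProfile σ a u t s) R
  mem_L4Linfty : normL4Linfty t₀ (fun t s => v t s - longRangeProfile σ a u t s) < ∞
  decay : ∃ C : ℝ, ∀ᶠ t : ℝ in atTop,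
    eLpNorm (fun s => v t s - longRangeProfile σ a u t s) 2 volume
      + normL4Linfty t (fun t' s => v t' s - longRangeProfile σ a u t' s)
      ≤ ENNReal.ofReal (C * t ^ (-(1 / 4) : ℝ))

end

/-! Write `v = a + w` with `w = e^{ic log t} e^{it∂ₛ²}(u + x)` and `c = σa²`. The gauge factor
cancels the term `(σ/t)a²w`. What drives the remainder `x` is a linear term, `a²/t` times `e^{-2ic
log t} e^{-2it∂ₛ²}` applied to the conjugate of `u + x`, together with `1/t` times terms quadratic
and cubic in `w`. On `u` the linear term has norm of order `1/t` and is not absolutely integrable,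
but on the Fourier side it carries the phase `8π²ξ²t`. Its integral over `(t, ∞)` is therefore a
multiplier that is at worst logarithmic for `√t|ξ| ≤ 1` and `O((tξ²)⁻¹)` beyond. As `u ∈ L¹` has a
bounded Fourier transform, this gives `t^{-1/4}` in `L²` and `t^{-1/2}` in `L^∞`
(`norm_resonantTail_le`, `flowLinftyLe_resonantTail`).

Existence: the nonlinearity is cut off at height `M t^{-1/2}`, which makes it Lipschitz on `L²` with
constant `O(t^{-1/2})`. The equation for `x`, integrated from infinity, is then a contraction in the
norm `sup t^{1/4}‖x(t)‖`, with no Strichartz estimate (`ProfileSmallness.exists_fixedPoint`). A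
posteriori `‖w(t)‖_∞ ≤ M t^{-1/2}` when `u` is small (`ProfileSmallness.linftyLe_gaugedFlow`), so
the cutoff is inactive and `w` solves the true equation. In that bound the quadratic and cubic terms
lie in `L¹` and obey the dispersive estimate. The linear term in `x`, for which only `L²` decay is
known, is handled by inserting the integral equation of `x` once more and exchanging the order of
integration.

Uniqueness: the `L²` norm of a difference of two solutions satisfies a Gronwall inequality backwards
in time, with kernel `2a²/τ + K(τ)`, where `K` is integrable thanks to the `L⁴L^∞` bounds. The
assumed decay `t^{-1/4}` and the smallness of `a` absorb the non-integrable part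
(`eq_zero_of_le_add_integral`). -/

/-! ### The Fourier transform on `L²`: agreement with the integral formula, and complex conjugation.
-/

theorem coeFn_fourier_of_integrable (f : L2R) (hf : Integrable f) :
    ((𝓕 f : L2R) : ℝ → ℂ) =ᵐ[volume] 𝓕 (f : ℝ → ℂ) := by
  have hc : Continuous (𝓕 (f : ℝ → ℂ)) :=
    VectorFourier.fourierIntegral_continuous Real.continuous_fourierChar
      (by exact continuous_inner) hf
  -- The `L²` transform is accessible through its action on tempered distributions, the integral one
  -- through Fubini; against a test function both move `𝓕` onto that function.
  refine ae_eq_of_integral_contDiff_smul_eq ((Lp.memLp _).locallyIntegrable (by norm_num))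
    hc.locallyIntegrable ?_
  intro g g_smooth g_cpt
  have hg₁ : HasCompactSupport (Complex.ofRealCLM ∘ g) := g_cpt.comp_left rfl
  have hg₂ : ContDiff ℝ ((⊤ : ℕ∞) : WithTop ℕ∞) (Complex.ofRealCLM ∘ g) := by fun_prop
  set G : SchwartzMap ℝ ℂ := hg₁.toSchwartzMap hg₂
  have hG : ∀ x, G x = (g x : ℂ) := fun x => rfl
  have h1 : ∫ x, G x • (𝓕 f : L2R) x = ∫ x, (𝓕 G) x • f x := by
    have := congrArg (fun T => T G) (Lp.fourier_toTemperedDistribution_eq f)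
    simp only [TemperedDistribution.fourier_apply, Lp.toTemperedDistribution_apply] at this
    exact this.symm
  have h2 : ∫ x, (𝓕 (G : ℝ → ℂ)) x • f x = ∫ x, G x • 𝓕 (f : ℝ → ℂ) x := by
    have := VectorFourier.integral_fourierIntegral_smul_eq_flip (μ := (volume : Measure ℝ))
      (ν := (volume : Measure ℝ)) (L := innerₗ ℝ) (f := (G : ℝ → ℂ)) (g := (f : ℝ → ℂ))
      Real.continuous_fourierChar (by exact continuous_inner) G.integrable hf
    rw [flip_innerₗ] at this
    exact this
  calc ∫ x, g x • (𝓕 f : L2R) x = ∫ x, G x • (𝓕 f : L2R) x := by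
        simp [hG, Complex.real_smul]
    _ = ∫ x, (𝓕 (G : ℝ → ℂ)) x • f x := by rw [h1, SchwartzMap.fourier_coe]
    _ = ∫ x, G x • 𝓕 (f : ℝ → ℂ) x := h2
    _ = _ := by simp [hG, Complex.real_smul]

theorem norm_fourier_le_of_integrable (f : L2R) (hf : Integrable f) :
    ∀ᵐ ξ, ‖(𝓕 f : L2R) ξ‖ ≤ ∫ x, ‖f x‖ := by
  filter_upwards [coeFn_fourier_of_integrable f hf] with ξ h
  rw [h]
  exact VectorFourier.norm_fourierIntegral_le_integral_norm _ _ _ _ _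

/-- Complex conjugation on `L²(ℝ)`. -/
noncomputable def conjL2 : L2R →L[ℝ] L2R :=
  (Complex.conjCLE : ℂ →L[ℝ] ℂ).compLpL 2 volume

theorem coeFn_conjL2 (f : L2R) : (conjL2 f : ℝ → ℂ) =ᵐ[volume] fun x => (starRingEnd ℂ) (f x) :=
  (Complex.conjCLE : ℂ →L[ℝ] ℂ).coeFn_compLp f

theorem norm_conjL2 (f : L2R) : ‖conjL2 f‖ = ‖f‖ := by
  rw [Lp.norm_def, Lp.norm_def]
  congr 1
  refine eLpNorm_congr_norm_ae ?_
  filter_upwards [coeFn_conjL2 f] with x hx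
  simp [hx]

theorem conjL2_smul (c : ℂ) (f : L2R) : conjL2 (c • f) = (starRingEnd ℂ) c • conjL2 f := by
  refine Lp.ext ?_
  filter_upwards [coeFn_conjL2 f, coeFn_conjL2 (c • f), Lp.coeFn_smul c f,
    Lp.coeFn_smul ((starRingEnd ℂ) c) (conjL2 f)] with x h1 h2 h3 h4
  simp [h1, h2, h3, h4]

theorem norm_conjL2_apply (f : L2R) : ∀ᵐ x, ‖conjL2 f x‖ = ‖f x‖ := by
  filter_upwards [coeFn_conjL2 f] with x hx
  simp [hx]

theorem integrable_conjL2 {f : L2R} (hf : Integrable f) : Integrable (conjL2 f) :=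
  hf.mono (Lp.aestronglyMeasurable _) ((norm_conjL2_apply f).mono fun _ h => h.le)

theorem integral_norm_conjL2 (f : L2R) : ∫ x, ‖conjL2 f x‖ = ∫ x, ‖f x‖ :=
  integral_congr_ae (norm_conjL2_apply f)

/-- Both sides depend continuously on `f`, so Schwartz functions suffice; for them the Fourier
integral can be conjugated under the integral sign. -/
theorem coeFn_fourier_conjL2 (f : L2R) : ((𝓕 (conjL2 f) : L2R) : ℝ → ℂ)
    =ᵐ[volume] fun ξ => (starRingEnd ℂ) ((𝓕 f : L2R) (-ξ)) := by
  have hneg : MeasurePreserving (fun x : ℝ => -x) volume volume := Measure.measurePreserving_neg _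
  have key : 𝓕 (conjL2 f) = conjL2 (Lp.compMeasurePreserving _ hneg (𝓕 f)) := by
    refine DenseRange.induction_on
      (p := fun f : L2R => 𝓕 (conjL2 f) = conjL2 (Lp.compMeasurePreserving _ hneg (𝓕 f)))
      (SchwartzMap.denseRange_toLpCLM (p := 2) (F := ℂ) (E := ℝ) ENNReal.ofNat_ne_top) f ?_ ?_
    · refine isClosed_eq ?_ ?_
      · exact (Lp.fourierTransformₗᵢ ℝ ℂ).continuous.comp conjL2.continuous
      · exact conjL2.continuous.comp ((Lp.isometry_compMeasurePreserving hneg).continuous.comp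
          (Lp.fourierTransformₗᵢ ℝ ℂ).continuous)
    · intro g
      simp only [SchwartzMap.toLpCLM_apply]
      have hg1 : Integrable ((g.toLp 2 : L2R) : ℝ → ℂ) :=
        g.integrable.congr (g.coeFn_toLp 2 volume).symm
      have hg2 : Integrable (conjL2 (g.toLp 2 : L2R) : ℝ → ℂ) := integrable_conjL2 hg1
      refine Lp.ext ?_
      have h5 := hneg.quasiMeasurePreserving.ae (coeFn_fourier_of_integrable _ hg1)
      filter_upwards [coeFn_fourier_of_integrable _ hg2,
        coeFn_conjL2 (Lp.compMeasurePreserving _ hneg (𝓕 (g.toLp 2 : L2R))),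
        Lp.coeFn_compMeasurePreserving (𝓕 (g.toLp 2 : L2R)) hneg, h5] with ξ h1 h2 h3 h4
      rw [h1, h2, h3, Function.comp_apply, h4]
      simp only [Real.fourier_eq']
      rw [← integral_conj]
      refine integral_congr_ae ?_
      filter_upwards [coeFn_conjL2 (g.toLp 2 : L2R)] with x hx
      rw [hx, smul_eq_mul, smul_eq_mul, map_mul, ← Complex.exp_conj, map_mul, Complex.conj_ofReal,
        Complex.conj_I]
      simp
  rw [key]
  filter_upwards [coeFn_conjL2 (Lp.compMeasurePreserving _ hneg (𝓕 f)),
    Lp.coeFn_compMeasurePreserving (𝓕 f) hneg] with ξ h1 h2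
  rw [h1, h2, Function.comp_apply]

/-! ### The free Schrödinger group on `L²`: group law, unitarity, strong continuity. -/

theorem fourier_freeSchrodinger (t : ℝ) (f : L2R) : ((𝓕 (freeSchrodinger t f) : L2R) : ℝ → ℂ)
    =ᵐ[volume] fun ξ => schrodingerSymbol t ξ * (𝓕 f : L2R) ξ := by
  rw [freeSchrodinger, FourierTransform.fourier_fourierInv_eq]
  exact MemLp.coeFn_toLp _

theorem fourier_injective_L2 {f g : L2R}
    (h : ((𝓕 f : L2R) : ℝ → ℂ) =ᵐ[volume] (𝓕 g : L2R)) : f = g :=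
  (Lp.fourierTransformₗᵢ ℝ ℂ).injective (Lp.ext h)

theorem schrodingerSymbol_add (s t ξ : ℝ) :
    schrodingerSymbol (s + t) ξ = schrodingerSymbol s ξ * schrodingerSymbol t ξ := by
  rw [schrodingerSymbol, schrodingerSymbol, schrodingerSymbol, ← Complex.exp_add]
  congr 1
  push_cast
  ring

theorem schrodingerSymbol_zero (ξ : ℝ) : schrodingerSymbol 0 ξ = 1 := by
  simp [schrodingerSymbol]

theorem schrodingerSymbol_conj_neg (t ξ : ℝ) :
    (starRingEnd ℂ) (schrodingerSymbol t (-ξ)) = schrodingerSymbol (-t) ξ := by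
  rw [schrodingerSymbol, schrodingerSymbol, ← Complex.exp_conj, map_mul, Complex.conj_ofReal,
    Complex.conj_I]
  congr 1
  push_cast
  ring

theorem freeSchrodinger_add_right (t : ℝ) (f g : L2R) :
    freeSchrodinger t (f + g) = freeSchrodinger t f + freeSchrodinger t g := by
  refine fourier_injective_L2 ?_
  rw [FourierTransform.fourier_add]
  filter_upwards [fourier_freeSchrodinger t (f + g), fourier_freeSchrodinger t f,
    fourier_freeSchrodinger t g, Lp.coeFn_add (𝓕 f) (𝓕 g),
    Lp.coeFn_add (𝓕 (freeSchrodinger t f)) (𝓕 (freeSchrodinger t g))] with ξ h1 h2 h3 h4 h5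
  rw [FourierTransform.fourier_add] at h1
  simp only [h1, h2, h3, h4, h5, Pi.add_apply]
  ring

theorem freeSchrodinger_smul (t : ℝ) (c : ℂ) (f : L2R) :
    freeSchrodinger t (c • f) = c • freeSchrodinger t f := by
  refine fourier_injective_L2 ?_
  rw [FourierTransform.fourier_smul]
  filter_upwards [fourier_freeSchrodinger t (c • f), fourier_freeSchrodinger t f,
    Lp.coeFn_smul c (𝓕 f), Lp.coeFn_smul c (𝓕 (freeSchrodinger t f))] with ξ h1 h2 h3 h4
  rw [FourierTransform.fourier_smul] at h1
  simp only [h1, h2, h3, h4, Pi.smul_apply, smul_eq_mul]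
  ring

theorem norm_freeSchrodinger (t : ℝ) (f : L2R) : ‖freeSchrodinger t f‖ = ‖f‖ := by
  rw [← Lp.norm_fourier_eq (freeSchrodinger t f), ← Lp.norm_fourier_eq f, Lp.norm_def, Lp.norm_def]
  congr 1
  refine eLpNorm_congr_norm_ae ?_
  filter_upwards [fourier_freeSchrodinger t f] with ξ h
  simp [h, norm_schrodingerSymbol]

/-- The free Schrödinger evolution as a linear isometry. -/
noncomputable def freeSchrodingerLI (t : ℝ) : L2R →ₗᵢ[ℂ] L2R where
  toFun := freeSchrodinger t
  map_add' := freeSchrodinger_add_right t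
  map_smul' := freeSchrodinger_smul t
  norm_map' := norm_freeSchrodinger t

theorem freeSchrodinger_sub_right (t : ℝ) (f g : L2R) :
    freeSchrodinger t (f - g) = freeSchrodinger t f - freeSchrodinger t g :=
  map_sub (freeSchrodingerLI t) f g

theorem freeSchrodinger_freeSchrodinger (s t : ℝ) (f : L2R) :
    freeSchrodinger s (freeSchrodinger t f) = freeSchrodinger (s + t) f := by
  refine fourier_injective_L2 ?_
  filter_upwards [fourier_freeSchrodinger s (freeSchrodinger t f), fourier_freeSchrodinger t f,
    fourier_freeSchrodinger (s + t) f] with ξ h1 h2 h3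
  rw [h1, h2, h3, schrodingerSymbol_add, mul_assoc]

theorem freeSchrodinger_zero_left (f : L2R) : freeSchrodinger 0 f = f := by
  refine fourier_injective_L2 ?_
  filter_upwards [fourier_freeSchrodinger 0 f] with ξ h1
  rw [h1, schrodingerSymbol_zero, one_mul]

theorem conjL2_freeSchrodinger (t : ℝ) (f : L2R) :
    conjL2 (freeSchrodinger t f) = freeSchrodinger (-t) (conjL2 f) := by
  refine fourier_injective_L2 ?_
  have hneg : MeasurePreserving (fun x : ℝ => -x) volume volume := Measure.measurePreserving_neg _
  filter_upwards [coeFn_fourier_conjL2 (freeSchrodinger t f), coeFn_fourier_conjL2 f,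
    fourier_freeSchrodinger (-t) (conjL2 f),
    hneg.quasiMeasurePreserving.ae (fourier_freeSchrodinger t f)] with ξ h1 h2 h3 h4
  rw [h1, h3, h2, h4, map_mul, schrodingerSymbol_conj_neg]

/-- By Plancherel. Every matrix coefficient becomes the integral of the symbol against a fixed `L¹`
density; continuity in time, the dispersive estimate and the resonant bounds all start here. -/
theorem inner_freeSchrodinger (t : ℝ) (φ f : L2R) :
    inner ℂ φ (freeSchrodinger t f)
      = ∫ ξ, schrodingerSymbol t ξ * ((starRingEnd ℂ) ((𝓕 φ : L2R) ξ) * (𝓕 f : L2R) ξ) := by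
  rw [← Lp.inner_fourier_eq, L2.inner_def]
  refine integral_congr_ae ?_
  filter_upwards [fourier_freeSchrodinger t f] with ξ h
  rw [h, RCLike.inner_apply]
  ring

theorem integrable_conj_fourier_mul_fourier (φ f : L2R) :
    Integrable fun ξ => (starRingEnd ℂ) ((𝓕 φ : L2R) ξ) * (𝓕 f : L2R) ξ := by
  refine (L2.integrable_inner (𝕜 := ℂ) (𝓕 φ) (𝓕 f)).congr (Eventually.of_forall fun ξ => ?_)
  simp only [RCLike.inner_apply]
  ring

theorem continuous_schrodingerSymbol_left (ξ : ℝ) : Continuous fun t => schrodingerSymbol t ξ := by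
  unfold schrodingerSymbol
  fun_prop

theorem continuous_inner_freeSchrodinger (φ f : L2R) :
    Continuous fun t => inner ℂ φ (freeSchrodinger t f) := by
  simp only [inner_freeSchrodinger]
  refine continuous_of_dominated
    (bound := fun ξ => ‖(starRingEnd ℂ) ((𝓕 φ : L2R) ξ) * (𝓕 f : L2R) ξ‖) ?_ ?_ ?_ ?_
  · intro t
    exact (continuous_schrodingerSymbol t).aestronglyMeasurable.mul
      (integrable_conj_fourier_mul_fourier φ f).1
  · intro t
    refine Eventually.of_forall fun ξ => ?_
    rw [norm_mul, norm_schrodingerSymbol, one_mul]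
  · exact (integrable_conj_fourier_mul_fourier φ f).norm
  · exact Eventually.of_forall fun ξ => (continuous_schrodingerSymbol_left ξ).mul continuous_const

/-- Unitarity reduces strong continuity to continuity of a single matrix coefficient. -/
theorem norm_freeSchrodinger_sub_sq (s t : ℝ) (f : L2R) :
    ‖freeSchrodinger s f - freeSchrodinger t f‖ ^ 2
      = 2 * ‖f‖ ^ 2 - 2 * (inner ℂ f (freeSchrodinger (s - t) f)).re := by
  have h : freeSchrodinger s f - freeSchrodinger t f
      = freeSchrodinger t (freeSchrodinger (s - t) f - f) := by
    rw [freeSchrodinger_sub_right, freeSchrodinger_freeSchrodinger, add_sub_cancel]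
  rw [h, norm_freeSchrodinger, norm_sub_rev, @norm_sub_sq ℂ, norm_freeSchrodinger]
  simp only [RCLike.re_to_complex]
  ring

theorem continuous_freeSchrodinger_left (f : L2R) : Continuous fun t => freeSchrodinger t f := by
  rw [continuous_iff_continuousAt]
  intro t₁
  rw [ContinuousAt, tendsto_iff_norm_sub_tendsto_zero]
  have h2 : Tendsto (fun s => ‖freeSchrodinger s f - freeSchrodinger t₁ f‖ ^ 2)
      (nhds t₁) (nhds 0) := by
    simp only [norm_freeSchrodinger_sub_sq]
    have hc : Continuous fun s => 2 * ‖f‖ ^ 2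
        - 2 * (inner ℂ f (freeSchrodinger (s - t₁) f)).re :=
      continuous_const.sub (continuous_const.mul (Complex.continuous_re.comp
        ((continuous_inner_freeSchrodinger f f).comp (continuous_id.sub continuous_const))))
    have := hc.tendsto t₁
    rw [sub_self, freeSchrodinger_zero_left] at this
    convert this using 2
    rw [← RCLike.re_to_complex, inner_self_eq_norm_sq]
    ring
  have h3 := (Real.continuous_sqrt.tendsto 0).comp h2
  simp only [Real.sqrt_zero] at h3
  refine h3.congr fun s => ?_
  simp [Real.sqrt_sq]

theorem continuous_freeSchrodinger :
    Continuous fun p : ℝ × L2R => freeSchrodinger p.1 p.2 := by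
  rw [continuous_iff_continuousAt]
  rintro ⟨t₁, f₁⟩
  rw [ContinuousAt, tendsto_iff_norm_sub_tendsto_zero]
  have h1 : Tendsto (fun p : ℝ × L2R => ‖p.2 - f₁‖
      + ‖freeSchrodinger p.1 f₁ - freeSchrodinger t₁ f₁‖) (nhds (t₁, f₁)) (nhds 0) := by
    have hc : Continuous fun p : ℝ × L2R => ‖p.2 - f₁‖
      + ‖freeSchrodinger p.1 f₁ - freeSchrodinger t₁ f₁‖ :=
      (continuous_snd.sub continuous_const).norm.add
        (((continuous_freeSchrodinger_left f₁).comp continuous_fst).sub continuous_const).norm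
    simpa using hc.tendsto (t₁, f₁)
  refine squeeze_zero (fun _ => norm_nonneg _) (fun p => ?_) h1
  calc ‖freeSchrodinger p.1 p.2 - freeSchrodinger t₁ f₁‖
      = ‖freeSchrodinger p.1 (p.2 - f₁)
        + (freeSchrodinger p.1 f₁ - freeSchrodinger t₁ f₁)‖ := by
        rw [freeSchrodinger_sub_right]; abel_nf
    _ ≤ _ := (norm_add_le _ _).trans (by rw [norm_freeSchrodinger])

theorem inner_freeSchrodinger_left (t : ℝ) (φ f : L2R) :
    inner ℂ (freeSchrodinger t φ) f = inner ℂ φ (freeSchrodinger (-t) f) := by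
  have h : freeSchrodinger t (freeSchrodinger (-t) f) = f := by
    rw [freeSchrodinger_freeSchrodinger, add_neg_cancel, freeSchrodinger_zero_left]
  conv_lhs => rw [← h]
  exact (freeSchrodingerLI t).inner_map_map φ _

/-! ### Sup-norm bounds by duality with `L¹ ∩ L²`. -/

/-- The bound `‖f‖_{L^∞} ≤ M`, expressed by duality. -/
def LinftyLe (f : L2R) (M : ℝ) : Prop :=
  ∀ φ : L2R, Integrable φ → ‖inner ℂ φ f‖ ≤ M * ∫ x, ‖φ x‖

theorem LinftyLe.of_ae {f : L2R} {M : ℝ} (h : ∀ᵐ x, ‖f x‖ ≤ M) : LinftyLe f M := by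
  intro φ hφ
  rw [L2.inner_def, ← integral_const_mul]
  refine norm_integral_le_of_norm_le (hφ.norm.const_mul M) ?_
  filter_upwards [h] with x hx
  rw [RCLike.inner_apply, norm_mul, RCLike.norm_conj]
  exact mul_le_mul_of_nonneg_right hx (norm_nonneg _)

/-- Testing against the phase of `f` restricted to a set `s` of finite measure gives `∫_s ‖f‖ ≤ M
|s|`; this for all `s` forces the pointwise bound. -/
theorem LinftyLe.ae_le {f : L2R} {M : ℝ} (hM : 0 ≤ M) (h : LinftyLe f M) : ∀ᵐ x, ‖f x‖ ≤ M := by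
  have hfm : StronglyMeasurable f := Lp.stronglyMeasurable f
  have key : 0 ≤ᵐ[volume] fun x => M - ‖f x‖ := by
    refine ae_nonneg_of_forall_setIntegral_nonneg_of_sigmaFinite ?_ ?_
    · intro s hs hμ
      have : IsFiniteMeasure (volume.restrict s) := ⟨by simpa using hμ⟩
      exact (integrable_const M).sub
        ((((Lp.memLp f).restrict s).mono_exponent (p := 1) (by norm_num)).integrable le_rfl).norm
    · intro s hs hμ
      have : IsFiniteMeasure (volume.restrict s) := ⟨by simpa using hμ⟩
      have hi : Integrable (fun x => ‖f x‖) (volume.restrict s) :=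
        ((((Lp.memLp f).restrict s).mono_exponent (p := 1) (by norm_num)).integrable le_rfl).norm
      set g : ℝ → ℂ := s.indicator fun x => ((‖f x‖⁻¹ : ℝ) : ℂ) * f x with hg
      have hgm : StronglyMeasurable g := by
        refine StronglyMeasurable.indicator ?_ hs
        refine StronglyMeasurable.mul ?_ hfm
        exact (Complex.measurable_ofReal.comp hfm.norm.measurable.inv).stronglyMeasurable
      have hgb : ∀ x, ‖g x‖ ≤ s.indicator (fun _ => (1 : ℝ)) x := by
        intro x
        by_cases hx : x ∈ s
        · rw [hg, indicator_of_mem hx, indicator_of_mem hx, norm_mul, Complex.norm_real, norm_inv,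
            norm_norm]
          exact inv_mul_le_one
        · rw [hg, indicator_of_notMem hx, indicator_of_notMem hx, norm_zero]
      have hg1 : ∀ p : ℝ≥0∞, MemLp g p volume := fun p =>
        (memLp_indicator_const p hs (1 : ℝ) (Or.inr hμ.ne)).of_le hgm.aestronglyMeasurable
          (Eventually.of_forall fun x => (hgb x).trans (le_abs_self _))
      let φ : L2R := (hg1 2).toLp g
      have hφ : φ =ᵐ[volume] g := MemLp.coeFn_toLp _
      have hφi : Integrable φ := (memLp_one_iff_integrable.1 (hg1 1)).congr hφ.symm
      have h1 := h φ hφi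
      have h2 : inner ℂ φ f = ((∫ x in s, ‖f x‖ : ℝ) : ℂ) := by
        rw [L2.inner_def, ← integral_complex_ofReal, ← integral_indicator hs]
        refine integral_congr_ae ?_
        filter_upwards [hφ] with x hx
        rw [hx, RCLike.inner_apply]
        by_cases hxs : x ∈ s
        · rw [hg, indicator_of_mem hxs, indicator_of_mem hxs, map_mul, Complex.conj_ofReal,
            mul_left_comm, Complex.mul_conj, Complex.normSq_eq_norm_sq]
          rcases eq_or_ne (f x) 0 with h0 | h0
          · simp [h0]
          · have : ‖f x‖ ≠ 0 := norm_ne_zero_iff.2 h0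
            norm_cast
            field_simp
        · rw [hg, indicator_of_notMem hxs, indicator_of_notMem hxs, map_zero, mul_zero]
      have hMnn : ∫ x, ‖φ x‖ ≤ volume.real s := by
        have : ∫ x, s.indicator (fun _ => (1 : ℝ)) x = volume.real s := by
          rw [integral_indicator hs]; simp
        rw [← this]
        refine integral_mono_ae hφi.norm
          (memLp_one_iff_integrable.1 (memLp_indicator_const 1 hs (1 : ℝ) (Or.inr hμ.ne))) ?_
        filter_upwards [hφ] with x hx
        rw [hx]; exact hgb x
      rw [integral_sub (integrable_const M) hi, sub_nonneg]
      rw [h2, Complex.norm_real] at h1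
      refine (le_abs_self _).trans (h1.trans ?_)
      rw [integral_const, smul_eq_mul, mul_comm _ M, measureReal_restrict_apply MeasurableSet.univ,
        univ_inter]
      exact mul_le_mul_of_nonneg_left hMnn hM
  filter_upwards [key] with x hx
  simpa using hx

theorem LinftyLe.eLpNorm_le {f : L2R} {M : ℝ} (hM : 0 ≤ M) (h : LinftyLe f M) :
    eLpNorm f ∞ volume ≤ ENNReal.ofReal M := by
  rw [eLpNorm_exponent_top]
  exact eLpNormEssSup_le_of_ae_bound (h.ae_le hM)

theorem LinftyLe.of_eLpNorm_le {f : L2R} {M : ℝ} (hM : 0 ≤ M)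
    (h : eLpNorm f ∞ volume ≤ ENNReal.ofReal M) : LinftyLe f M := by
  refine LinftyLe.of_ae ?_
  rw [eLpNorm_exponent_top] at h
  filter_upwards [ae_le_eLpNormEssSup (f := f) (μ := volume)] with x hx
  have := hx.trans h
  rwa [← ofReal_norm, ENNReal.ofReal_le_ofReal_iff hM] at this

theorem LinftyLe.mono {f : L2R} {M N : ℝ} (h : LinftyLe f M) (hMN : M ≤ N) : LinftyLe f N :=
  fun φ hφ => (h φ hφ).trans
    (mul_le_mul_of_nonneg_right hMN (integral_nonneg fun _ => norm_nonneg _))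

theorem LinftyLe.add {f g : L2R} {M N : ℝ} (hf : LinftyLe f M) (hg : LinftyLe g N) :
    LinftyLe (f + g) (M + N) := by
  intro φ hφ
  rw [inner_add_right, add_mul]
  exact (norm_add_le _ _).trans (add_le_add (hf φ hφ) (hg φ hφ))

theorem LinftyLe.smul {f : L2R} {M : ℝ} (hf : LinftyLe f M) (c : ℂ) :
    LinftyLe (c • f) (‖c‖ * M) := by
  intro φ hφ
  rw [inner_smul_right, norm_mul, mul_assoc]
  exact mul_le_mul_of_nonneg_left (hf φ hφ) (norm_nonneg _)

theorem LinftyLe.smul_of_norm_eq_one {f : L2R} {M : ℝ} (hf : LinftyLe f M) {c : ℂ}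
    (hc : ‖c‖ = 1) : LinftyLe (c • f) M := by
  simpa [hc] using hf.smul c

theorem LinftyLe.conj {f : L2R} {M : ℝ} (hM : 0 ≤ M) (hf : LinftyLe f M) :
    LinftyLe (conjL2 f) M := by
  refine LinftyLe.of_ae ?_
  filter_upwards [hf.ae_le hM, norm_conjL2_apply f] with x h1 h2
  rwa [h2]

theorem LinftyLe.of_tendsto {ι : Type*} {l : Filter ι} [l.NeBot] {F : ι → L2R} {f : L2R} {M : ℝ}
    (hF : Tendsto F l (nhds f)) (h : ∀ᶠ i in l, LinftyLe (F i) M) : LinftyLe f M := by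
  intro φ hφ
  have h1 : Tendsto (fun i => ‖inner ℂ φ (F i)‖) l (nhds ‖inner ℂ φ f‖) :=
    (tendsto_const_nhds.inner hF).norm
  exact le_of_tendsto h1 (h.mono fun i hi => hi φ hφ)

/-- The dual form makes Minkowski's inequality immediate and avoids any measurability question for
`τ ↦ ‖F τ‖_∞`. -/
theorem LinftyLe.integral {μ : Measure ℝ} {F : ℝ → L2R} {m : ℝ → ℝ} (hF : Integrable F μ)
    (hm : Integrable m μ) (h : ∀ᵐ τ ∂μ, LinftyLe (F τ) (m τ)) :
    LinftyLe (∫ τ, F τ ∂μ) (∫ τ, m τ ∂μ) := by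
  intro φ hφ
  rw [← integral_inner hF, ← integral_mul_const]
  refine norm_integral_le_of_norm_le (hm.mul_const _) ?_
  filter_upwards [h] with τ hτ
  exact hτ φ hφ

theorem isClosed_setOf_linftyLe (M : ℝ) : IsClosed {f : L2R | LinftyLe f M} := by
  have : {f : L2R | LinftyLe f M}
      = ⋂ φ : L2R, ⋂ _ : Integrable φ, {f | ‖inner ℂ φ f‖ ≤ M * ∫ x, ‖φ x‖} := by
    ext f
    simp [LinftyLe]
  rw [this]
  refine isClosed_iInter fun φ => isClosed_iInter fun _ => isClosed_le ?_ continuous_const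
  exact (continuous_const.inner continuous_id).norm

/-- Sublevel sets are intersections of closed conditions, one per test function. This is what makes
the sup norm measurable in time along an `L²`-continuous curve. -/
theorem lowerSemicontinuous_eLpNorm_top :
    LowerSemicontinuous fun f : L2R => eLpNorm f ∞ volume := by
  refine lowerSemicontinuous_iff_isClosed_preimage.2 fun M => ?_
  induction M using ENNReal.recTopCoe with
  | top => simp
  | coe M =>
    have : (fun f : L2R => eLpNorm f ∞ volume) ⁻¹' Iic (M : ℝ≥0∞)
        = {f : L2R | LinftyLe f (M : ℝ)} := by
      ext f
      simp only [mem_preimage, mem_Iic, mem_ofPred_eq]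
      rw [← ENNReal.ofReal_coe_nnreal]
      exact ⟨LinftyLe.of_eLpNorm_le M.2, LinftyLe.eLpNorm_le M.2⟩
    rw [this]
    exact isClosed_setOf_linftyLe _

/-! ### The dispersive estimate. -/

theorem integral_fourier_mul_eq_flip {f g : ℝ → ℂ} (hf : Integrable f) (hg : Integrable g) :
    ∫ ξ, 𝓕 f ξ * g ξ = ∫ x, f x * 𝓕 g x := by
  have := VectorFourier.integral_fourierIntegral_smul_eq_flip (μ := (volume : Measure ℝ))
      (ν := (volume : Measure ℝ)) (L := innerₗ ℝ) (f := f) (g := g)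
      Real.continuous_fourierChar (by exact continuous_inner) hf hg
  rw [flip_innerₗ] at this
  exact this

theorem continuous_fourier_of_integrable {f : ℝ → ℂ} (hf : Integrable f) : Continuous (𝓕 f) :=
  VectorFourier.fourierIntegral_continuous Real.continuous_fourierChar
      (by exact continuous_inner) hf

theorem norm_fourier_le_integral_norm (f : ℝ → ℂ) (ξ : ℝ) : ‖𝓕 f ξ‖ ≤ ∫ x, ‖f x‖ :=
  VectorFourier.norm_fourierIntegral_le_integral_norm _ _ _ _ _

/-- The multiplier `e^{-πbξ²}` has the kernel `b^{-1/2} e^{-π(x-y)²/b}`, of modulus at most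
`|b|^{-1/2}` because `Re(1/b) ≥ 0`. The bound involves only `|b|`, so it survives as `b` approaches
the imaginary axis. -/
theorem norm_gaussian_fourier_pairing_le {b : ℂ} (hb : 0 < b.re) {f g : ℝ → ℂ}
    (hf : Integrable f) (hg : Integrable g) :
    ‖∫ ξ : ℝ, Complex.exp (-Real.pi * b * ξ ^ 2) * (𝓕 g (-ξ) * 𝓕 f ξ)‖
      ≤ ‖b‖ ^ (-(1 / 2) : ℝ) * ((∫ x, ‖g x‖) * ∫ x, ‖f x‖) := by
  have hGi : ∀ c : ℂ, Integrable fun ξ : ℝ =>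
      Complex.exp (-Real.pi * b * ξ ^ 2 + 2 * Real.pi * c * ξ) := by
    intro c
    have h : (-↑Real.pi * b).re < 0 := by
      simpa using mul_pos Real.pi_pos hb
    simpa using integrable_cexp_quadratic' h (2 * Real.pi * c) 0
  set G : ℝ → ℂ := fun ξ => Complex.exp (-Real.pi * b * ξ ^ 2) with hG
  have hGint : Integrable G := by simpa [hG] using hGi 0
  have hg' : Continuous (fun ξ => 𝓕 g (-ξ)) := (continuous_fourier_of_integrable hg).comp
    continuous_neg
  have hprod : Integrable fun ξ => G ξ * 𝓕 g (-ξ) := by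
    refine hGint.mul_bdd (c := ∫ x, ‖g x‖) hg'.aestronglyMeasurable ?_
    exact Eventually.of_forall fun ξ => norm_fourier_le_integral_norm g _
  have h1 : ∫ ξ : ℝ, G ξ * (𝓕 g (-ξ) * 𝓕 f ξ) = ∫ x, f x * 𝓕 (fun ξ => G ξ * 𝓕 g (-ξ)) x := by
    rw [← integral_fourier_mul_eq_flip hf hprod]
    refine integral_congr_ae (Eventually.of_forall fun ξ => ?_)
    simp only
    ring
  have h2 : ∀ x, ‖𝓕 (fun ξ => G ξ * 𝓕 g (-ξ)) x‖ ≤ ‖b‖ ^ (-(1 / 2) : ℝ) * ∫ x, ‖g x‖ := by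
    intro x
    have h3 : 𝓕 (fun ξ => G ξ * 𝓕 g (-ξ)) x
        = ∫ ξ : ℝ, 𝓕 g ξ * Complex.exp (-Real.pi * b * ξ ^ 2 + 2 * Real.pi * (Complex.I * x) * ξ) := by
      rw [Real.fourier_real_eq_integral_exp_smul, ← integral_neg_eq_self]
      refine integral_congr_ae (Eventually.of_forall fun ξ => ?_)
      simp only [hG, neg_neg, smul_eq_mul]
      rw [← mul_assoc, ← Complex.exp_add, mul_comm]
      congr 2
      push_cast
      ring
    rw [h3, integral_fourier_mul_eq_flip hg (hGi _), fourier_gaussian_pi' hb,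
    mul_comm (‖b‖ ^ _),
      ← integral_mul_const]
    refine norm_integral_le_of_norm_le (hg.norm.mul_const _) (Eventually.of_forall fun y => ?_)
    rw [norm_mul]
    refine mul_le_mul_of_nonneg_left ?_ (norm_nonneg _)
    rw [norm_mul, norm_div, norm_one, show ((1 : ℂ) / 2) = ((1 / 2 : ℝ) : ℂ) by push_cast; rfl,
      Complex.norm_cpow_real, Real.rpow_neg (norm_nonneg _), one_div]
    refine mul_le_of_le_one_right (by positivity) ?_
    rw [Complex.norm_exp, Real.exp_le_one_iff]
    have h4 : (-↑Real.pi / b * ((y : ℂ) + Complex.I * (Complex.I * x)) ^ 2)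
        = ((-Real.pi * (y - x) ^ 2 : ℝ) : ℂ) * b⁻¹ := by
      rw [← mul_assoc, Complex.I_mul_I]
      push_cast
      ring
    rw [h4, Complex.re_ofReal_mul, Complex.inv_re]
    have : 0 ≤ b.re / Complex.normSq b := div_nonneg hb.le (Complex.normSq_nonneg _)
    have h5 : 0 ≤ Real.pi * (y - x) ^ 2 := by positivity
    nlinarith
  rw [h1, ← mul_assoc, ← integral_const_mul]
  refine norm_integral_le_of_norm_le (hf.norm.const_mul _) (Eventually.of_forall fun x => ?_)
  rw [norm_mul, mul_comm]
  exact mul_le_mul_of_nonneg_right (h2 x) (norm_nonneg _)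

/-- The dispersive estimate for the free Schrödinger evolution. -/
theorem linftyLe_freeSchrodinger {t : ℝ} (ht : t ≠ 0) {f : L2R} (hf : Integrable f) :
    LinftyLe (freeSchrodinger t f) (|t| ^ (-(1 / 2) : ℝ) * ∫ x, ‖f x‖) := by
  intro φ hφ
  have hψ := integrable_conjL2 hφ
  have hconj : ∀ᵐ ξ, (starRingEnd ℂ) ((𝓕 φ : L2R) ξ) = 𝓕 (conjL2 φ : ℝ → ℂ) (-ξ) := by
    have hneg : MeasurePreserving (fun x : ℝ => -x) volume volume :=
      Measure.measurePreserving_neg _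
    filter_upwards [hneg.quasiMeasurePreserving.ae (coeFn_fourier_conjL2 φ),
      hneg.quasiMeasurePreserving.ae (coeFn_fourier_of_integrable _ hψ)] with ξ h1 h2
    rw [← h2, h1, neg_neg]
  -- The Schrödinger symbol is the limit of the Gaussians with `b = ε + 4πit`; the density is
  -- integrable and dominates.
  have hlim : Tendsto (fun ε : ℝ => ∫ ξ : ℝ,
      Complex.exp (-Real.pi * (ε + 4 * Real.pi * t * Complex.I) * ξ ^ 2)
        * (𝓕 (conjL2 φ : ℝ → ℂ) (-ξ) * 𝓕 (f : ℝ → ℂ) ξ))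
      (nhdsWithin 0 (Ioi 0)) (nhds (inner ℂ φ (freeSchrodinger t f))) := by
    rw [inner_freeSchrodinger]
    refine tendsto_integral_filter_of_dominated_convergence
      (fun ξ => ‖(starRingEnd ℂ) ((𝓕 φ : L2R) ξ) * (𝓕 f : L2R) ξ‖) ?_ ?_
      (integrable_conj_fourier_mul_fourier φ f).norm ?_
    · refine Eventually.of_forall fun ε => Continuous.aestronglyMeasurable ?_
      refine Continuous.mul (by fun_prop) (((continuous_fourier_of_integrable hψ).comp
        continuous_neg).mul (continuous_fourier_of_integrable hf))
    · filter_upwards [self_mem_nhdsWithin] with ε hε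
      filter_upwards [hconj, coeFn_fourier_of_integrable f hf] with ξ h1 h2
      rw [h1, h2, norm_mul]
      refine mul_le_of_le_one_left (norm_nonneg _) ?_
      rw [Complex.norm_exp, Real.exp_le_one_iff]
      have h4 : (-Real.pi * (ε + 4 * Real.pi * t * Complex.I) * ξ ^ 2 : ℂ)
          = ((-(Real.pi * ε * ξ ^ 2) : ℝ) : ℂ)
            + ((-Real.pi * (4 * Real.pi * t) * ξ ^ 2 : ℝ) : ℂ) * Complex.I := by
        push_cast; ring
      rw [h4, Complex.add_re, Complex.ofReal_re, Complex.re_ofReal_mul, Complex.I_re, mul_zero,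
        add_zero]
      have : 0 ≤ Real.pi * ε * ξ ^ 2 := by
        have : (0 : ℝ) < ε := hε
        positivity
      linarith
    · filter_upwards [hconj, coeFn_fourier_of_integrable f hf] with ξ h1 h2
      rw [h1, h2]
      refine Tendsto.mul_const _ ?_
      have hc : Continuous fun ε : ℝ =>
          Complex.exp (-Real.pi * (ε + 4 * Real.pi * t * Complex.I) * ξ ^ 2) := by fun_prop
      have := (hc.tendsto 0).mono_left (nhdsWithin_le_nhds (s := Ioi 0))
      convert this using 2
      rw [schrodingerSymbol]
      congr 1
      push_cast
      ring
  refine le_of_tendsto hlim.norm ?_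
  filter_upwards [self_mem_nhdsWithin] with ε hε
  have hb : 0 < ((ε : ℂ) + 4 * Real.pi * t * Complex.I).re := by
    have : (ε : ℂ) + 4 * Real.pi * t * Complex.I
      = (ε : ℂ) + ((4 * Real.pi * t : ℝ) : ℂ) * Complex.I := by push_cast; ring
    rw [this, Complex.add_re, Complex.re_ofReal_mul]
    simpa using hε
  refine (norm_gaussian_fourier_pairing_le hb hf hψ).trans ?_
  rw [integral_norm_conjL2, mul_comm (∫ x, ‖φ x‖), ← mul_assoc]
  refine mul_le_mul_of_nonneg_right (mul_le_mul_of_nonneg_right ?_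
    (integral_nonneg fun _ => norm_nonneg _)) (integral_nonneg fun _ => norm_nonneg _)
  -- `|b| ≥ |Im b| = 4π|t| ≥ |t|`; the sharp constant is not needed.
  refine Real.rpow_le_rpow_of_nonpos (abs_pos.2 ht) ?_ (by norm_num)
  have him : ((ε : ℂ) + 4 * Real.pi * t * Complex.I).im = 4 * Real.pi * t := by
    have : (ε : ℂ) + 4 * Real.pi * t * Complex.I
      = (ε : ℂ) + ((4 * Real.pi * t : ℝ) : ℂ) * Complex.I := by push_cast; ring
    rw [this, Complex.add_im, Complex.im_ofReal_mul]
    simp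
  refine le_trans ?_ (Complex.abs_im_le_norm _)
  rw [him, abs_mul, abs_of_pos (show 0 < 4 * Real.pi by positivity)]
  exact le_mul_of_one_le_left (abs_nonneg t) (by linarith [Real.pi_gt_three])

/-! ### Scalar oscillatory integrals with phase `α log τ + lτ`. -/

/-- The profile `min(|x|^{-1/4}, |x|^{-2})` that dominates the oscillatory integrals below. -/
noncomputable def oscMajorant (x : ℝ) : ℝ := if |x| ≤ 1 then |x| ^ (-(1 / 4) : ℝ) else |x| ^ (-2 : ℝ)

theorem norm_exp_ofReal_I (x : ℝ) : ‖Complex.exp ((x : ℂ) * Complex.I)‖ = 1 :=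
  Complex.norm_exp_ofReal_mul_I x

theorem continuousOn_oscillatory (α l : ℝ) : ContinuousOn
    (fun τ : ℝ => ((τ⁻¹ : ℝ) : ℂ) * Complex.exp (((α * Real.log τ + l * τ : ℝ) : ℂ) * Complex.I))
    (Ioi 0) := by
  have h1 : ContinuousOn (fun τ : ℝ => τ⁻¹) (Ioi 0) :=
    continuousOn_inv₀.mono fun x (hx : 0 < x) => hx.ne'
  have h2 : ContinuousOn Real.log (Ioi 0) :=
    Real.continuousOn_log.mono fun x (hx : 0 < x) => hx.ne'
  fun_prop

/-- One integration by parts against `e^{ilτ}` alone. The factor `e^{iα log τ}` stays in the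
amplitude, where differentiating it costs only another `|α|/τ`, so a stationary point of the full
phase does no harm. For `|α| ≤ 2` the boundary and integral terms add up to at most `4/(lt)`. -/
theorem norm_oscillatory_le_of_ibp {α l t T : ℝ} (hα : |α| ≤ 2) (hl : 0 < l) (ht : 0 < t)
    (htT : t ≤ T) :
    ‖∫ τ in t..T, ((τ⁻¹ : ℝ) : ℂ) *
      Complex.exp (((α * Real.log τ + l * τ : ℝ) : ℂ) * Complex.I)‖ ≤ 4 / (l * t) := by
  have hsub : uIcc t T ⊆ Ioi 0 := by
    rw [uIcc_of_le htT]; exact fun x hx => lt_of_lt_of_le ht hx.1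
  set E : ℝ → ℂ := fun τ => Complex.exp (((α * Real.log τ + l * τ : ℝ) : ℂ) * Complex.I) with hE
  have hEn : ∀ τ, ‖E τ‖ = 1 := fun τ => norm_exp_ofReal_I _
  have hinvc : ContinuousOn (fun τ : ℝ => τ⁻¹) (Ioi 0) :=
    continuousOn_inv₀.mono fun x (hx : 0 < x) => hx.ne'
  have hlogc : ContinuousOn Real.log (Ioi 0) :=
    Real.continuousOn_log.mono fun x (hx : 0 < x) => hx.ne'
  have hder : ∀ τ ∈ uIcc t T, HasDerivAt
      (fun τ : ℝ => ((τ⁻¹ : ℝ) : ℂ) * E τ * (Complex.I * l)⁻¹)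
      (((τ⁻¹ : ℝ) : ℂ) * E τ + ((τ ^ 2 : ℝ) : ℂ)⁻¹ * ((-1 + α * Complex.I) * (Complex.I * l)⁻¹ * E τ)) τ := by
    intro τ hτ
    have hτ0 : (0 : ℝ) < τ := hsub hτ
    have h1 : HasDerivAt (fun τ : ℝ => ((τ⁻¹ : ℝ) : ℂ)) ((-(τ ^ 2)⁻¹ : ℝ) : ℂ) τ :=
      (hasDerivAt_inv hτ0.ne').ofReal_comp
    have h2 : HasDerivAt (fun τ : ℝ => ((α * Real.log τ + l * τ : ℝ) : ℂ))
        ((α * τ⁻¹ + l * 1 : ℝ) : ℂ) τ :=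
      (((Real.hasDerivAt_log hτ0.ne').const_mul α).add ((hasDerivAt_id τ).const_mul l)).ofReal_comp
    have h3 := (h1.mul (h2.mul_const Complex.I).cexp).mul_const (Complex.I * (l : ℂ))⁻¹
    refine h3.congr_deriv ?_
    have hlC : (l : ℂ) ≠ 0 := by exact_mod_cast hl.ne'
    have hτC : (τ : ℂ) ≠ 0 := by exact_mod_cast hτ0.ne'
    have hI := Complex.I_ne_zero
    simp only [hE]
    push_cast
    field_simp
    ring
  have hc1 : ContinuousOn (fun τ : ℝ => ((τ⁻¹ : ℝ) : ℂ) * E τ) (uIcc t T) :=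
    (continuousOn_oscillatory α l).mono hsub
  have hc2 : ContinuousOn (fun τ : ℝ => ((τ ^ 2 : ℝ) : ℂ)⁻¹ *
      ((-1 + α * Complex.I) * (Complex.I * l)⁻¹ * E τ)) (uIcc t T) := by
    have h3 : ContinuousOn (fun τ : ℝ => ((τ ^ 2 : ℝ) : ℂ)⁻¹) (uIcc t T) := by
      refine ContinuousOn.inv₀ (by fun_prop) fun τ hτ => ?_
      have : (0 : ℝ) < τ := hsub hτ
      exact_mod_cast (pow_pos this 2).ne'
    have h4 : ContinuousOn E (uIcc t T) := by
      have := hlogc.mono hsub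
      fun_prop
    fun_prop
  have hi1 := hc1.intervalIntegrable (μ := volume)
  have hi2 := hc2.intervalIntegrable (μ := volume)
  have hFTC := intervalIntegral.integral_eq_sub_of_hasDerivAt hder (hi1.add hi2)
  rw [intervalIntegral.integral_add hi1 hi2] at hFTC
  have hT : 0 < T := ht.trans_le htT
  have hIl : ‖(Complex.I * (l : ℂ))⁻¹‖ = l⁻¹ := by
    simp [abs_of_pos hl]
  have hb2 : ‖∫ τ in t..T, ((τ ^ 2 : ℝ) : ℂ)⁻¹ *
      ((-1 + α * Complex.I) * (Complex.I * l)⁻¹ * E τ)‖ ≤ (t⁻¹ - T⁻¹) * ((1 + |α|) * l⁻¹) := by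
    have hder2 : ∀ τ ∈ uIcc t T, HasDerivAt (fun τ : ℝ => -τ⁻¹ * ((1 + |α|) * l⁻¹))
        ((τ ^ 2)⁻¹ * ((1 + |α|) * l⁻¹)) τ := by
      intro τ hτ
      have hτ0 : (0 : ℝ) < τ := hsub hτ
      exact (((hasDerivAt_inv hτ0.ne').neg).mul_const _).congr_deriv (by ring)
    have hc3 : ContinuousOn (fun τ : ℝ => (τ ^ 2)⁻¹ * ((1 + |α|) * l⁻¹)) (uIcc t T) := by
      refine ContinuousOn.mul (ContinuousOn.inv₀ (by fun_prop) fun τ hτ => ?_) (by fun_prop)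
      have : (0 : ℝ) < τ := hsub hτ
      positivity
    have hI2 := intervalIntegral.integral_eq_sub_of_hasDerivAt hder2 hc3.intervalIntegrable
    have : (t⁻¹ - T⁻¹) * ((1 + |α|) * l⁻¹) = ∫ τ in t..T, (τ ^ 2)⁻¹ * ((1 + |α|) * l⁻¹) := by
      rw [hI2]; ring
    rw [this]
    refine intervalIntegral.norm_integral_le_of_norm_le htT (Eventually.of_forall fun τ _ => ?_)
      hc3.intervalIntegrable
    rw [norm_mul, norm_mul, norm_mul, hEn, mul_one, norm_inv, Complex.norm_real, hIl, norm_pow,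
      Real.norm_eq_abs, sq_abs]
    refine mul_le_mul_of_nonneg_left (mul_le_mul_of_nonneg_right ?_ (by positivity))
      (by positivity)
    refine (norm_add_le _ _).trans ?_
    simp
  have hend : ‖((T⁻¹ : ℝ) : ℂ) * E T * (Complex.I * l)⁻¹ - ((t⁻¹ : ℝ) : ℂ) * E t * (Complex.I * l)⁻¹‖
      ≤ (T⁻¹ + t⁻¹) * l⁻¹ := by
    refine (norm_sub_le _ _).trans (le_of_eq ?_)
    rw [norm_mul, norm_mul, norm_mul, norm_mul, hEn, hEn, hIl, Complex.norm_real, Complex.norm_real,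
      Real.norm_of_nonneg (by positivity), Real.norm_of_nonneg (by positivity)]
    ring
  have hfin : ‖∫ τ in t..T, ((τ⁻¹ : ℝ) : ℂ) * E τ‖
      ≤ (T⁻¹ + t⁻¹) * l⁻¹ + (t⁻¹ - T⁻¹) * ((1 + |α|) * l⁻¹) := by
    rw [eq_sub_of_add_eq hFTC]
    exact (norm_sub_le _ _).trans (add_le_add hend hb2)
  refine hfin.trans ?_
  have h5 : T⁻¹ ≤ t⁻¹ := inv_anti₀ ht htT
  have h6 : 0 < l⁻¹ := inv_pos.2 hl
  have h7 : 0 < T⁻¹ := inv_pos.2 hT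
  have h8 : 4 / (l * t) = 4 * t⁻¹ * l⁻¹ := by field_simp
  rw [h8]
  have h9 : (T⁻¹ + t⁻¹) + (t⁻¹ - T⁻¹) * (1 + |α|) ≤ 4 * t⁻¹ := by
    nlinarith [abs_nonneg α, mul_nonneg (sub_nonneg.2 h5) (sub_nonneg.2 hα)]
  calc _ = ((T⁻¹ + t⁻¹) + (t⁻¹ - T⁻¹) * (1 + |α|)) * l⁻¹ := by ring
    _ ≤ _ := mul_le_mul_of_nonneg_right h9 h6.le

theorem norm_oscillatory_le_log {α l t T : ℝ} (ht : 0 < t) (htT : t ≤ T) :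
    ‖∫ τ in t..T, ((τ⁻¹ : ℝ) : ℂ) *
      Complex.exp (((α * Real.log τ + l * τ : ℝ) : ℂ) * Complex.I)‖ ≤ Real.log (T / t) := by
  rw [← integral_inv_of_pos ht (ht.trans_le htT)]
  refine intervalIntegral.norm_integral_le_of_norm_le htT (Eventually.of_forall fun τ hτ => ?_) ?_
  · rw [norm_mul, norm_exp_ofReal_I, mul_one, Complex.norm_real,
      Real.norm_of_nonneg (inv_nonneg.2 (ht.trans hτ.1).le)]
  · rw [intervalIntegrable_inv_iff]
    right
    rw [uIcc_of_le htT]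
    exact fun h => absurd h.1 (not_le.2 ht)

/-- The integral is cut at `τ = ξ⁻²`. Before it the modulus `1/τ` gives a logarithm of `1/(tξ²)`, at
most `8|x|^{-1/4}` with `x = √t ξ`; after it integration by parts gives at most `4`. The power
`-1/4` replaces the logarithm because its square is still integrable at `0`. -/
theorem norm_oscillatory_le {α l t T ξ : ℝ} (hα : |α| ≤ 2) (hξ : ξ ≠ 0) (hl : ξ ^ 2 ≤ l)
    (ht : 0 < t) (htT : t ≤ T) :
    ‖∫ τ in t..T, ((τ⁻¹ : ℝ) : ℂ) *
      Complex.exp (((α * Real.log τ + l * τ : ℝ) : ℂ) * Complex.I)‖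
      ≤ 12 * oscMajorant (Real.sqrt t * ξ) := by
  have hξ2 : 0 < ξ ^ 2 := by positivity
  have hl0 : 0 < l := hξ2.trans_le hl
  have hst : 0 < Real.sqrt t := Real.sqrt_pos.2 ht
  set x := |Real.sqrt t * ξ| with hx
  have hx0 : 0 < x := abs_pos.2 (mul_ne_zero hst.ne' hξ)
  have hx2 : x ^ 2 = t * ξ ^ 2 := by rw [hx, sq_abs, mul_pow, Real.sq_sqrt ht.le]
  have hbig : ∀ s, 0 < s → s ≤ T → ‖∫ τ in s..T, ((τ⁻¹ : ℝ) : ℂ) *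
      Complex.exp (((α * Real.log τ + l * τ : ℝ) : ℂ) * Complex.I)‖ ≤ 4 / (ξ ^ 2 * s) := by
    intro s hs hsT
    refine (norm_oscillatory_le_of_ibp hα hl0 hs hsT).trans ?_
    gcongr
  unfold oscMajorant
  rw [← hx]
  split_ifs with h1
  · have hrp : 1 ≤ x ^ (-(1 / 4) : ℝ) := by
      rw [Real.rpow_neg hx0.le]
      exact one_le_inv_iff₀.2 ⟨Real.rpow_pos_of_pos hx0 _,
        Real.rpow_le_one hx0.le h1 (by norm_num)⟩
    -- `log x⁻² = 2 log x⁻¹`, and `log y ≤ 4 y^{1/4}`.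
    have hlog : Real.log ((x ^ 2)⁻¹) ≤ 8 * x ^ (-(1 / 4) : ℝ) := by
      have := Real.log_le_rpow_div (x := x⁻¹) (inv_nonneg.2 hx0.le) (ε := 1 / 4) (by norm_num)
      rw [Real.inv_rpow hx0.le, ← Real.rpow_neg hx0.le] at this
      rw [← inv_pow, Real.log_pow]
      push_cast
      linarith
    have hlogle : ∀ s, 0 < s → s ≤ (ξ ^ 2)⁻¹ → Real.log (s / t) ≤ 8 * x ^ (-(1 / 4) : ℝ) := by
      intro s hs hs2
      refine (Real.log_le_log (by positivity) ?_).trans hlog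
      rw [hx2, mul_inv, mul_comm, ← div_eq_mul_inv]
      gcongr
    rcases le_total T (ξ ^ 2)⁻¹ with h2 | h2
    · refine (norm_oscillatory_le_log ht htT).trans ((hlogle T (ht.trans_le htT) h2).trans ?_)
      linarith
    · have ht2 : t ≤ (ξ ^ 2)⁻¹ := by
        rw [le_inv_comm₀ ht hξ2, ← one_div, le_div_iff₀ ht, mul_comm, ← hx2]
        exact pow_le_one₀ hx0.le h1
      have hi : ∀ p q, 0 < p → 0 < q → IntervalIntegrable (fun τ : ℝ => ((τ⁻¹ : ℝ) : ℂ) *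
          Complex.exp (((α * Real.log τ + l * τ : ℝ) : ℂ) * Complex.I)) volume p q := by
        intro p q hp hq
        refine ((continuousOn_oscillatory α l).mono ?_).intervalIntegrable
        exact fun y hy => lt_of_lt_of_le (lt_min hp hq) hy.1
      have hm : 0 < (ξ ^ 2)⁻¹ := inv_pos.2 hξ2
      rw [← intervalIntegral.integral_add_adjacent_intervals (hi t _ ht hm)
        (hi _ T hm (ht.trans_le htT))]
      refine (norm_add_le _ _).trans ?_
      have h3 := norm_oscillatory_le_log (α := α) (l := l) ht ht2
      have h4 := hbig _ hm h2
      rw [mul_inv_cancel₀ hξ2.ne'] at h4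
      have h5 := hlogle _ hm le_rfl
      linarith
  · refine (hbig t ht htT).trans ?_
    rw [Real.rpow_neg hx0.le, Real.rpow_two, hx2, mul_comm t, div_eq_mul_inv]
    have : 0 < (ξ ^ 2 * t)⁻¹ := by positivity
    linarith

theorem integrable_abs_piecewise_rpow {p q : ℝ} (hp : -1 < p) (hq : q < -1) :
    Integrable fun x : ℝ => if |x| ≤ 1 then |x| ^ p else |x| ^ q := by
  have h1 : IntegrableOn (fun x : ℝ => if |x| ≤ 1 then |x| ^ p else |x| ^ q) (Ioi 0) := by
    rw [← Ioc_union_Ioi_eq_Ioi zero_le_one]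
    refine IntegrableOn.union ?_ ?_
    · have := (intervalIntegral.intervalIntegrable_rpow' hp (a := 0) (b := 1)).1
      refine this.congr_fun (fun x hx => ?_) measurableSet_Ioc
      simp only [abs_of_pos hx.1, if_pos hx.2]
    · refine (integrableOn_Ioi_rpow_of_lt hq zero_lt_one).congr_fun (fun x hx => ?_)
        measurableSet_Ioi
      have h0 : (0 : ℝ) < x := zero_lt_one.trans hx
      simp only [abs_of_pos h0, if_neg (not_le.2 (show (1 : ℝ) < x from hx))]
  have h2 : IntegrableOn (fun x : ℝ => if |x| ≤ 1 then |x| ^ p else |x| ^ q) (Iic 0) := by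
    rw [← Measure.map_neg_eq_self (volume : Measure ℝ)]
    let m : MeasurableEmbedding fun x : ℝ => -x := (Homeomorph.neg ℝ).measurableEmbedding
    rw [m.integrableOn_map_iff]
    simp_rw [Function.comp_def, abs_neg, neg_preimage, neg_Iic, neg_zero]
    exact Iff.mpr integrableOn_Ici_iff_integrableOn_Ioi h1
  rw [← integrableOn_univ, ← Iic_union_Ioi (a := (0 : ℝ))]
  exact h2.union h1

theorem oscMajorant_nonneg (x : ℝ) : 0 ≤ oscMajorant x := by
  unfold oscMajorant
  split_ifs <;> positivity

theorem integrable_oscMajorant : Integrable oscMajorant :=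
  integrable_abs_piecewise_rpow (by norm_num) (by norm_num)

theorem integrable_oscMajorant_sq : Integrable fun x => oscMajorant x ^ 2 := by
  have := integrable_abs_piecewise_rpow (p := -(1 / 2)) (q := -4) (by norm_num) (by norm_num)
  refine this.congr (Eventually.of_forall fun x => ?_)
  simp only [oscMajorant]
  split_ifs
  · rw [← Real.rpow_two, ← Real.rpow_mul (abs_nonneg x)]; norm_num
  · rw [← Real.rpow_two, ← Real.rpow_mul (abs_nonneg x)]; norm_num

theorem integral_comp_sqrt_mul {f : ℝ → ℝ} {t : ℝ} (ht : 0 < t) :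
    ∫ ξ, f (Real.sqrt t * ξ) = t ^ (-(1 / 2) : ℝ) * ∫ x, f x := by
  rw [Measure.integral_comp_mul_left, smul_eq_mul, abs_of_pos (inv_pos.2 (Real.sqrt_pos.2 ht)),
    Real.sqrt_eq_rpow, Real.rpow_neg ht.le]

theorem memLp_oscMajorant_comp {t : ℝ} (ht : 0 < t) :
    MemLp (fun ξ => oscMajorant (Real.sqrt t * ξ)) 2 volume := by
  have h0 := (Real.sqrt_pos.2 ht).ne'
  rw [memLp_two_iff_integrable_sq]
  · exact integrable_oscMajorant_sq.comp_mul_left' h0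
  · exact (integrable_oscMajorant.comp_mul_left' h0).1

/-! ### The resonant Duhamel integral over a finite time interval. -/

theorem norm_sq_eq_integral (f : L2R) : ‖f‖ ^ 2 = ∫ x, ‖f x‖ ^ 2 := by
  rw [← @inner_self_eq_norm_sq ℂ, L2.inner_def, ← integral_re (L2.integrable_inner f f)]
  refine integral_congr_ae (Eventually.of_forall fun x => ?_)
  simp only [inner_self_eq_norm_sq]

theorem integral_norm_fourier_mul_le (f : L2R) {H : ℝ → ℝ} (hH0 : ∀ x, 0 ≤ H x)
    (hH : MemLp H 2 volume) :
    ∫ ξ, ‖(𝓕 f : L2R) ξ‖ * H ξ ≤ ‖f‖ * Real.sqrt (∫ ξ, H ξ ^ 2) := by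
  have h := integral_mul_le_Lp_mul_Lq_of_nonneg (μ := volume) (p := 2) (q := 2)
    Real.HolderConjugate.two_two
    (f := fun ξ => ‖(𝓕 f : L2R) ξ‖) (g := H) (Eventually.of_forall fun _ => norm_nonneg _)
    (Eventually.of_forall hH0) (by simpa using (Lp.memLp (𝓕 f)).norm) (by simpa using hH)
  refine h.trans (le_of_eq ?_)
  simp only [Real.rpow_two]
  rw [← norm_sq_eq_integral, ← Real.sqrt_eq_rpow, ← Real.sqrt_eq_rpow,
    Real.sqrt_sq (norm_nonneg _), Lp.norm_fourier_eq]

/-- The phase `e^{i c log τ}`. -/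
noncomputable def gaugePhase (c τ : ℝ) : ℂ := Complex.exp (((c * Real.log τ : ℝ) : ℂ) * Complex.I)

theorem norm_gaugePhase (c τ : ℝ) : ‖gaugePhase c τ‖ = 1 := norm_exp_ofReal_I _

theorem gaugePhase_add (c d τ : ℝ) : gaugePhase (c + d) τ = gaugePhase c τ * gaugePhase d τ := by
  rw [gaugePhase, gaugePhase, gaugePhase, ← Complex.exp_add]
  congr 1
  push_cast
  ring

theorem gaugePhase_zero (τ : ℝ) : gaugePhase 0 τ = 1 := by simp [gaugePhase]

theorem conj_gaugePhase (c τ : ℝ) : (starRingEnd ℂ) (gaugePhase c τ) = gaugePhase (-c) τ := by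
  rw [gaugePhase, gaugePhase, ← Complex.exp_conj, map_mul, Complex.conj_ofReal, Complex.conj_I]
  congr 1
  push_cast
  ring

theorem continuousOn_gaugePhase (c : ℝ) : ContinuousOn (gaugePhase c) (Ioi 0) := by
  have h2 : ContinuousOn Real.log (Ioi 0) :=
    Real.continuousOn_log.mono fun x (hx : 0 < x) => hx.ne'
  unfold gaugePhase
  fun_prop

/-- The integrand `τ⁻¹ e^{-2ic log τ} e^{-2iτ∂ₛ²} g` of the resonant Duhamel term. -/
noncomputable def resonantIntegrand (c : ℝ) (g : L2R) (τ : ℝ) : L2R :=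
  (((τ⁻¹ : ℝ) : ℂ) * gaugePhase (-(2 * c)) τ) • freeSchrodinger (-(2 * τ)) g

theorem norm_resonantIntegrand (c : ℝ) (g : L2R) {τ : ℝ} (hτ : 0 < τ) :
    ‖resonantIntegrand c g τ‖ = τ⁻¹ * ‖g‖ := by
  rw [resonantIntegrand, norm_smul, norm_mul, norm_gaugePhase, norm_freeSchrodinger, mul_one,
    Complex.norm_real, Real.norm_of_nonneg (inv_nonneg.2 hτ.le)]

theorem continuousOn_resonantIntegrand {s : Set ℝ} (hs : s ⊆ Ioi 0) (c : ℝ) {g : ℝ → L2R}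
    (hg : ContinuousOn g s) : ContinuousOn (fun τ => resonantIntegrand c (g τ) τ) s := by
  unfold resonantIntegrand
  have h1 : ContinuousOn (fun τ : ℝ => τ⁻¹) s :=
    continuousOn_inv₀.mono fun x hx => (hs hx : (0 : ℝ) < x).ne'
  have h2 := (continuousOn_gaugePhase (-(2 * c))).mono hs
  have h3 : ContinuousOn (fun τ => freeSchrodinger (-(2 * τ)) (g τ)) s :=
    continuous_freeSchrodinger.comp_continuousOn
      (f := fun τ => (-(2 * τ), g τ)) (by fun_prop)
  fun_prop

/-- The resonant Duhamel term `∫_t^T τ⁻¹ e^{-2ic log τ} e^{-2iτ∂ₛ²} g dτ`. -/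
noncomputable def resonantDuhamel (c t T : ℝ) (g : L2R) : L2R :=
  ∫ τ in t..T, resonantIntegrand c g τ

/-- Fubini: on the Fourier side the operator is multiplication by the scalar oscillatory integral
with `α = -2c` and `l = 8π²ξ² ≥ ξ²`. -/
theorem inner_resonantDuhamel (c : ℝ) {t T : ℝ} (ht : 0 < t) (htT : t ≤ T) (φ g : L2R) :
    inner ℂ φ (resonantDuhamel c t T g)
      = ∫ ξ, ((starRingEnd ℂ) ((𝓕 φ : L2R) ξ) * (𝓕 g : L2R) ξ) *
        ∫ τ in t..T, ((τ⁻¹ : ℝ) : ℂ) * Complex.exp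
          (((-(2 * c) * Real.log τ + (8 * Real.pi ^ 2 * ξ ^ 2) * τ : ℝ) : ℂ) * Complex.I) := by
  have hsub : uIcc t T ⊆ Ioi 0 := by
    rw [uIcc_of_le htT]; exact fun x hx => lt_of_lt_of_le ht hx.1
  have hi : IntervalIntegrable (resonantIntegrand c g) volume t T :=
    (continuousOn_resonantIntegrand hsub c continuousOn_const).intervalIntegrable
  set w : ℝ → ℂ := fun ξ => (starRingEnd ℂ) ((𝓕 φ : L2R) ξ) * (𝓕 g : L2R) ξ with hw
  have hwi : Integrable w := integrable_conj_fourier_mul_fourier φ g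
  rw [resonantDuhamel, intervalIntegral.integral_of_le htT, ← integral_inner hi.1]
  have h1 : ∀ τ, inner ℂ φ (resonantIntegrand c g τ) = ∫ ξ, w ξ * (((τ⁻¹ : ℝ) : ℂ) * Complex.exp
      (((-(2 * c) * Real.log τ + (8 * Real.pi ^ 2 * ξ ^ 2) * τ : ℝ) : ℂ) * Complex.I)) := by
    intro τ
    rw [resonantIntegrand, inner_smul_right, inner_freeSchrodinger, ← integral_const_mul]
    refine integral_congr_ae (Eventually.of_forall fun ξ => ?_)
    have h2 : gaugePhase (-(2 * c)) τ * schrodingerSymbol (-(2 * τ)) ξ = Complex.exp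
      (((-(2 * c) * Real.log τ + (8 * Real.pi ^ 2 * ξ ^ 2) * τ : ℝ) : ℂ) * Complex.I) := by
      rw [gaugePhase, schrodingerSymbol, ← Complex.exp_add]
      congr 1
      push_cast
      ring
    simp only [hw]
    rw [← h2]
    ring
  simp only [h1]
  rw [integral_integral_swap]
  · refine integral_congr_ae (Eventually.of_forall fun ξ => ?_)
    simp only
    rw [intervalIntegral.integral_of_le htT, integral_const_mul]
  · clear_value w
    have hdom : Integrable (fun p : ℝ × ℝ => t⁻¹ * ‖w p.2‖)
        ((volume.restrict (Ioc t T)).prod volume) :=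
      (integrable_const t⁻¹).mul_prod hwi.norm
    refine hdom.mono ?_ ?_
    · refine AEStronglyMeasurable.mul hwi.1.comp_snd ?_
      refine Measurable.aestronglyMeasurable ?_
      fun_prop
    · have : ∀ᵐ p : ℝ × ℝ ∂((volume.restrict (Ioc t T)).prod volume), p.1 ∈ Ioc t T := by
        refine Measure.quasiMeasurePreserving_fst.ae ?_
        exact ae_restrict_mem measurableSet_Ioc
      filter_upwards [this] with p hp
      rw [Function.uncurry_def, norm_mul, norm_mul, norm_exp_ofReal_I, mul_one, norm_mul,
        norm_norm, mul_comm, Complex.norm_real]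
      have h0 : 0 < p.1 := ht.trans hp.1
      refine mul_le_mul_of_nonneg_right ?_ (norm_nonneg _)
      rw [Real.norm_of_nonneg (inv_pos.2 h0).le, Real.norm_of_nonneg (inv_pos.2 ht).le]
      exact inv_anti₀ ht hp.1.le

theorem norm_inner_resonantDuhamel_le {c : ℝ} (hc : |c| ≤ 1) {t T : ℝ} (ht : 0 < t) (htT : t ≤ T)
    (φ g : L2R) {B : ℝ → ℝ} (hB : Integrable B)
    (h : ∀ᵐ ξ, ‖(𝓕 φ : L2R) ξ‖ * ‖(𝓕 g : L2R) ξ‖ * oscMajorant (Real.sqrt t * ξ) ≤ B ξ) :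
    ‖inner ℂ φ (resonantDuhamel c t T g)‖ ≤ 12 * ∫ ξ, B ξ := by
  rw [inner_resonantDuhamel c ht htT, ← integral_const_mul]
  refine norm_integral_le_of_norm_le (hB.const_mul 12) ?_
  have h0 : ∀ᵐ ξ : ℝ, ξ ≠ 0 := by
    simp [ae_iff]
  filter_upwards [h, h0] with ξ hξ hξ0
  rw [norm_mul, norm_mul, RCLike.norm_conj]
  have hα : |-(2 * c)| ≤ 2 := by
    rw [abs_neg, abs_mul, abs_two]; linarith
  have hl : ξ ^ 2 ≤ 8 * Real.pi ^ 2 * ξ ^ 2 := by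
    refine le_mul_of_one_le_left (sq_nonneg ξ) ?_
    nlinarith [Real.pi_gt_three]
  have h2 := norm_oscillatory_le hα hξ0 hl ht htT
  calc _ ≤ ‖(𝓕 φ : L2R) ξ‖ * ‖(𝓕 g : L2R) ξ‖ * (12 * oscMajorant (Real.sqrt t * ξ)) :=
        mul_le_mul_of_nonneg_left h2 (by positivity)
    _ ≤ 12 * B ξ := by linarith

/-- A constant for the decay estimates of the resonant Duhamel term. -/
noncomputable def resonantConst : ℝ :=
  12 * (∫ x, oscMajorant x) + 12 * Real.sqrt (∫ x, oscMajorant x ^ 2)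

theorem resonantConst_nonneg : 0 ≤ resonantConst := by
  have : 0 ≤ ∫ x, oscMajorant x := integral_nonneg oscMajorant_nonneg
  unfold resonantConst
  positivity

/-- When both transforms are bounded the majorant is integrated directly, and the rescaling `x = √t
ξ` produces `t^{-1/2}`. -/
theorem norm_inner_resonantDuhamel_le_of_fourier_bounded {c : ℝ} (hc : |c| ≤ 1) {t T : ℝ}
    (ht : 0 < t) (htT : t ≤ T) {φ g : L2R} {A : ℝ} (hA : 0 ≤ A)
    (h : ∀ᵐ ξ, ‖(𝓕 φ : L2R) ξ‖ * ‖(𝓕 g : L2R) ξ‖ ≤ A) :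
    ‖inner ℂ φ (resonantDuhamel c t T g)‖ ≤ resonantConst * t ^ (-(1 / 2) : ℝ) * A := by
  have hst := (Real.sqrt_pos.2 ht).ne'
  refine (norm_inner_resonantDuhamel_le hc ht htT φ g
    (B := fun ξ => A * oscMajorant (Real.sqrt t * ξ))
    ((integrable_oscMajorant.comp_mul_left' hst).const_mul _) ?_).trans ?_
  · filter_upwards [h] with ξ h1
    exact mul_le_mul_of_nonneg_right h1 (oscMajorant_nonneg _)
  · rw [integral_const_mul, integral_comp_sqrt_mul ht]
    have h3 : 0 ≤ Real.sqrt (∫ x, oscMajorant x ^ 2) := Real.sqrt_nonneg _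
    have h4 : 0 ≤ t ^ (-(1 / 2) : ℝ) * A := by positivity
    unfold resonantConst
    nlinarith [mul_nonneg h3 h4]

/-- Here one factor is bounded and the other, `ψ`, is measured in `L²`. Cauchy–Schwarz against the
rescaled majorant, whose `L²` norm scales like `t^{-1/4}`, costs half the decay. `ψ` may come from
either slot, which serves both the `L¹ → L²` and the `L² → L^∞` bound. -/
theorem norm_inner_resonantDuhamel_le_of_fourier_le {c : ℝ} (hc : |c| ≤ 1) {t T : ℝ} (ht : 0 < t)
    (htT : t ≤ T) {φ g ψ : L2R} {A : ℝ} (hA : 0 ≤ A)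
    (h : ∀ᵐ ξ, ‖(𝓕 φ : L2R) ξ‖ * ‖(𝓕 g : L2R) ξ‖ ≤ A * ‖(𝓕 ψ : L2R) ξ‖) :
    ‖inner ℂ φ (resonantDuhamel c t T g)‖
      ≤ resonantConst * t ^ (-(1 / 4) : ℝ) * A * ‖ψ‖ := by
  have hH := memLp_oscMajorant_comp ht
  refine (norm_inner_resonantDuhamel_le hc ht htT φ g
    (B := fun ξ => A * (‖(𝓕 ψ : L2R) ξ‖ * oscMajorant (Real.sqrt t * ξ)))
    (((Lp.memLp (𝓕 ψ)).norm.integrable_mul hH).const_mul A) ?_).trans ?_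
  · filter_upwards [h] with ξ h1
    rw [← mul_assoc]
    exact mul_le_mul_of_nonneg_right h1 (oscMajorant_nonneg _)
  · rw [integral_const_mul]
    have h1 := integral_norm_fourier_mul_le ψ (fun x => oscMajorant_nonneg _) hH
    rw [integral_comp_sqrt_mul (f := fun x => oscMajorant x ^ 2) ht,
      Real.sqrt_mul (by positivity), Real.sqrt_eq_rpow (t ^ _), ← Real.rpow_mul ht.le] at h1
    norm_num at h1
    have h2 : 0 ≤ ∫ x, oscMajorant x := integral_nonneg oscMajorant_nonneg
    have h3 : 0 ≤ (t ^ (-(1 / 4) : ℝ)) * A * ‖ψ‖ := by positivity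
    have h4 := mul_le_mul_of_nonneg_left h1 hA
    unfold resonantConst
    norm_num
    norm_num at h3
    nlinarith [mul_nonneg h2 h3]

/-! ### Sup-norm bounds along the whole free flow, and their use for the resonant integral. -/

/-- A uniform `L^∞` bound along the whole free evolution of `f`. -/
def FlowLinftyLe (f : L2R) (M : ℝ) : Prop :=
  ∀ s, LinftyLe (freeSchrodinger s f) M

theorem FlowLinftyLe.mono {f : L2R} {M N : ℝ} (h : FlowLinftyLe f M) (hMN : M ≤ N) :
    FlowLinftyLe f N := fun s => (h s).mono hMN

theorem FlowLinftyLe.add {f g : L2R} {M N : ℝ} (hf : FlowLinftyLe f M) (hg : FlowLinftyLe g N) :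
    FlowLinftyLe (f + g) (M + N) := by
  intro s
  rw [freeSchrodinger_add_right]
  exact (hf s).add (hg s)

theorem FlowLinftyLe.smul {f : L2R} {M : ℝ} (hf : FlowLinftyLe f M) (c : ℂ) :
    FlowLinftyLe (c • f) (‖c‖ * M) := by
  intro s
  rw [freeSchrodinger_smul]
  exact (hf s).smul c

theorem FlowLinftyLe.conj {f : L2R} {M : ℝ} (hM : 0 ≤ M) (hf : FlowLinftyLe f M) :
    FlowLinftyLe (conjL2 f) M := by
  intro s
  have := (hf (-s)).conj hM
  rwa [conjL2_freeSchrodinger, neg_neg] at this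

theorem FlowLinftyLe.flow {f : L2R} {M : ℝ} (hf : FlowLinftyLe f M) (t : ℝ) :
    FlowLinftyLe (freeSchrodinger t f) M := by
  intro s
  rw [freeSchrodinger_freeSchrodinger]
  exact hf _

theorem FlowLinftyLe.of_tendsto {ι : Type*} {l : Filter ι} [l.NeBot] {F : ι → L2R} {f : L2R}
    {M : ℝ} (hF : Tendsto F l (nhds f)) (h : ∀ᶠ i in l, FlowLinftyLe (F i) M) :
    FlowLinftyLe f M := fun s =>
  LinftyLe.of_tendsto (((freeSchrodingerLI s).continuous.tendsto f).comp hF)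
    (h.mono fun _ hi => hi s)

theorem freeSchrodinger_integral {μ : Measure ℝ} {F : ℝ → L2R} (hF : Integrable F μ) (s : ℝ) :
    freeSchrodinger s (∫ τ, F τ ∂μ) = ∫ τ, freeSchrodinger s (F τ) ∂μ :=
  (((freeSchrodingerLI s).toContinuousLinearMap).integral_comp_comm hF).symm

theorem integrable_freeSchrodinger {μ : Measure ℝ} {F : ℝ → L2R} (hF : Integrable F μ) (s : ℝ) :
    Integrable (fun τ => freeSchrodinger s (F τ)) μ :=
  ((freeSchrodingerLI s).toContinuousLinearMap).integrable_comp hF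

theorem FlowLinftyLe.integral {μ : Measure ℝ} {F : ℝ → L2R} {m : ℝ → ℝ} (hF : Integrable F μ)
    (hm : Integrable m μ) (h : ∀ᵐ τ ∂μ, FlowLinftyLe (F τ) (m τ)) :
    FlowLinftyLe (∫ τ, F τ ∂μ) (∫ τ, m τ ∂μ) := by
  intro s
  rw [freeSchrodinger_integral hF]
  exact LinftyLe.integral (integrable_freeSchrodinger hF s) hm (h.mono fun τ hτ => hτ s)

theorem norm_fourier_freeSchrodinger (t : ℝ) (f : L2R) :
    ∀ᵐ ξ, ‖(𝓕 (freeSchrodinger t f) : L2R) ξ‖ = ‖(𝓕 f : L2R) ξ‖ := by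
  filter_upwards [fourier_freeSchrodinger t f] with ξ h
  rw [h, norm_mul, norm_schrodingerSymbol, one_mul]

/-- The flow is moved onto the test function, where it changes only the phase of the Fourier
transform. The pairing bound sees only moduli, hence the uniformity in `s`. -/
theorem flowLinftyLe_resonantDuhamel_of_integrable {c : ℝ} (hc : |c| ≤ 1) {t T : ℝ} (ht : 0 < t)
    (htT : t ≤ T) {g : L2R} (hg : Integrable g) :
    FlowLinftyLe (resonantDuhamel c t T g) (resonantConst * t ^ (-(1 / 2) : ℝ) * ∫ x, ‖g x‖) := by
  intro s φ hφ
  have hφ0 : 0 ≤ ∫ x, ‖φ x‖ := integral_nonneg fun _ => norm_nonneg _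
  have hg0 : 0 ≤ ∫ x, ‖g x‖ := integral_nonneg fun _ => norm_nonneg _
  have h := inner_freeSchrodinger_left (-s) φ (resonantDuhamel c t T g)
  rw [neg_neg] at h
  rw [← h, mul_assoc]
  refine norm_inner_resonantDuhamel_le_of_fourier_bounded hc ht htT (mul_nonneg hg0 hφ0) ?_
  filter_upwards [norm_fourier_freeSchrodinger (-s) φ, norm_fourier_le_of_integrable φ hφ,
    norm_fourier_le_of_integrable g hg] with ξ h1 h2 h3
  rw [h1, mul_comm]
  exact mul_le_mul h3 h2 (norm_nonneg _) hg0

theorem flowLinftyLe_resonantDuhamel {c : ℝ} (hc : |c| ≤ 1) {t T : ℝ} (ht : 0 < t)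
    (htT : t ≤ T) (g : L2R) :
    FlowLinftyLe (resonantDuhamel c t T g) (resonantConst * t ^ (-(1 / 4) : ℝ) * ‖g‖) := by
  intro s φ hφ
  have hφ0 : 0 ≤ ∫ x, ‖φ x‖ := integral_nonneg fun _ => norm_nonneg _
  have h := inner_freeSchrodinger_left (-s) φ (resonantDuhamel c t T g)
  rw [neg_neg] at h
  rw [← h, mul_right_comm]
  refine norm_inner_resonantDuhamel_le_of_fourier_le hc ht htT hφ0 ?_
  filter_upwards [norm_fourier_freeSchrodinger (-s) φ, norm_fourier_le_of_integrable φ hφ]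
    with ξ h1 h2
  rw [h1]
  exact mul_le_mul_of_nonneg_right h2 (norm_nonneg _)

/-- The output is paired with itself and one factor of its norm is cancelled. -/
theorem norm_resonantDuhamel_le {c : ℝ} (hc : |c| ≤ 1) {t T : ℝ} (ht : 0 < t)
    (htT : t ≤ T) {g : L2R} (hg : Integrable g) :
    ‖resonantDuhamel c t T g‖ ≤ resonantConst * t ^ (-(1 / 4) : ℝ) * ∫ x, ‖g x‖ := by
  have hg0 : 0 ≤ ∫ x, ‖g x‖ := integral_nonneg fun _ => norm_nonneg _
  set k := resonantDuhamel c t T g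
  have h := norm_inner_resonantDuhamel_le_of_fourier_le hc ht htT (φ := k) (g := g) (ψ := k) hg0 (by
    filter_upwards [norm_fourier_le_of_integrable g hg] with ξ h1
    rw [mul_comm]
    exact mul_le_mul_of_nonneg_right h1 (norm_nonneg _))
  rw [inner_self_eq_norm_sq_to_K] at h
  norm_num at h
  rcases eq_or_lt_of_le (norm_nonneg k) with h0 | h0
  · rw [← h0]
    have := resonantConst_nonneg
    positivity
  · norm_num
    exact le_of_mul_le_mul_right (by nlinarith) h0

theorem intervalIntegrable_resonantIntegrand (c : ℝ) (g : L2R) {t T : ℝ} (ht : 0 < t)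
    (hT : 0 < T) : IntervalIntegrable (resonantIntegrand c g) volume t T := by
  refine (continuousOn_resonantIntegrand (fun x hx => ?_) c continuousOn_const).intervalIntegrable
  exact lt_of_lt_of_le (lt_min ht hT) hx.1

theorem resonantDuhamel_add (c : ℝ) (g : L2R) {r s t : ℝ} (hr : 0 < r) (hs : 0 < s) (ht : 0 < t) :
    resonantDuhamel c r s g + resonantDuhamel c s t g = resonantDuhamel c r t g :=
  intervalIntegral.integral_add_adjacent_intervals
    (intervalIntegrable_resonantIntegrand c g hr hs) (intervalIntegrable_resonantIntegrand c g hs ht)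

/-! ### The resonant integral up to infinite time. -/

/-- The improper integral `∫_t^∞ τ⁻¹ e^{-2ic log τ} e^{-2iτ∂ₛ²} g dτ`. -/
noncomputable def resonantTail (c t : ℝ) (g : L2R) : L2R :=
  limUnder atTop fun T => resonantDuhamel c t T g

/-- The integrand has norm `‖g‖/τ`, so convergence is only conditional: the Cauchy property comes
from the oscillatory bound on `[N, n]`, which requires `g ∈ L¹`. This is why the tail is a limit and
not a Bochner integral. -/
theorem tendsto_resonantDuhamel {c : ℝ} (hc : |c| ≤ 1) {t : ℝ} (ht : 0 < t) {g : L2R}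
    (hg : Integrable g) :
    Tendsto (fun T => resonantDuhamel c t T g) atTop (nhds (resonantTail c t g)) := by
  refine CauchySeq.tendsto_limUnder ?_
  have hlim : Tendsto (fun N : ℝ => resonantConst * N ^ (-(1 / 4) : ℝ) * ∫ x, ‖g x‖) atTop
      (nhds 0) := by
    have := ((tendsto_rpow_neg_atTop (y := 1 / 4) (by norm_num)).const_mul resonantConst).mul_const
      (∫ x, ‖g x‖)
    simpa using this
  rw [Metric.cauchySeq_iff']
  intro ε hε
  obtain ⟨N, hN, hNt⟩ := ((hlim.eventually (gt_mem_nhds hε)).and (eventually_ge_atTop t)).exists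
  refine ⟨N, fun n hn => ?_⟩
  have hN0 : 0 < N := ht.trans_le hNt
  rw [dist_eq_norm, ← resonantDuhamel_add c g ht hN0 (hN0.trans_le hn), add_sub_cancel_left]
  exact (norm_resonantDuhamel_le hc hN0 hn hg).trans_lt hN

theorem resonantDuhamel_add_resonantTail {c : ℝ} (hc : |c| ≤ 1) {s t : ℝ} (hs : 0 < s)
    (ht : 0 < t) {g : L2R} (hg : Integrable g) :
    resonantDuhamel c s t g + resonantTail c t g = resonantTail c s g := by
  refine tendsto_nhds_unique ?_ (tendsto_resonantDuhamel hc hs hg)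
  refine ((tendsto_resonantDuhamel hc ht hg).const_add (resonantDuhamel c s t g)).congr' ?_
  filter_upwards [eventually_gt_atTop 0] with T hT
  exact resonantDuhamel_add c g hs ht hT

theorem norm_resonantTail_le {c : ℝ} (hc : |c| ≤ 1) {t : ℝ} (ht : 0 < t) {g : L2R}
    (hg : Integrable g) :
    ‖resonantTail c t g‖ ≤ resonantConst * t ^ (-(1 / 4) : ℝ) * ∫ x, ‖g x‖ := by
  refine le_of_tendsto (tendsto_resonantDuhamel hc ht hg).norm ?_
  filter_upwards [eventually_ge_atTop t] with T hT
  exact norm_resonantDuhamel_le hc ht hT hg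

theorem flowLinftyLe_resonantTail {c : ℝ} (hc : |c| ≤ 1) {t : ℝ} (ht : 0 < t) {g : L2R}
    (hg : Integrable g) :
    FlowLinftyLe (resonantTail c t g) (resonantConst * t ^ (-(1 / 2) : ℝ) * ∫ x, ‖g x‖) := by
  refine FlowLinftyLe.of_tendsto (tendsto_resonantDuhamel hc ht hg) ?_
  filter_upwards [eventually_ge_atTop t] with T hT
  exact flowLinftyLe_resonantDuhamel_of_integrable hc ht hT hg

theorem hasDerivAt_resonantTail {c : ℝ} (hc : |c| ≤ 1) {t : ℝ} (ht : 0 < t) {g : L2R}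
    (hg : Integrable g) :
    HasDerivAt (fun s => resonantTail c s g) (-resonantIntegrand c g t) t := by
  have hcont : ContinuousOn (resonantIntegrand c g) (Ioi 0) :=
    continuousOn_resonantIntegrand subset_rfl c continuousOn_const
  have h1 : HasDerivAt (fun s => resonantDuhamel c t s g) (resonantIntegrand c g t) t :=
    intervalIntegral.integral_hasDerivAt_right
      (intervalIntegrable_resonantIntegrand c g ht ht)
      (hcont.stronglyMeasurableAtFilter isOpen_Ioi t ht)
      (hcont.continuousAt (Ioi_mem_nhds ht))
  refine (h1.const_sub (resonantTail c t g)).congr_of_eventuallyEq ?_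
  filter_upwards [Ioi_mem_nhds ht] with s hs
  rw [← resonantDuhamel_add_resonantTail hc ht hs hg, add_sub_cancel_left]

/-! ### The truncated quadratic and cubic nonlinearity on `L²`. -/

/-- The coordinatewise truncation of a complex number to the square `[-1, 1]²`. -/
noncomputable def clampC (z : ℂ) : ℂ := ⟨max (-1) (min 1 z.re), max (-1) (min 1 z.im)⟩

theorem abs_clamp_sub_le (x y : ℝ) : |max (-1) (min 1 x) - max (-1) (min 1 y)| ≤ |x - y| := by
  refine (abs_max_sub_max_le_max _ _ _ _).trans ?_
  rw [sub_self, abs_zero, max_eq_right (abs_nonneg _)]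
  refine (abs_min_sub_min_le_max _ _ _ _).trans ?_
  rw [sub_self, abs_zero, max_eq_right (abs_nonneg _)]

theorem norm_clampC_sub_le (z w : ℂ) : ‖clampC z - clampC w‖ ≤ ‖z - w‖ := by
  rw [← sq_le_sq₀ (norm_nonneg _) (norm_nonneg _), ← Complex.normSq_eq_norm_sq,
    ← Complex.normSq_eq_norm_sq, Complex.normSq_apply, Complex.normSq_apply]
  have h1 := sq_le_sq.2 (abs_clamp_sub_le z.re w.re)
  have h2 := sq_le_sq.2 (abs_clamp_sub_le z.im w.im)
  simp only [Complex.sub_re, Complex.sub_im, clampC]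
  nlinarith

theorem clampC_zero : clampC 0 = 0 := by
  apply Complex.ext <;> simp [clampC]

theorem norm_clampC_le (z : ℂ) : ‖clampC z‖ ≤ ‖z‖ := by
  simpa [clampC_zero] using norm_clampC_sub_le z 0

theorem norm_clampC_le_two (z : ℂ) : ‖clampC z‖ ≤ 2 := by
  refine (Complex.norm_le_abs_re_add_abs_im _).trans ?_
  have h : ∀ x : ℝ, |max (-1) (min 1 x)| ≤ 1 := fun x =>
    abs_le.2 ⟨le_max_left _ _, max_le (by norm_num) (min_le_left _ _)⟩
  have h1 := h z.re
  have h2 := h z.im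
  simp only [clampC]
  linarith

theorem clampC_of_norm_le_one {z : ℂ} (h : ‖z‖ ≤ 1) : clampC z = z := by
  have h1 := abs_le.1 ((Complex.abs_re_le_norm z).trans h)
  have h2 := abs_le.1 ((Complex.abs_im_le_norm z).trans h)
  apply Complex.ext
  · simp only [clampC]; rw [min_eq_right h1.2, max_eq_right h1.1]
  · simp only [clampC]; rw [min_eq_right h2.2, max_eq_right h2.1]

/-- The truncated quadratic nonlinearity `2|z|² + z²`. -/
noncomputable def truncQuad (z : ℂ) : ℂ :=
  2 * (clampC z * (starRingEnd ℂ) (clampC z)) + clampC z * clampC z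

/-- The truncated cubic nonlinearity `|z|²z`. -/
noncomputable def truncCubic (z : ℂ) : ℂ := clampC z * (starRingEnd ℂ) (clampC z) * clampC z

theorem norm_mul_sub_mul_le {p q p' q' : ℂ} {A B d e : ℝ} (hp : ‖p‖ ≤ A) (hq' : ‖q'‖ ≤ B)
    (hd : ‖p - p'‖ ≤ d) (he : ‖q - q'‖ ≤ e) :
    ‖p * q - p' * q'‖ ≤ A * e + d * B := by
  have h : p * q - p' * q' = p * (q - q') + (p - p') * q' := by ring
  rw [h]
  refine (norm_add_le _ _).trans ?_
  rw [norm_mul, norm_mul]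
  have hA : 0 ≤ A := (norm_nonneg _).trans hp
  have hd0 : 0 ≤ d := (norm_nonneg _).trans hd
  exact add_le_add (mul_le_mul hp he (norm_nonneg _) hA) (mul_le_mul hd hq' (norm_nonneg _) hd0)

/-- With factors bounded by `2` and 1-Lipschitz, each product is 4-Lipschitz, and `12 = 2·4 + 4`. -/
theorem lipschitzWith_truncQuad : LipschitzWith 12 truncQuad := by
  refine LipschitzWith.of_dist_le_mul fun z w => ?_
  rw [dist_eq_norm, dist_eq_norm]
  have hd := norm_clampC_sub_le z w
  have hc : ‖(starRingEnd ℂ) (clampC z) - (starRingEnd ℂ) (clampC w)‖ ≤ ‖z - w‖ := by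
    rw [← map_sub, RCLike.norm_conj]; exact hd
  have hw : ‖(starRingEnd ℂ) (clampC w)‖ ≤ 2 := by
    rw [RCLike.norm_conj]; exact norm_clampC_le_two w
  have h1 := norm_mul_sub_mul_le (norm_clampC_le_two z) hw hd hc
  have h2 := norm_mul_sub_mul_le (norm_clampC_le_two z) (norm_clampC_le_two w) hd hd
  have h3 : truncQuad z - truncQuad w = 2 * (clampC z * (starRingEnd ℂ) (clampC z)
      - clampC w * (starRingEnd ℂ) (clampC w)) + (clampC z * clampC z - clampC w * clampC w) := by
    unfold truncQuad; ring
  rw [h3]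
  refine (norm_add_le _ _).trans ?_
  rw [norm_mul]
  norm_num
  linarith

theorem lipschitzWith_truncCubic : LipschitzWith 12 truncCubic := by
  refine LipschitzWith.of_dist_le_mul fun z w => ?_
  rw [dist_eq_norm, dist_eq_norm]
  have hd := norm_clampC_sub_le z w
  have hc : ‖(starRingEnd ℂ) (clampC z) - (starRingEnd ℂ) (clampC w)‖ ≤ ‖z - w‖ := by
    rw [← map_sub, RCLike.norm_conj]; exact hd
  have hw : ‖(starRingEnd ℂ) (clampC w)‖ ≤ 2 := by
    rw [RCLike.norm_conj]; exact norm_clampC_le_two w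
  have h1 := norm_mul_sub_mul_le (norm_clampC_le_two z) hw hd hc
  have hz : ‖clampC z * (starRingEnd ℂ) (clampC z)‖ ≤ 2 * 2 := by
    rw [norm_mul, RCLike.norm_conj]
    exact mul_le_mul (norm_clampC_le_two z) (norm_clampC_le_two z) (norm_nonneg _) (by norm_num)
  have h2 := norm_mul_sub_mul_le hz (norm_clampC_le_two w) h1 hd
  refine h2.trans ?_
  norm_num
  linarith

theorem truncQuad_zero : truncQuad 0 = 0 := by simp [truncQuad, clampC_zero]

theorem truncCubic_zero : truncCubic 0 = 0 := by simp [truncCubic, clampC_zero]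

theorem norm_truncQuad_le (z : ℂ) : ‖truncQuad z‖ ≤ 3 * ‖z‖ ^ 2 := by
  unfold truncQuad
  refine (norm_add_le _ _).trans ?_
  simp only [norm_mul, RCLike.norm_conj]
  have := norm_clampC_le z
  norm_num
  nlinarith [norm_nonneg (clampC z)]

theorem norm_truncCubic_le (z : ℂ) : ‖truncCubic z‖ ≤ 2 * ‖z‖ ^ 2 := by
  unfold truncCubic
  simp only [norm_mul, RCLike.norm_conj]
  have h1 := norm_clampC_le z
  have h2 := norm_clampC_le_two z
  have h3 : ‖clampC z‖ * ‖clampC z‖ ≤ ‖z‖ ^ 2 := by nlinarith [norm_nonneg (clampC z)]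
  nlinarith [norm_nonneg (clampC z), sq_nonneg ‖z‖]

/-- The nonlinearity `2a|w|² + aw² + |w|²w` on `L²(ℝ)`, truncated at height `m`. -/
noncomputable def truncNonlinearity (a m : ℝ) (w : L2R) : L2R :=
  (a * m ^ 2) • lipschitzWith_truncQuad.compLp truncQuad_zero (m⁻¹ • w)
    + m ^ 3 • lipschitzWith_truncCubic.compLp truncCubic_zero (m⁻¹ • w)

/-- Homogeneity: the cutoff at unit height is rescaled, so the quadratic part gains one factor `m`
and the cubic part two. With `m` of order `τ^{-1/2}` this is the decay that the contraction uses. -/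
theorem norm_truncNonlinearity_sub_le (a : ℝ) {m : ℝ} (hm : 0 < m) (w w' : L2R) :
    ‖truncNonlinearity a m w - truncNonlinearity a m w'‖
      ≤ 12 * (|a| * m + m ^ 2) * ‖w - w'‖ := by
  have h1 := lipschitzWith_truncQuad.norm_compLp_sub_le truncQuad_zero (m⁻¹ • w) (m⁻¹ • w')
  have h2 := lipschitzWith_truncCubic.norm_compLp_sub_le truncCubic_zero (m⁻¹ • w) (m⁻¹ • w')
  rw [← smul_sub, norm_smul, Real.norm_of_nonneg (inv_pos.2 hm).le] at h1 h2
  have h3 : truncNonlinearity a m w - truncNonlinearity a m w'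
      = (a * m ^ 2) • (lipschitzWith_truncQuad.compLp truncQuad_zero (m⁻¹ • w)
          - lipschitzWith_truncQuad.compLp truncQuad_zero (m⁻¹ • w'))
        + m ^ 3 • (lipschitzWith_truncCubic.compLp truncCubic_zero (m⁻¹ • w)
          - lipschitzWith_truncCubic.compLp truncCubic_zero (m⁻¹ • w')) := by
    unfold truncNonlinearity
    rw [smul_sub, smul_sub]
    abel
  rw [h3]
  refine (norm_add_le _ _).trans ?_
  rw [norm_smul, norm_smul, Real.norm_eq_abs, Real.norm_eq_abs, abs_mul, abs_of_pos (pow_pos hm 2),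
    abs_of_pos (pow_pos hm 3)]
  have h4 := mul_le_mul_of_nonneg_left h1 (show 0 ≤ |a| * m ^ 2 by positivity)
  have h5 := mul_le_mul_of_nonneg_left h2 (show 0 ≤ m ^ 3 by positivity)
  refine (add_le_add h4 h5).trans (le_of_eq ?_)
  push_cast
  field_simp

theorem truncNonlinearity_zero (a m : ℝ) : truncNonlinearity a m 0 = 0 := by
  simp [truncNonlinearity]

theorem coeFn_truncNonlinearity (a m : ℝ) (w : L2R) : truncNonlinearity a m w =ᵐ[volume]
    fun x => ((a * m ^ 2 : ℝ) : ℂ) * truncQuad (((m⁻¹ : ℝ) : ℂ) * w x)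
      + ((m ^ 3 : ℝ) : ℂ) * truncCubic (((m⁻¹ : ℝ) : ℂ) * w x) := by
  unfold truncNonlinearity
  refine (Lp.coeFn_add _ _).trans ?_
  filter_upwards [Lp.coeFn_smul (a * m ^ 2)
      (lipschitzWith_truncQuad.compLp truncQuad_zero (m⁻¹ • w)),
    Lp.coeFn_smul (m ^ 3) (lipschitzWith_truncCubic.compLp truncCubic_zero (m⁻¹ • w)),
    lipschitzWith_truncQuad.coeFn_compLp truncQuad_zero (m⁻¹ • w),
    lipschitzWith_truncCubic.coeFn_compLp truncCubic_zero (m⁻¹ • w),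
    Lp.coeFn_smul m⁻¹ w] with x h1 h2 h3 h4 h5
  simp only [Pi.add_apply, h1, h2, Pi.smul_apply, h3, h4, Function.comp_apply, h5,
    Complex.real_smul]

theorem integrable_norm_sq (w : L2R) : Integrable fun x => ‖w x‖ ^ 2 :=
  (memLp_two_iff_integrable_sq_norm (Lp.aestronglyMeasurable w)).1 (Lp.memLp w)

/-- One factor of the cubic term is paid for by the cutoff, so the whole nonlinearity is at most
quadratic. It thus maps `L²` to `L¹`, as the dispersive estimate requires. -/
theorem norm_truncNonlinearity_apply_le (a : ℝ) {m : ℝ} (hm : 0 < m) (w : L2R) :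
    ∀ᵐ x, ‖truncNonlinearity a m w x‖ ≤ (3 * |a| + 2 * m) * ‖w x‖ ^ 2 := by
  filter_upwards [coeFn_truncNonlinearity a m w] with x hx
  rw [hx]
  refine (norm_add_le _ _).trans ?_
  rw [norm_mul, norm_mul, Complex.norm_real, Complex.norm_real, Real.norm_eq_abs, Real.norm_eq_abs,
    abs_mul, abs_of_pos (pow_pos hm 2), abs_of_pos (pow_pos hm 3)]
  have h1 := norm_truncQuad_le (((m⁻¹ : ℝ) : ℂ) * w x)
  have h2 := norm_truncCubic_le (((m⁻¹ : ℝ) : ℂ) * w x)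
  rw [norm_mul, Complex.norm_real, Real.norm_of_nonneg (inv_pos.2 hm).le] at h1 h2
  have h4 := mul_le_mul_of_nonneg_left h1 (show 0 ≤ |a| * m ^ 2 by positivity)
  have h5 := mul_le_mul_of_nonneg_left h2 (show 0 ≤ m ^ 3 by positivity)
  refine (add_le_add h4 h5).trans (le_of_eq ?_)
  field_simp

theorem integrable_truncNonlinearity (a : ℝ) {m : ℝ} (hm : 0 < m) (w : L2R) :
    Integrable (truncNonlinearity a m w) := by
  refine ((integrable_norm_sq w).const_mul (3 * |a| + 2 * m)).mono'
    (Lp.aestronglyMeasurable _) ?_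
  exact norm_truncNonlinearity_apply_le a hm w

theorem integral_norm_truncNonlinearity_le (a : ℝ) {m : ℝ} (hm : 0 < m) (w : L2R) :
    ∫ x, ‖truncNonlinearity a m w x‖ ≤ (3 * |a| + 2 * m) * ‖w‖ ^ 2 := by
  rw [norm_sq_eq_integral, ← integral_const_mul]
  exact integral_mono_ae (integrable_truncNonlinearity a hm w).norm
    ((integrable_norm_sq w).const_mul _) (norm_truncNonlinearity_apply_le a hm w)

theorem coeFn_truncNonlinearity_of_le (a : ℝ) {m : ℝ} (hm : 0 < m) {w : L2R}
    (hw : ∀ᵐ x, ‖w x‖ ≤ m) : truncNonlinearity a m w =ᵐ[volume]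
    fun x => ((a : ℝ) : ℂ) * (2 * ((‖w x‖ ^ 2 : ℝ) : ℂ) + w x ^ 2)
      + ((‖w x‖ ^ 2 : ℝ) : ℂ) * w x := by
  filter_upwards [coeFn_truncNonlinearity a m w, hw] with x hx hwx
  rw [hx]
  have h1 : clampC (((m⁻¹ : ℝ) : ℂ) * w x) = ((m⁻¹ : ℝ) : ℂ) * w x := by
    refine clampC_of_norm_le_one ?_
    rw [norm_mul, Complex.norm_real, Real.norm_of_nonneg (inv_pos.2 hm).le, inv_mul_le_iff₀ hm]
    linarith
  have h2 : ((‖w x‖ ^ 2 : ℝ) : ℂ) = w x * (starRingEnd ℂ) (w x) := by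
    rw [Complex.mul_conj, Complex.normSq_eq_norm_sq]
  have hmC : (m : ℂ) ≠ 0 := by exact_mod_cast hm.ne'
  rw [truncQuad, truncCubic, h1, h2, map_mul, Complex.conj_ofReal]
  push_cast
  field_simp

theorem continuousOn_truncNonlinearity {s : Set ℝ} (a : ℝ) {m : ℝ → ℝ} {w : ℝ → L2R}
    (hm : ContinuousOn m s) (hm0 : ∀ t ∈ s, m t ≠ 0) (hw : ContinuousOn w s) :
    ContinuousOn (fun t => truncNonlinearity a (m t) (w t)) s := by
  unfold truncNonlinearity
  have h0 : ContinuousOn (fun t => (m t)⁻¹ • w t) s := (hm.inv₀ hm0).smul hw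
  have h1 := (lipschitzWith_truncQuad.continuous_compLp (p := 2) (μ := (volume : Measure ℝ))
    truncQuad_zero).comp_continuousOn h0
  have h2 := (lipschitzWith_truncCubic.continuous_compLp (p := 2) (μ := (volume : Measure ℝ))
    truncCubic_zero).comp_continuousOn h0
  exact ((continuousOn_const.mul (hm.pow 2)).smul h1).add ((hm.pow 3).smul h2)

/-! ### Forcing terms in the interaction picture, and the weight `τ^{-5/4}`. -/

/-- The gauged free evolution `e^{ic log τ} e^{iτ∂ₛ²}`. -/
noncomputable def gaugedFlow (c τ : ℝ) (f : L2R) : L2R := gaugePhase c τ • freeSchrodinger τ f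

theorem norm_gaugedFlow (c τ : ℝ) (f : L2R) : ‖gaugedFlow c τ f‖ = ‖f‖ := by
  rw [gaugedFlow, norm_smul, norm_gaugePhase, one_mul, norm_freeSchrodinger]

theorem gaugedFlow_add (c τ : ℝ) (f g : L2R) :
    gaugedFlow c τ (f + g) = gaugedFlow c τ f + gaugedFlow c τ g := by
  rw [gaugedFlow, freeSchrodinger_add_right, smul_add, gaugedFlow, gaugedFlow]

theorem gaugedFlow_sub (c τ : ℝ) (f g : L2R) :
    gaugedFlow c τ (f - g) = gaugedFlow c τ f - gaugedFlow c τ g := by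
  rw [gaugedFlow, freeSchrodinger_sub_right, smul_sub, gaugedFlow, gaugedFlow]

theorem continuousOn_gaugedFlow {s : Set ℝ} (hs : s ⊆ Ioi 0) (c : ℝ) {f : ℝ → L2R}
    (hf : ContinuousOn f s) : ContinuousOn (fun τ => gaugedFlow c τ (f τ)) s := by
  unfold gaugedFlow
  have h2 := (continuousOn_gaugePhase c).mono hs
  have h3 : ContinuousOn (fun τ => freeSchrodinger τ (f τ)) s :=
    continuous_freeSchrodinger.comp_continuousOn (f := fun τ => (τ, f τ)) (by fun_prop)
  fun_prop

/-- The truncated nonlinear term, in the interaction picture. -/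
noncomputable def nonlinearForcing (c a M τ : ℝ) (y : L2R) : L2R :=
  (((τ⁻¹ : ℝ) : ℂ) * gaugePhase (-c) τ) • freeSchrodinger (-τ)
    (truncNonlinearity a (M * τ ^ (-(1 / 2) : ℝ)) (gaugedFlow c τ y))

/-- The Lipschitz constant of the truncated nonlinearity at time `τ`. -/
noncomputable def truncLip (a M τ : ℝ) : ℝ :=
  12 * (|a| * (M * τ ^ (-(1 / 2) : ℝ)) + (M * τ ^ (-(1 / 2) : ℝ)) ^ 2)

theorem norm_nonlinearForcing_sub_le (c a : ℝ) {M τ : ℝ} (hM : 0 < M) (hτ : 0 < τ) (y y' : L2R) :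
    ‖nonlinearForcing c a M τ y - nonlinearForcing c a M τ y'‖
      ≤ τ⁻¹ * (truncLip a M τ * ‖y - y'‖) := by
  have hm : 0 < M * τ ^ (-(1 / 2) : ℝ) := by positivity
  rw [nonlinearForcing, nonlinearForcing, ← smul_sub, ← freeSchrodinger_sub_right, norm_smul,
    norm_mul, norm_gaugePhase, mul_one, norm_freeSchrodinger, Complex.norm_real,
    Real.norm_of_nonneg (inv_pos.2 hτ).le]
  refine mul_le_mul_of_nonneg_left ?_ (inv_pos.2 hτ).le
  refine (norm_truncNonlinearity_sub_le a hm _ _).trans ?_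
  rw [← gaugedFlow_sub, norm_gaugedFlow, truncLip]

theorem nonlinearForcing_zero (c a M τ : ℝ) : nonlinearForcing c a M τ 0 = 0 := by
  have h : gaugedFlow c τ 0 = 0 := by
    rw [← norm_eq_zero, norm_gaugedFlow, norm_zero]
  have h' : freeSchrodinger (-τ) 0 = 0 := by
    rw [← norm_eq_zero, norm_freeSchrodinger, norm_zero]
  rw [nonlinearForcing, h, truncNonlinearity_zero, h', smul_zero]

theorem norm_nonlinearForcing_le (c a : ℝ) {M τ : ℝ} (hM : 0 < M) (hτ : 0 < τ) (y : L2R) :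
    ‖nonlinearForcing c a M τ y‖ ≤ τ⁻¹ * (truncLip a M τ * ‖y‖) := by
  simpa [nonlinearForcing_zero] using norm_nonlinearForcing_sub_le c a hM hτ y 0

theorem continuousOn_nonlinearForcing {s : Set ℝ} (hs : s ⊆ Ioi 0) (c a : ℝ) {M : ℝ} (hM : 0 < M)
    {y : ℝ → L2R} (hy : ContinuousOn y s) :
    ContinuousOn (fun τ => nonlinearForcing c a M τ (y τ)) s := by
  unfold nonlinearForcing
  have h1 : ContinuousOn (fun τ : ℝ => τ⁻¹) s :=
    continuousOn_inv₀.mono fun x hx => (hs hx : (0 : ℝ) < x).ne'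
  have h2 := (continuousOn_gaugePhase (-c)).mono hs
  have h3 : ContinuousOn (fun τ : ℝ => M * τ ^ (-(1 / 2) : ℝ)) s :=
    continuousOn_const.mul (ContinuousOn.rpow_const continuousOn_id
      fun x hx => Or.inl (hs hx : (0 : ℝ) < x).ne')
  have h4 := continuousOn_truncNonlinearity a h3 (fun τ hτ => by
    have : (0 : ℝ) < τ := hs hτ
    positivity) (continuousOn_gaugedFlow hs c hy)
  have h5 : ContinuousOn (fun τ => freeSchrodinger (-τ)
      (truncNonlinearity a (M * τ ^ (-(1 / 2) : ℝ)) (gaugedFlow c τ (y τ)))) s :=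
    continuous_freeSchrodinger.comp_continuousOn (f := fun τ => (-τ,
      truncNonlinearity a (M * τ ^ (-(1 / 2) : ℝ)) (gaugedFlow c τ (y τ)))) (by fun_prop)
  fun_prop

/-- The part of the forcing that depends on the remainder profile `x`. -/
noncomputable def profileForcing (c a M : ℝ) (u : L2R) (x : ℝ → L2R) (τ : ℝ) : L2R :=
  ((a ^ 2 : ℝ) : ℂ) • resonantIntegrand c (conjL2 (x τ)) τ + nonlinearForcing c a M τ (u + x τ)

theorem continuousOn_profileForcing {s : Set ℝ} (hs : s ⊆ Ioi 0) (c a : ℝ) {M : ℝ} (hM : 0 < M)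
    (u : L2R) {x : ℝ → L2R} (hx : ContinuousOn x s) :
    ContinuousOn (profileForcing c a M u x) s := by
  unfold profileForcing
  have h0 : ContinuousOn (fun τ => conjL2 (x τ)) s := conjL2.continuous.comp_continuousOn hx
  have h1 := continuousOn_resonantIntegrand hs c h0
  have h2 : ContinuousOn (fun τ => u + x τ) s := continuousOn_const.add hx
  have h3 := continuousOn_nonlinearForcing hs c a hM h2
  fun_prop

theorem resonantIntegrand_sub (c τ : ℝ) (f g : L2R) :
    resonantIntegrand c f τ - resonantIntegrand c g τ = resonantIntegrand c (f - g) τ := by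
  rw [resonantIntegrand, resonantIntegrand, resonantIntegrand, freeSchrodinger_sub_right, smul_sub]

theorem norm_profileForcing_sub_le (c a : ℝ) {M τ : ℝ} (hM : 0 < M) (hτ : 0 < τ) (u : L2R)
    (x x' : ℝ → L2R) :
    ‖profileForcing c a M u x τ - profileForcing c a M u x' τ‖
      ≤ (a ^ 2 + truncLip a M τ) * (τ⁻¹ * ‖x τ - x' τ‖) := by
  have h : profileForcing c a M u x τ - profileForcing c a M u x' τ
      = ((a ^ 2 : ℝ) : ℂ) • resonantIntegrand c (conjL2 (x τ - x' τ)) τ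
        + (nonlinearForcing c a M τ (u + x τ) - nonlinearForcing c a M τ (u + x' τ)) := by
    rw [profileForcing, profileForcing, map_sub, ← resonantIntegrand_sub, smul_sub]
    abel
  rw [h]
  refine (norm_add_le _ _).trans ?_
  have h1 := norm_nonlinearForcing_sub_le c a hM hτ (u + x τ) (u + x' τ)
  rw [add_sub_add_left_eq_sub] at h1
  rw [norm_smul, norm_resonantIntegrand c _ hτ, norm_conjL2, Complex.norm_real,
    Real.norm_of_nonneg (sq_nonneg a)]
  linarith

theorem norm_profileForcing_le (c a : ℝ) {M τ : ℝ} (hM : 0 < M) (hτ : 0 < τ) (u : L2R)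
    (x : ℝ → L2R) :
    ‖profileForcing c a M u x τ‖
      ≤ (a ^ 2 + truncLip a M τ) * (τ⁻¹ * ‖x τ‖) + τ⁻¹ * (truncLip a M τ * ‖u‖) := by
  have h1 := norm_profileForcing_sub_le c a hM hτ u x (fun _ => 0)
  have h2 : profileForcing c a M u (fun _ => 0) τ = nonlinearForcing c a M τ u := by
    have : resonantIntegrand c 0 τ = 0 := by
      rw [← norm_eq_zero, norm_resonantIntegrand c _ hτ, norm_zero, mul_zero]
    rw [profileForcing, map_zero, this, smul_zero, zero_add, add_zero]
  have h3 := norm_nonlinearForcing_le c a hM hτ u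
  rw [h2, sub_zero] at h1
  have h4 := norm_le_norm_sub_add (profileForcing c a M u x τ) (nonlinearForcing c a M τ u)
  linarith

theorem integrableOn_Ioi_rpow_five_fourths {t : ℝ} (ht : 0 < t) :
    IntegrableOn (fun τ : ℝ => τ ^ (-(5 / 4) : ℝ)) (Ioi t) :=
  integrableOn_Ioi_rpow_of_lt (by norm_num) ht

theorem integral_Ioi_rpow_five_fourths {t : ℝ} (ht : 0 < t) :
    ∫ τ in Ioi t, τ ^ (-(5 / 4) : ℝ) = 4 * t ^ (-(1 / 4) : ℝ) := by
  rw [integral_Ioi_rpow_of_lt (by norm_num) ht]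
  norm_num
  ring

theorem inv_mul_rpow_neg_quarter {τ : ℝ} (hτ : 0 < τ) :
    τ⁻¹ * τ ^ (-(1 / 4) : ℝ) = τ ^ (-(5 / 4) : ℝ) := by
  rw [← Real.rpow_neg_one, ← Real.rpow_add hτ]
  norm_num

theorem norm_setIntegral_Ioi_le_of_norm_le {E : Type*} [NormedAddCommGroup E] [NormedSpace ℝ E]
    {t B : ℝ} (ht : 0 < t) {F : ℝ → E}
    (h : ∀ τ ∈ Ioi t, ‖F τ‖ ≤ B * τ ^ (-(5 / 4) : ℝ)) :
    ‖∫ τ in Ioi t, F τ‖ ≤ 4 * B * t ^ (-(1 / 4) : ℝ) := by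
  refine (norm_integral_le_of_norm_le ((integrableOn_Ioi_rpow_five_fourths ht).const_mul B)
    (ae_restrict_of_forall_mem measurableSet_Ioi h)).trans (le_of_eq ?_)
  rw [integral_const_mul, integral_Ioi_rpow_five_fourths ht]
  ring

theorem integrableOn_Ioi_of_norm_le {E : Type*} [NormedAddCommGroup E]
    {t B : ℝ} (ht : 0 < t) {F : ℝ → E} (hF : ContinuousOn F (Ioi 0))
    (h : ∀ τ ∈ Ioi t, ‖F τ‖ ≤ B * τ ^ (-(5 / 4) : ℝ)) : IntegrableOn F (Ioi t) := by
  refine Integrable.mono' ((integrableOn_Ioi_rpow_five_fourths ht).const_mul B)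
    ((hF.mono (Ioi_subset_Ioi ht.le)).aestronglyMeasurable measurableSet_Ioi) ?_
  exact ae_restrict_of_forall_mem measurableSet_Ioi h

theorem hasDerivAt_integral_Ioi {E : Type*} [NormedAddCommGroup E] [NormedSpace ℝ E]
    [CompleteSpace E] {t₀ : ℝ} (ht₀ : 0 < t₀) {F : ℝ → E} (hF : ContinuousOn F (Ioi 0))
    (hi : IntegrableOn F (Ioi t₀)) {t : ℝ} (ht : t₀ ≤ t) :
    HasDerivAt (fun s => ∫ τ in Ioi s, F τ) (-F t) t := by
  have ht0 : 0 < t := ht₀.trans_le ht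
  have hii : ∀ p q, 0 < p → 0 < q → IntervalIntegrable F volume p q := fun p q hp hq =>
    (hF.mono fun y hy => lt_of_lt_of_le (lt_min hp hq) hy.1).intervalIntegrable
  have h1 : HasDerivAt (fun s => ∫ τ in t..s, F τ) (F t) t :=
    intervalIntegral.integral_hasDerivAt_right (hii t t ht0 ht0)
      (hF.stronglyMeasurableAtFilter isOpen_Ioi t ht0)
      (hF.continuousAt (Ioi_mem_nhds ht0))
  refine (h1.const_sub (∫ τ in Ioi t, F τ)).congr_of_eventuallyEq ?_
  filter_upwards [Ioi_mem_nhds ht0] with s hs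
  have hit : IntegrableOn F (Ioi t) := hi.mono_set (Ioi_subset_Ioi ht)
  have his : IntegrableOn F (Ioi s) := by
    rcases le_total s t with h | h
    · rw [← Ioc_union_Ioi_eq_Ioi h]
      exact ((hii s t hs ht0).1).union hit
    · exact hit.mono_set (Ioi_subset_Ioi h)
  have := intervalIntegral.integral_interval_add_Ioi hit his
  rw [← this, add_sub_cancel_left]

/-! ### The fixed point problem for the remainder profile. -/

/-- The map whose fixed points are the remainder profiles of long range solutions. -/
noncomputable def profileMap (σ a M : ℝ) (u : L2R) (x : ℝ → L2R) (t : ℝ) : L2R :=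
  (-(Complex.I * σ)) • (((a ^ 2 : ℝ) : ℂ) • resonantTail (σ * a ^ 2) t (conjL2 u)
    + ∫ τ in Ioi t, profileForcing (σ * a ^ 2) a M u x τ)

/-- The smallness conditions under which the profile map is a contraction on `[t₀, ∞)`. -/
structure ProfileSmallness (σ a M t₀ : ℝ) : Prop where
  time_pos : 0 < t₀
  height_pos : 0 < M
  abs_sign : |σ| = 1
  sq_le : ∀ τ, t₀ ≤ τ → a ^ 2 + truncLip a M τ ≤ 1 / 8
  lip_le : ∀ τ, t₀ ≤ τ → truncLip a M τ ≤ τ ^ (-(1 / 4) : ℝ)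

section

variable {σ a M t₀ : ℝ}

theorem truncLip_nonneg (hM : 0 < M) {τ : ℝ} (hτ : 0 < τ) : 0 ≤ truncLip a M τ := by
  unfold truncLip
  positivity

theorem ProfileSmallness.sq_le_eighth (h : ProfileSmallness σ a M t₀) : a ^ 2 ≤ 1 / 8 := by
  have h1 := h.sq_le t₀ le_rfl
  have h2 := truncLip_nonneg (a := a) h.height_pos h.time_pos
  linarith

theorem ProfileSmallness.abs_coupling_le (h : ProfileSmallness σ a M t₀) : |σ * a ^ 2| ≤ 1 := by
  rw [abs_mul, h.abs_sign, one_mul, abs_of_nonneg (sq_nonneg a)]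
  linarith [h.sq_le_eighth]

theorem ProfileSmallness.norm_factor (h : ProfileSmallness σ a M t₀) :
    ‖-(Complex.I * (σ : ℂ))‖ = 1 := by
  simp [h.abs_sign]

/-- The two smallness conditions act separately. Terms in `x` already decay and only need the small
factor `1/8`; the term in `u` does not decay, and there the bound `truncLip ≤ τ^{-1/4}` supplies the
missing power. -/
theorem ProfileSmallness.norm_forcing_le (h : ProfileSmallness σ a M t₀) (c : ℝ) (u : L2R)
    {x : ℝ → L2R} {D τ : ℝ} (hτ : t₀ ≤ τ) (hx : ‖x τ‖ ≤ D * τ ^ (-(1 / 4) : ℝ)) :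
    ‖profileForcing c a M u x τ‖ ≤ (D / 8 + ‖u‖) * τ ^ (-(5 / 4) : ℝ) := by
  have hτ0 : 0 < τ := h.time_pos.trans_le hτ
  refine (norm_profileForcing_le c a h.height_pos hτ0 u x).trans ?_
  rw [← inv_mul_rpow_neg_quarter hτ0]
  have h1 : τ⁻¹ * ‖x τ‖ ≤ τ⁻¹ * (D * τ ^ (-(1 / 4) : ℝ)) :=
    mul_le_mul_of_nonneg_left hx (inv_pos.2 hτ0).le
  have h2 : (a ^ 2 + truncLip a M τ) * (τ⁻¹ * ‖x τ‖)
      ≤ 1 / 8 * (τ⁻¹ * (D * τ ^ (-(1 / 4) : ℝ))) :=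
    mul_le_mul (h.sq_le τ hτ) h1 (by positivity) (by norm_num)
  have h3 : τ⁻¹ * (truncLip a M τ * ‖u‖) ≤ τ⁻¹ * (τ ^ (-(1 / 4) : ℝ) * ‖u‖) :=
    mul_le_mul_of_nonneg_left (mul_le_mul_of_nonneg_right (h.lip_le τ hτ) (norm_nonneg _))
      (inv_pos.2 hτ0).le
  linarith

theorem ProfileSmallness.norm_forcing_sub_le (h : ProfileSmallness σ a M t₀) (c : ℝ) (u : L2R)
    {x x' : ℝ → L2R} {D τ : ℝ} (hτ : t₀ ≤ τ) (hx : ‖x τ - x' τ‖ ≤ D * τ ^ (-(1 / 4) : ℝ)) :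
    ‖profileForcing c a M u x τ - profileForcing c a M u x' τ‖
      ≤ (D / 8) * τ ^ (-(5 / 4) : ℝ) := by
  have hτ0 : 0 < τ := h.time_pos.trans_le hτ
  refine (norm_profileForcing_sub_le c a h.height_pos hτ0 u x x').trans ?_
  rw [← inv_mul_rpow_neg_quarter hτ0]
  have h1 : τ⁻¹ * ‖x τ - x' τ‖ ≤ τ⁻¹ * (D * τ ^ (-(1 / 4) : ℝ)) :=
    mul_le_mul_of_nonneg_left hx (inv_pos.2 hτ0).le
  have h2 := mul_le_mul (h.sq_le τ hτ) h1 (by positivity) (by norm_num)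
  linarith

theorem ProfileSmallness.integrableOn_forcing (h : ProfileSmallness σ a M t₀) (c : ℝ) (u : L2R)
    {x : ℝ → L2R} {D t : ℝ} (hx : ContinuousOn x (Ioi 0))
    (hD : ∀ τ, t₀ ≤ τ → ‖x τ‖ ≤ D * τ ^ (-(1 / 4) : ℝ)) (ht : t₀ ≤ t) :
    IntegrableOn (profileForcing c a M u x) (Ioi t) :=
  integrableOn_Ioi_of_norm_le (h.time_pos.trans_le ht)
    (continuousOn_profileForcing subset_rfl c a h.height_pos u hx)
    fun τ hτ => h.norm_forcing_le c u (ht.trans (le_of_lt hτ)) (hD τ (ht.trans (le_of_lt hτ)))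

theorem ProfileSmallness.norm_map_le (h : ProfileSmallness σ a M t₀) {u : L2R} (hu : Integrable u)
    {x : ℝ → L2R} {D t : ℝ} (hD : ∀ τ, t₀ ≤ τ → ‖x τ‖ ≤ D * τ ^ (-(1 / 4) : ℝ)) (ht : t₀ ≤ t) :
    ‖profileMap σ a M u x t‖
      ≤ (resonantConst * (∫ s, ‖u s‖) + D / 2 + 4 * ‖u‖) * t ^ (-(1 / 4) : ℝ) := by
  have ht0 : 0 < t := h.time_pos.trans_le ht
  rw [profileMap, norm_smul, h.norm_factor, one_mul]
  refine (norm_add_le _ _).trans ?_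
  have h1 := norm_resonantTail_le h.abs_coupling_le ht0 (integrable_conjL2 hu)
  rw [integral_norm_conjL2] at h1
  have h2 := norm_setIntegral_Ioi_le_of_norm_le ht0 (F := profileForcing (σ * a ^ 2) a M u x)
    fun τ hτ => h.norm_forcing_le (σ * a ^ 2) u (ht.trans (le_of_lt hτ)) (hD τ (ht.trans (le_of_lt hτ)))
  have h3 : ‖((a ^ 2 : ℝ) : ℂ) • resonantTail (σ * a ^ 2) t (conjL2 u)‖
      ≤ resonantConst * t ^ (-(1 / 4) : ℝ) * ∫ s, ‖u s‖ := by
    rw [norm_smul, Complex.norm_real, Real.norm_of_nonneg (sq_nonneg a)]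
    refine le_trans ?_ h1
    exact mul_le_of_le_one_left (norm_nonneg _) (by linarith [h.sq_le_eighth])
  linarith

/-- The conditionally convergent tail depends on `u` alone and cancels. The factor `1/2` is `4 ·
1/8`, the `4` coming from `∫_t^∞ τ^{-5/4} dτ = 4 t^{-1/4}`. -/
theorem ProfileSmallness.norm_map_sub_le (h : ProfileSmallness σ a M t₀) (u : L2R)
    {x x' : ℝ → L2R} {D D₁ D₂ t : ℝ} (hx : ContinuousOn x (Ioi 0)) (hx' : ContinuousOn x' (Ioi 0))
    (hD₁ : ∀ τ, t₀ ≤ τ → ‖x τ‖ ≤ D₁ * τ ^ (-(1 / 4) : ℝ))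
    (hD₂ : ∀ τ, t₀ ≤ τ → ‖x' τ‖ ≤ D₂ * τ ^ (-(1 / 4) : ℝ))
    (hD : ∀ τ, t₀ ≤ τ → ‖x τ - x' τ‖ ≤ D * τ ^ (-(1 / 4) : ℝ)) (ht : t₀ ≤ t) :
    ‖profileMap σ a M u x t - profileMap σ a M u x' t‖ ≤ D / 2 * t ^ (-(1 / 4) : ℝ) := by
  have ht0 : 0 < t := h.time_pos.trans_le ht
  rw [profileMap, profileMap, ← smul_sub, norm_smul, h.norm_factor, one_mul,
    add_sub_add_left_eq_sub, ← integral_sub (h.integrableOn_forcing _ u hx hD₁ ht)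
      (h.integrableOn_forcing _ u hx' hD₂ ht)]
  refine (norm_setIntegral_Ioi_le_of_norm_le ht0 fun τ hτ =>
    h.norm_forcing_sub_le (σ * a ^ 2) u (ht.trans (le_of_lt hτ))
      (hD τ (ht.trans (le_of_lt hτ)))).trans (le_of_eq (by ring))

theorem ProfileSmallness.hasDerivAt_map (h : ProfileSmallness σ a M t₀) {u : L2R}
    (hu : Integrable u) {x : ℝ → L2R} {D t : ℝ} (hx : ContinuousOn x (Ioi 0))
    (hD : ∀ τ, t₀ ≤ τ → ‖x τ‖ ≤ D * τ ^ (-(1 / 4) : ℝ)) (ht : t₀ ≤ t) :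
    HasDerivAt (profileMap σ a M u x) ((Complex.I * σ) •
      (((a ^ 2 : ℝ) : ℂ) • resonantIntegrand (σ * a ^ 2) (conjL2 u) t
        + profileForcing (σ * a ^ 2) a M u x t)) t := by
  have ht0 : 0 < t := h.time_pos.trans_le ht
  have h1 := hasDerivAt_resonantTail h.abs_coupling_le ht0 (integrable_conjL2 hu)
  have h2 := hasDerivAt_integral_Ioi h.time_pos
    (continuousOn_profileForcing subset_rfl (σ * a ^ 2) a h.height_pos u hx)
    (h.integrableOn_forcing _ u hx hD le_rfl) ht
  have h3 := ((h1.const_smul ((a ^ 2 : ℝ) : ℂ)).add h2).const_smul (-(Complex.I * (σ : ℂ)))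
  refine h3.congr_deriv ?_
  rw [smul_neg, ← neg_add, smul_neg, neg_smul, neg_neg]

/-- The curve with values in `L²` encoded by a bounded continuous function, with the weight
`t^{-1/4}`. -/
noncomputable def weightedCurve (t₀ : ℝ) (b : BoundedContinuousFunction ℝ L2R) (τ : ℝ) : L2R :=
  (max τ t₀) ^ (-(1 / 4) : ℝ) • b τ

theorem continuous_weight (ht₀ : 0 < t₀) (p : ℝ) : Continuous fun τ : ℝ => (max τ t₀) ^ p :=
  (continuous_id.max continuous_const).rpow_const
    fun _ => Or.inl (ht₀.trans_le (le_max_right _ _)).ne'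

theorem continuous_weightedCurve (ht₀ : 0 < t₀) (b : BoundedContinuousFunction ℝ L2R) :
    Continuous (weightedCurve t₀ b) :=
  (continuous_weight ht₀ _).smul b.continuous

theorem norm_weightedCurve_le (ht₀ : 0 < t₀) (b : BoundedContinuousFunction ℝ L2R) {τ : ℝ}
    (hτ : t₀ ≤ τ) : ‖weightedCurve t₀ b τ‖ ≤ ‖b‖ * τ ^ (-(1 / 4) : ℝ) := by
  have : 0 < τ := ht₀.trans_le hτ
  rw [weightedCurve, max_eq_left hτ, norm_smul, Real.norm_of_nonneg (by positivity), mul_comm]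
  exact mul_le_mul_of_nonneg_right (b.norm_coe_le_norm τ) (by positivity)

theorem norm_weightedCurve_sub_le (ht₀ : 0 < t₀) (b b' : BoundedContinuousFunction ℝ L2R) {τ : ℝ}
    (hτ : t₀ ≤ τ) :
    ‖weightedCurve t₀ b τ - weightedCurve t₀ b' τ‖ ≤ ‖b - b'‖ * τ ^ (-(1 / 4) : ℝ) := by
  have h := norm_weightedCurve_le ht₀ (b - b') hτ
  rwa [weightedCurve, BoundedContinuousFunction.sub_apply, smul_sub] at h

/-- Banach's theorem in bounded continuous functions, after multiplication by `t^{1/4}`. Replacing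
`t` by `max t t₀` freezes weight and map to the left of `t₀`, so that functions on all of `ℝ` can be
used. -/
theorem ProfileSmallness.exists_fixedPoint (h : ProfileSmallness σ a M t₀) {u : L2R}
    (hu : Integrable u) :
    ∃ x : ℝ → L2R, Continuous x ∧ (∀ t, t₀ ≤ t → profileMap σ a M u x t = x t) ∧
      ∀ t, t₀ ≤ t → ‖x t‖
        ≤ (2 * resonantConst * (∫ s, ‖u s‖) + 8 * ‖u‖) * t ^ (-(1 / 4) : ℝ) := by
  have ht₀ := h.time_pos
  have hcu : ∀ b, ContinuousOn (weightedCurve t₀ b) (Ioi 0) := fun b =>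
    (continuous_weightedCurve ht₀ b).continuousOn
  have hbd : ∀ b : BoundedContinuousFunction ℝ L2R, ∀ τ, t₀ ≤ τ →
      ‖weightedCurve t₀ b τ‖ ≤ ‖b‖ * τ ^ (-(1 / 4) : ℝ) := fun b τ hτ =>
    norm_weightedCurve_le ht₀ b hτ
  have hmax : ∀ t : ℝ, t₀ ≤ max t t₀ := fun t => le_max_right _ _
  have hw : ∀ t : ℝ, 0 ≤ (max t t₀) ^ (1 / 4 : ℝ) := fun t =>
    Real.rpow_nonneg (ht₀.le.trans (hmax t)) _
  have hww : ∀ t : ℝ, (max t t₀) ^ (1 / 4 : ℝ) * (max t t₀) ^ (-(1 / 4) : ℝ) = 1 := fun t => by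
    rw [← Real.rpow_add (ht₀.trans_le (hmax t))]; norm_num
  have hcont : ∀ b, Continuous fun t : ℝ => (max t t₀) ^ (1 / 4 : ℝ) •
      profileMap σ a M u (weightedCurve t₀ b) (max t t₀) := by
    intro b
    refine (continuous_weight ht₀ _).smul ?_
    rw [continuous_iff_continuousAt]
    intro t
    exact ContinuousAt.comp (f := fun t => max t t₀) (x := t)
      (h.hasDerivAt_map hu (hcu b) (hbd b) (hmax t)).continuousAt
      (continuous_id.max continuous_const).continuousAt
  have hbound : ∀ (b : BoundedContinuousFunction ℝ L2R) (t : ℝ), ‖(max t t₀) ^ (1 / 4 : ℝ) •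
      profileMap σ a M u (weightedCurve t₀ b) (max t t₀)‖
      ≤ resonantConst * (∫ s, ‖u s‖) + ‖b‖ / 2 + 4 * ‖u‖ := by
    intro b t
    rw [norm_smul, Real.norm_of_nonneg (hw t)]
    refine (mul_le_mul_of_nonneg_left (h.norm_map_le hu (hbd b) (hmax t)) (hw t)).trans
      (le_of_eq ?_)
    rw [mul_left_comm, hww, mul_one]
  let T : BoundedContinuousFunction ℝ L2R → BoundedContinuousFunction ℝ L2R := fun b =>
    BoundedContinuousFunction.ofNormedAddCommGroup _ (hcont b) _ (hbound b)
  have hT : ∀ b t, T b t = (max t t₀) ^ (1 / 4 : ℝ) •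
      profileMap σ a M u (weightedCurve t₀ b) (max t t₀) := fun b t => rfl
  have hcontr : ContractingWith (1 / 2) T := by
    refine ⟨by rw [← NNReal.coe_lt_coe]; norm_num, LipschitzWith.of_dist_le_mul fun b b' => ?_⟩
    rw [dist_eq_norm, dist_eq_norm]
    refine (BoundedContinuousFunction.norm_le (by positivity)).2 fun t => ?_
    rw [BoundedContinuousFunction.sub_apply, hT, hT, ← smul_sub, norm_smul,
      Real.norm_of_nonneg (hw t)]
    refine (mul_le_mul_of_nonneg_left (h.norm_map_sub_le u (hcu b) (hcu b') (hbd b) (hbd b')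
      (fun τ hτ => norm_weightedCurve_sub_le ht₀ b b' hτ) (hmax t)) (hw t)).trans (le_of_eq ?_)
    rw [mul_left_comm, hww, mul_one]
    push_cast
    ring
  set b := hcontr.fixedPoint T
  have hfix : T b = b := hcontr.fixedPoint_isFixedPt
  -- Solving this inequality for `‖b‖` gives the constant `2 * resonantConst * S + 8 * ‖u‖`, where
  -- `S` is the `L¹` norm of `u`.
  have hnb : ‖b‖ ≤ resonantConst * (∫ s, ‖u s‖) + ‖b‖ / 2 + 4 * ‖u‖ := by
    have hnn : 0 ≤ resonantConst * (∫ s, ‖u s‖) + ‖b‖ / 2 + 4 * ‖u‖ :=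
      (norm_nonneg _).trans (hbound b 0)
    conv_lhs => rw [← hfix]
    exact (BoundedContinuousFunction.norm_le hnn).2 (hbound b)
  refine ⟨weightedCurve t₀ b, continuous_weightedCurve ht₀ b, fun t ht => ?_, fun t ht => ?_⟩
  · have h1 := hT b t
    rw [hfix, max_eq_left ht] at h1
    rw [weightedCurve, h1, max_eq_left ht, smul_smul, mul_comm]
    have h2 := hww t
    rw [max_eq_left ht] at h2
    rw [h2, one_smul]
  · refine (hbd b t ht).trans (mul_le_mul_of_nonneg_right ?_
      (Real.rpow_nonneg (ht₀.le.trans ht) _))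
    linarith

end

/-! ### Ingredients of the sup-norm bound for the fixed point. -/

theorem hasDerivAt_arctan_sqrt {t τ : ℝ} (ht : 0 < t) (hτ : t < τ) :
    HasDerivAt (fun τ => 2 * t ^ (-(1 / 2) : ℝ) * Real.arctan (Real.sqrt ((τ - t) / t)))
      ((τ - t) ^ (-(1 / 2) : ℝ) * τ⁻¹) τ := by
  have hd : 0 < τ - t := sub_pos.2 hτ
  have hτ0 : 0 < τ := ht.trans hτ
  have hq : 0 < (τ - t) / t := div_pos hd ht
  have h1 : HasDerivAt (fun τ => (τ - t) / t) (1 / t) τ :=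
    ((hasDerivAt_id τ).sub_const t).div_const t
  have h2 := ((h1.sqrt hq.ne').arctan).const_mul (2 * t ^ (-(1 / 2) : ℝ))
  refine h2.congr_deriv ?_
  rw [Real.sq_sqrt hq.le, Real.sqrt_div hd.le, Real.rpow_neg ht.le, Real.rpow_neg hd.le,
    ← Real.sqrt_eq_rpow, ← Real.sqrt_eq_rpow]
  have hst := Real.sqrt_pos.2 ht
  have hsd := Real.sqrt_pos.2 hd
  have e1 : 1 + (τ - t) / t = τ / t := by field_simp; ring
  rw [e1]
  have e2 : Real.sqrt t * Real.sqrt t = t := Real.mul_self_sqrt ht.le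
  field_simp

theorem tendsto_arctan_sqrt {t : ℝ} (ht : 0 < t) :
    Tendsto (fun τ => 2 * t ^ (-(1 / 2) : ℝ) * Real.arctan (Real.sqrt ((τ - t) / t))) atTop
      (nhds (2 * t ^ (-(1 / 2) : ℝ) * (Real.pi / 2))) := by
  refine Tendsto.const_mul _ ?_
  have h1 : Tendsto (fun τ : ℝ => Real.sqrt ((τ - t) / t)) atTop atTop :=
    Real.tendsto_sqrt_atTop.comp
      ((tendsto_atTop_add_const_right atTop (-t) tendsto_id).atTop_div_const ht)
  exact (Real.tendsto_arctan_atTop.mono_right nhdsWithin_le_nhds).comp h1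

theorem integrableOn_sub_rpow_mul_inv {t : ℝ} (ht : 0 < t) :
    IntegrableOn (fun τ : ℝ => (τ - t) ^ (-(1 / 2) : ℝ) * τ⁻¹) (Ioi t) := by
  refine integrableOn_Ioi_deriv_of_nonneg (g := fun τ => 2 * t ^ (-(1 / 2) : ℝ) *
    Real.arctan (Real.sqrt ((τ - t) / t))) ?_
    (fun τ hτ => hasDerivAt_arctan_sqrt ht hτ) (fun τ hτ => ?_) (tendsto_arctan_sqrt ht)
  · have : Continuous (fun τ => 2 * t ^ (-(1 / 2) : ℝ) * Real.arctan (Real.sqrt ((τ - t) / t))) := by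
      fun_prop
    exact this.continuousWithinAt
  · have h1 : 0 < τ - t := sub_pos.2 hτ
    have h2 : 0 < τ := ht.trans hτ
    positivity

/-- The kernel is the dispersive decay `(τ-t)^{-1/2}` times the factor `1/τ` of the equation; its
integral has exactly the desired decay `t^{-1/2}`. -/
theorem integral_sub_rpow_mul_inv {t : ℝ} (ht : 0 < t) :
    ∫ τ in Ioi t, (τ - t) ^ (-(1 / 2) : ℝ) * τ⁻¹ = Real.pi * t ^ (-(1 / 2) : ℝ) := by
  rw [integral_Ioi_of_hasDerivAt_of_nonneg (g := fun τ => 2 * t ^ (-(1 / 2) : ℝ) *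
    Real.arctan (Real.sqrt ((τ - t) / t))) ?_
    (fun τ hτ => hasDerivAt_arctan_sqrt ht hτ) (fun τ hτ => ?_) (tendsto_arctan_sqrt ht)]
  · simp only [sub_self, zero_div, Real.sqrt_zero, Real.arctan_zero]
    ring
  · have : Continuous (fun τ => 2 * t ^ (-(1 / 2) : ℝ) * Real.arctan (Real.sqrt ((τ - t) / t))) := by
      fun_prop
    exact this.continuousWithinAt
  · have h1 : 0 < τ - t := sub_pos.2 hτ
    have h2 : 0 < τ := ht.trans hτ
    positivity

/-- The map `g ↦ τ⁻¹ e^{-2ic log τ} e^{-2iτ∂ₛ²} ḡ`, as a real linear map. -/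
noncomputable def resonantCLM (c τ : ℝ) : L2R →L[ℝ] L2R :=
  ((((τ⁻¹ : ℝ) : ℂ) * gaugePhase (-(2 * c)) τ) •
    (freeSchrodingerLI (-(2 * τ))).toContinuousLinearMap).restrictScalars ℝ ∘L conjL2

theorem resonantCLM_apply (c τ : ℝ) (g : L2R) :
    resonantCLM c τ g = resonantIntegrand c (conjL2 g) τ := rfl

theorem flowLinftyLe_resonantIntegrand {g : L2R} {B : ℝ} (hg : FlowLinftyLe g B) (c : ℝ) {τ : ℝ}
    (hτ : 0 < τ) : FlowLinftyLe (resonantIntegrand c g τ) (τ⁻¹ * B) := by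
  have h := (hg.flow (-(2 * τ))).smul (((τ⁻¹ : ℝ) : ℂ) * gaugePhase (-(2 * c)) τ)
  rwa [norm_mul, norm_gaugePhase, mul_one, Complex.norm_real,
    Real.norm_of_nonneg (inv_pos.2 hτ).le] at h

theorem continuousOn_uncurry_resonantIntegrand (c : ℝ) {g : ℝ → L2R}
    (hg : ContinuousOn g (Ioi 0)) :
    ContinuousOn (fun p : ℝ × ℝ => resonantIntegrand c (conjL2 (g p.2)) p.1)
      (Ioi 0 ×ˢ Ioi 0) := by
  unfold resonantIntegrand
  have h1 : ContinuousOn (fun p : ℝ × ℝ => p.1⁻¹) (Ioi 0 ×ˢ Ioi 0) :=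
    continuousOn_fst.inv₀ fun p hp => (hp.1 : (0 : ℝ) < p.1).ne'
  have h2 : ContinuousOn (fun p : ℝ × ℝ => gaugePhase (-(2 * c)) p.1) (Ioi 0 ×ˢ Ioi 0) :=
    (continuousOn_gaugePhase _).comp continuousOn_fst fun p hp => hp.1
  have h3 : ContinuousOn (fun p : ℝ × ℝ => conjL2 (g p.2)) (Ioi 0 ×ˢ Ioi 0) :=
    conjL2.continuous.comp_continuousOn (hg.comp continuousOn_snd fun p hp => hp.2)
  have h4 : ContinuousOn (fun p : ℝ × ℝ => freeSchrodinger (-(2 * p.1)) (conjL2 (g p.2)))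
      (Ioi 0 ×ˢ Ioi 0) :=
    continuous_freeSchrodinger.comp_continuousOn
      (f := fun p : ℝ × ℝ => (-(2 * p.1), conjL2 (g p.2))) (by fun_prop)
  fun_prop

/-- The bound `p.1⁻¹ p.2^{-5/4}` just fails to be integrable in `p.1`. On `p.1 < p.2` a power `1/8`
can be shifted between the variables, leaving `-9/8` in each. -/
theorem integrable_prod_resonantIntegrand (c : ℝ) {g : ℝ → L2R} {G t : ℝ} (ht : 0 < t)
    (hg : ContinuousOn g (Ioi 0)) (hG : ∀ τ ∈ Ioi t, ‖g τ‖ ≤ G * τ ^ (-(5 / 4) : ℝ)) :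
    Integrable (fun p : ℝ × ℝ => {p : ℝ × ℝ | p.1 < p.2}.indicator
      (fun p => resonantIntegrand c (conjL2 (g p.2)) p.1) p)
      ((volume.restrict (Ioi t)).prod (volume.restrict (Ioi t))) := by
  have hi : IntegrableOn (fun τ : ℝ => τ ^ (-(9 / 8) : ℝ)) (Ioi t) :=
    integrableOn_Ioi_rpow_of_lt (by norm_num) ht
  have hG0 : 0 ≤ G := by
    have h1 := (norm_nonneg _).trans (hG (t + 1) (by simp))
    have h2 : 0 < (t + 1) ^ (-(5 / 4) : ℝ) := by positivity
    exact nonneg_of_mul_nonneg_left h1 h2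
  have hdom := (hi.mul_prod hi).const_mul G
  have hms : MeasurableSet {p : ℝ × ℝ | p.1 < p.2} := measurableSet_lt measurable_fst measurable_snd
  refine hdom.mono' ?_ ?_
  · refine AEStronglyMeasurable.indicator ?_ hms
    rw [Measure.prod_restrict]
    refine ((continuousOn_uncurry_resonantIntegrand c hg).mono ?_).aestronglyMeasurable
      (measurableSet_Ioi.prod measurableSet_Ioi)
    exact prod_mono (Ioi_subset_Ioi ht.le) (Ioi_subset_Ioi ht.le)
  · rw [Measure.prod_restrict]
    refine ae_restrict_of_forall_mem (measurableSet_Ioi.prod measurableSet_Ioi) fun p hp => ?_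
    have h1 : 0 < p.1 := ht.trans hp.1
    have h2 : 0 < p.2 := ht.trans hp.2
    by_cases hlt : p.1 < p.2
    · rw [indicator_of_mem (show p ∈ {p : ℝ × ℝ | p.1 < p.2} from hlt),
        norm_resonantIntegrand c _ h1, norm_conjL2]
      have h3 : p.2 ^ (-(1 / 8) : ℝ) ≤ p.1 ^ (-(1 / 8) : ℝ) :=
        Real.rpow_le_rpow_of_nonpos h1 hlt.le (by norm_num)
      have e1 : p.1 ^ (-(9 / 8) : ℝ) = p.1⁻¹ * p.1 ^ (-(1 / 8) : ℝ) := by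
        rw [← Real.rpow_neg_one, ← Real.rpow_add h1]; norm_num
      have e2 : p.2 ^ (-(5 / 4) : ℝ) = p.2 ^ (-(1 / 8) : ℝ) * p.2 ^ (-(9 / 8) : ℝ) := by
        rw [← Real.rpow_add h2]; norm_num
      calc p.1⁻¹ * ‖g p.2‖ ≤ p.1⁻¹ * (G * (p.2 ^ (-(1 / 8) : ℝ) * p.2 ^ (-(9 / 8) : ℝ))) := by
            rw [← e2]
            exact mul_le_mul_of_nonneg_left (hG _ hp.2) (inv_pos.2 h1).le
        _ ≤ p.1⁻¹ * (G * (p.1 ^ (-(1 / 8) : ℝ) * p.2 ^ (-(9 / 8) : ℝ))) := by gcongr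
        _ = _ := by rw [e1]; ring
    · rw [indicator_of_notMem (show p ∉ {p : ℝ × ℝ | p.1 < p.2} from hlt), norm_zero]
      positivity

/-- After Fubini the oscillating variable `τ` is integrated first, over `(t, r)`, so cancellation is
available even though `g r` is controlled only in `L²`. -/
theorem integral_resonantIntegrand_tail_eq (c : ℝ) {g : ℝ → L2R} {G t : ℝ} (ht : 0 < t)
    (hg : ContinuousOn g (Ioi 0)) (hG : ∀ τ ∈ Ioi t, ‖g τ‖ ≤ G * τ ^ (-(5 / 4) : ℝ)) :
    ∫ τ in Ioi t, resonantIntegrand c (conjL2 (∫ r in Ioi τ, g r)) τ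
      = ∫ r in Ioi t, resonantDuhamel c t r (conjL2 (g r)) := by
  have hint := integrable_prod_resonantIntegrand c ht hg hG
  have hgi : IntegrableOn g (Ioi t) := integrableOn_Ioi_of_norm_le ht hg hG
  calc ∫ τ in Ioi t, resonantIntegrand c (conjL2 (∫ r in Ioi τ, g r)) τ
      = ∫ τ in Ioi t, ∫ r in Ioi t, {p : ℝ × ℝ | p.1 < p.2}.indicator
        (fun p => resonantIntegrand c (conjL2 (g p.2)) p.1) (τ, r) := by
        refine setIntegral_congr_fun measurableSet_Ioi fun τ hτ => ?_
        have h1 : resonantIntegrand c (conjL2 (∫ r in Ioi τ, g r)) τ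
            = ∫ r in Ioi τ, resonantIntegrand c (conjL2 (g r)) τ :=
          ((resonantCLM c τ).integral_comp_comm
            (hgi.mono_set (Ioi_subset_Ioi (le_of_lt hτ)))).symm
        have h2 : Ioi t ∩ Ioi τ = Ioi τ := inter_eq_right.2 (Ioi_subset_Ioi (le_of_lt hτ))
        rw [h1, ← h2, ← setIntegral_indicator measurableSet_Ioi]
        rfl
    _ = ∫ r in Ioi t, ∫ τ in Ioi t, {p : ℝ × ℝ | p.1 < p.2}.indicator
        (fun p => resonantIntegrand c (conjL2 (g p.2)) p.1) (τ, r) :=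
        integral_integral_swap hint
    _ = _ := by
        refine setIntegral_congr_fun measurableSet_Ioi fun r hr => ?_
        have h2 : Ioi t ∩ Iio r = Ioo t r := Ioi_inter_Iio
        rw [resonantDuhamel, intervalIntegral.integral_of_le (le_of_lt hr),
          integral_Ioc_eq_integral_Ioo, ← h2, ← setIntegral_indicator measurableSet_Iio]
        rfl

theorem continuousOn_integral_Ioi {t₀ : ℝ} (ht₀ : 0 < t₀) {F : ℝ → L2R}
    (hF : ContinuousOn F (Ioi 0)) (hi : IntegrableOn F (Ioi t₀)) :
    ContinuousOn (fun s => ∫ τ in Ioi s, F τ) (Ici t₀) := fun _ ht =>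
  (hasDerivAt_integral_Ioi ht₀ hF hi ht).continuousAt.continuousWithinAt

theorem integrable_resonantIntegrand_tail (c : ℝ) {g : ℝ → L2R} {G t : ℝ} (ht : 0 < t)
    (hg : ContinuousOn g (Ioi 0)) (hG : ∀ τ ∈ Ioi t, ‖g τ‖ ≤ G * τ ^ (-(5 / 4) : ℝ)) :
    IntegrableOn (fun τ => resonantIntegrand c (conjL2 (∫ r in Ioi τ, g r)) τ) (Ioi t) := by
  have hgi : IntegrableOn g (Ioi t) := integrableOn_Ioi_of_norm_le ht hg hG
  refine Integrable.mono' ((integrableOn_Ioi_rpow_five_fourths ht).const_mul (4 * G)) ?_ ?_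
  · have h0 : ContinuousOn (fun s => conjL2 (∫ τ in Ioi s, g τ)) (Ioi t) :=
      conjL2.continuous.comp_continuousOn
        ((continuousOn_integral_Ioi ht hg hgi).mono Ioi_subset_Ici_self)
    exact (continuousOn_resonantIntegrand (Ioi_subset_Ioi ht.le) c h0).aestronglyMeasurable
      measurableSet_Ioi
  · refine ae_restrict_of_forall_mem measurableSet_Ioi fun τ hτ => ?_
    have hτ0 : 0 < τ := ht.trans hτ
    rw [norm_resonantIntegrand c _ hτ0, norm_conjL2, ← inv_mul_rpow_neg_quarter hτ0, mul_left_comm]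
    refine mul_le_mul_of_nonneg_left ?_ (inv_pos.2 hτ0).le
    exact norm_setIntegral_Ioi_le_of_norm_le hτ0 fun r hr => hG r (show t < r from lt_trans hτ hr)

/-- Half of the decay comes from the `L² → L^∞` bound at time `t`, uniformly in `r`, the other half
from integrating `‖g r‖` over `(t, ∞)`. -/
theorem flowLinftyLe_integral_resonantIntegrand_tail {c : ℝ} (hc : |c| ≤ 1) {g : ℝ → L2R} {G t : ℝ}
    (ht : 0 < t) (hg : ContinuousOn g (Ioi 0))
    (hG : ∀ τ ∈ Ioi t, ‖g τ‖ ≤ G * τ ^ (-(5 / 4) : ℝ)) :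
    FlowLinftyLe (∫ τ in Ioi t, resonantIntegrand c (conjL2 (∫ r in Ioi τ, g r)) τ)
      (4 * resonantConst * G * t ^ (-(1 / 2) : ℝ)) := by
  rw [integral_resonantIntegrand_tail_eq c ht hg hG]
  have hC := resonantConst_nonneg
  have hint : IntegrableOn (fun r => resonantDuhamel c t r (conjL2 (g r))) (Ioi t) := by
    refine (integrable_prod_resonantIntegrand c ht hg hG).integral_prod_right.congr ?_
    refine ae_restrict_of_forall_mem measurableSet_Ioi fun r hr => ?_
    have h2 : Ioi t ∩ Iio r = Ioo t r := Ioi_inter_Iio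
    simp only
    rw [resonantDuhamel, intervalIntegral.integral_of_le (le_of_lt hr),
      integral_Ioc_eq_integral_Ioo, ← h2, ← setIntegral_indicator measurableSet_Iio]
    rfl
  have hm := (integrableOn_Ioi_rpow_five_fourths ht).const_mul
    (resonantConst * t ^ (-(1 / 4) : ℝ) * G)
  refine (FlowLinftyLe.integral hint hm ?_).mono (le_of_eq ?_)
  · refine ae_restrict_of_forall_mem measurableSet_Ioi fun r hr => ?_
    refine (flowLinftyLe_resonantDuhamel hc ht (le_of_lt hr) _).mono ?_
    rw [norm_conjL2, mul_assoc _ G]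
    exact mul_le_mul_of_nonneg_left (hG r hr) (by positivity)
  · rw [integral_const_mul, integral_Ioi_rpow_five_fourths ht]
    have : t ^ (-(1 / 2) : ℝ) = t ^ (-(1 / 4) : ℝ) * t ^ (-(1 / 4) : ℝ) := by
      rw [← Real.rpow_add ht]; norm_num
    rw [this]
    ring

theorem linftyLe_gaugedFlow {f : L2R} {B : ℝ} (c t : ℝ) (h : LinftyLe (freeSchrodinger t f) B) :
    LinftyLe (gaugedFlow c t f) B :=
  h.smul_of_norm_eq_one (norm_gaugePhase c t)

/-- The flow `e^{it∂ₛ²}` combines with `e^{-iτ∂ₛ²}` inside the forcing, so the dispersive estimate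
acts over the time `τ - t`, on a nonlinearity whose `L¹` norm is at most `P N²`. -/
theorem linftyLe_freeSchrodinger_integral_nonlinearForcing (c : ℝ) {a M t P N : ℝ} (hM : 0 < M)
    (ht : 0 < t) {y : ℝ → L2R} (hi : IntegrableOn (fun τ => nonlinearForcing c a M τ (y τ)) (Ioi t))
    (hP : ∀ τ ∈ Ioi t, 3 * |a| + 2 * (M * τ ^ (-(1 / 2) : ℝ)) ≤ P)
    (hN : ∀ τ ∈ Ioi t, ‖y τ‖ ≤ N) :
    LinftyLe (freeSchrodinger t (∫ τ in Ioi t, nonlinearForcing c a M τ (y τ)))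
      (Real.pi * (P * N ^ 2) * t ^ (-(1 / 2) : ℝ)) := by
  rw [freeSchrodinger_integral hi]
  have hm := (integrableOn_sub_rpow_mul_inv ht).mul_const (P * N ^ 2)
  refine (LinftyLe.integral (integrable_freeSchrodinger hi t) hm ?_).mono (le_of_eq ?_)
  · refine ae_restrict_of_forall_mem measurableSet_Ioi fun τ hτ => ?_
    have hτ0 : 0 < τ := ht.trans hτ
    have hm0 : 0 < M * τ ^ (-(1 / 2) : ℝ) := by positivity
    have hne : t + -τ ≠ 0 := by
      have : t < τ := hτ
      linarith
    rw [nonlinearForcing, freeSchrodinger_smul, freeSchrodinger_freeSchrodinger]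
    have h1 := linftyLe_freeSchrodinger hne
      (integrable_truncNonlinearity a hm0 (gaugedFlow c τ (y τ)))
    refine (h1.smul _).mono ?_
    rw [norm_mul, norm_gaugePhase, mul_one, Complex.norm_real,
      Real.norm_of_nonneg (inv_pos.2 hτ0).le]
    have h2 : |t + -τ| = τ - t := by
      rw [abs_of_neg (by have : t < τ := hτ; linarith)]; ring
    rw [h2]
    have h3 : 0 < τ - t := sub_pos.2 hτ
    have h4 := integral_norm_truncNonlinearity_le a hm0 (gaugedFlow c τ (y τ))
    rw [norm_gaugedFlow] at h4
    have h5 : (3 * |a| + 2 * (M * τ ^ (-(1 / 2) : ℝ))) * ‖y τ‖ ^ 2 ≤ P * N ^ 2 :=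
      mul_le_mul (hP τ hτ) (pow_le_pow_left₀ (norm_nonneg _) (hN τ hτ) 2) (by positivity)
        (le_trans (by positivity) (hP τ hτ))
    have h6 : 0 ≤ (τ - t) ^ (-(1 / 2) : ℝ) * τ⁻¹ := by positivity
    calc _ = (τ - t) ^ (-(1 / 2) : ℝ) * τ⁻¹ *
          ∫ x, ‖truncNonlinearity a (M * τ ^ (-(1 / 2) : ℝ)) (gaugedFlow c τ (y τ)) x‖ := by ring
      _ ≤ _ := mul_le_mul_of_nonneg_left (h4.trans h5) h6
  · rw [integral_mul_const, integral_sub_rpow_mul_inv ht]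
    ring

theorem integrableOn_resonantIntegrand_resonantTail {c : ℝ} (hc : |c| ≤ 1) {t : ℝ} (ht : 0 < t)
    {g : L2R} (hg : Integrable g) :
    IntegrableOn (fun τ => resonantIntegrand c (conjL2 (resonantTail c τ g)) τ) (Ioi t) := by
  have h0 : ContinuousOn (fun τ => resonantTail c τ g) (Ioi 0) := fun τ hτ =>
    (hasDerivAt_resonantTail hc hτ hg).continuousAt.continuousWithinAt
  have h1 : ContinuousOn (fun τ => conjL2 (resonantTail c τ g)) (Ioi 0) :=
    conjL2.continuous.comp_continuousOn h0
  refine integrableOn_Ioi_of_norm_le (B := resonantConst * ∫ x, ‖g x‖) ht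
    (continuousOn_resonantIntegrand subset_rfl c h1) fun τ hτ => ?_
  have hτ0 : 0 < τ := ht.trans hτ
  rw [norm_resonantIntegrand c _ hτ0, norm_conjL2, ← inv_mul_rpow_neg_quarter hτ0, mul_left_comm]
  refine mul_le_mul_of_nonneg_left ((norm_resonantTail_le hc hτ0 hg).trans (le_of_eq ?_))
    (inv_pos.2 hτ0).le
  ring

/-- The tail already decays like `τ^{-1/2}` in sup norm along the flow; the factor `1/τ` makes this
integrable without further oscillation. -/
theorem flowLinftyLe_integral_resonantTail {c : ℝ} (hc : |c| ≤ 1) {t : ℝ} (ht : 0 < t)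
    {g : L2R} (hg : Integrable g) :
    FlowLinftyLe (∫ τ in Ioi t, resonantIntegrand c (conjL2 (resonantTail c τ g)) τ)
      (2 * resonantConst * (∫ x, ‖g x‖) * t ^ (-(1 / 2) : ℝ)) := by
  have hm : IntegrableOn (fun τ : ℝ => resonantConst * (∫ x, ‖g x‖) * τ ^ (-(3 / 2) : ℝ)) (Ioi t) :=
    (integrableOn_Ioi_rpow_of_lt (by norm_num) ht).const_mul _
  have hC := resonantConst_nonneg
  have hg0 : 0 ≤ ∫ x, ‖g x‖ := integral_nonneg fun _ => norm_nonneg _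
  refine (FlowLinftyLe.integral (integrableOn_resonantIntegrand_resonantTail hc ht hg) hm ?_).mono
    (le_of_eq ?_)
  · refine ae_restrict_of_forall_mem measurableSet_Ioi fun τ hτ => ?_
    have hτ0 : 0 < τ := ht.trans hτ
    have h1 := (flowLinftyLe_resonantTail hc hτ0 hg).conj (by positivity)
    refine (flowLinftyLe_resonantIntegrand h1 c hτ0).mono (le_of_eq ?_)
    have : τ ^ (-(3 / 2) : ℝ) = τ⁻¹ * τ ^ (-(1 / 2) : ℝ) := by
      rw [← Real.rpow_neg_one, ← Real.rpow_add hτ0]; norm_num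
    rw [this]
    ring
  · rw [integral_const_mul, integral_Ioi_rpow_of_lt (by norm_num) ht]
    norm_num
    ring

theorem resonantIntegrand_conj_smul (c τ : ℝ) (k : ℂ) (f : L2R) :
    resonantIntegrand c (conjL2 (k • f)) τ
      = (starRingEnd ℂ) k • resonantIntegrand c (conjL2 f) τ := by
  rw [resonantIntegrand, conjL2_smul, freeSchrodinger_smul, smul_comm, resonantIntegrand]

/-! ### The a posteriori sup-norm bound. -/

section

variable {σ a M t₀ : ℝ}

/-- The sup-norm bound for the profile, in terms of `S = ‖u‖_{L¹}` and `E = ‖u‖_{L²}`. -/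
noncomputable def profileSupBound (M t₀ S E : ℝ) : ℝ :=
  S + resonantConst * S + 2 * resonantConst * S
    + 4 * resonantConst * ((2 * resonantConst * S + 8 * E) / 8 + E)
    + Real.pi * ((3 + 2 * (M * t₀ ^ (-(1 / 2) : ℝ)))
      * (E + (2 * resonantConst * S + 8 * E) * t₀ ^ (-(1 / 4) : ℝ)) ^ 2)

/-- The terms of `profileSupBound` are, in order: the free evolution of `u`; the resonant tail of
`u`; the two pieces of the resonant integral of `x`; the nonlinear terms. All carry `t^{-1/2}`, and
the factors `a²` are bounded by `1`. -/
theorem ProfileSmallness.linftyLe_gaugedFlow (h : ProfileSmallness σ a M t₀) {u : L2R}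
    (hu : Integrable u) {x : ℝ → L2R} (hx : Continuous x)
    (hfix : ∀ t, t₀ ≤ t → profileMap σ a M u x t = x t)
    (hD : ∀ t, t₀ ≤ t → ‖x t‖
        ≤ (2 * resonantConst * (∫ s, ‖u s‖) + 8 * ‖u‖) * t ^ (-(1 / 4) : ℝ)) {t : ℝ} (ht : t₀ ≤ t) :
    LinftyLe (gaugedFlow (σ * a ^ 2) t (u + x t))
      (profileSupBound M t₀ (∫ s, ‖u s‖) ‖u‖ * t ^ (-(1 / 2) : ℝ)) := by
  set S := ∫ s, ‖u s‖ with hS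
  set c := σ * a ^ 2 with hcdef
  set D := 2 * resonantConst * S + 8 * ‖u‖ with hDdef
  have hC := resonantConst_nonneg
  have hS0 : 0 ≤ S := integral_nonneg fun _ => norm_nonneg _
  have hD0 : 0 ≤ D := by positivity
  have ht0 : 0 < t := h.time_pos.trans_le ht
  have hc : |c| ≤ 1 := h.abs_coupling_le
  have ha2 := h.sq_le_eighth
  have hcu := integrable_conjL2 hu
  have hScu : ∫ s, ‖conjL2 u s‖ = S := integral_norm_conjL2 u
  set g := profileForcing c a M u x with hg
  have hgc : ContinuousOn g (Ioi 0) :=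
    continuousOn_profileForcing subset_rfl c a h.height_pos u hx.continuousOn
  have hgb : ∀ τ ∈ Ioi t, ‖g τ‖ ≤ (D / 8 + ‖u‖) * τ ^ (-(5 / 4) : ℝ) := fun τ hτ =>
    h.norm_forcing_le c u (ht.trans (le_of_lt hτ)) (hD τ (ht.trans (le_of_lt hτ)))
  set k : ℂ := -(Complex.I * σ) with hk
  have hkn : ‖k‖ = 1 := h.norm_factor
  have htail := flowLinftyLe_resonantTail hc ht0 hcu
  have hlin1 := flowLinftyLe_integral_resonantTail hc ht0 hcu
  have hlin2 := flowLinftyLe_integral_resonantIntegrand_tail hc ht0 hgc hgb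
  rw [hScu] at htail hlin1
  have hlin_int1 := integrableOn_resonantIntegrand_resonantTail hc ht0 hcu
  have hlin_int2 := integrable_resonantIntegrand_tail c ht0 hgc hgb
  have hlin_int1' : IntegrableOn (fun τ => ((a ^ 2 : ℝ) : ℂ) •
      resonantIntegrand c (conjL2 (resonantTail c τ (conjL2 u))) τ) (Ioi t) :=
    Integrable.smul ((a ^ 2 : ℝ) : ℂ) hlin_int1
  -- The integral equation is inserted into its own linear term: no sup-norm bound for `x` is known
  -- yet, but each of the two pieces of `x` admits one after integration.
  have hxeq : ∀ τ ∈ Ioi t, resonantIntegrand c (conjL2 (x τ)) τ = (starRingEnd ℂ) k •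
      (((a ^ 2 : ℝ) : ℂ) • resonantIntegrand c (conjL2 (resonantTail c τ (conjL2 u))) τ
        + resonantIntegrand c (conjL2 (∫ r in Ioi τ, g r)) τ) := by
    intro τ hτ
    rw [← hfix τ (ht.trans (le_of_lt hτ)), profileMap, resonantIntegrand_conj_smul,
      ← resonantCLM_apply, map_add, resonantCLM_apply, resonantCLM_apply,
      resonantIntegrand_conj_smul, Complex.conj_ofReal]
  have hlin_int : IntegrableOn (fun τ => resonantIntegrand c (conjL2 (x τ)) τ) (Ioi t) := by
    refine IntegrableOn.congr_fun ?_ (fun τ hτ => (hxeq τ hτ).symm) measurableSet_Ioi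
    exact (hlin_int1'.add hlin_int2).smul ((starRingEnd ℂ) k)
  have hlin_int' : IntegrableOn (fun τ => ((a ^ 2 : ℝ) : ℂ) •
      resonantIntegrand c (conjL2 (x τ)) τ) (Ioi t) :=
    Integrable.smul ((a ^ 2 : ℝ) : ℂ) hlin_int
  have hlin : FlowLinftyLe (∫ τ in Ioi t, resonantIntegrand c (conjL2 (x τ)) τ)
      ((2 * resonantConst * S + 4 * resonantConst * (D / 8 + ‖u‖)) * t ^ (-(1 / 2) : ℝ)) := by
    rw [setIntegral_congr_fun measurableSet_Ioi hxeq, integral_smul,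
      integral_add hlin_int1' hlin_int2, integral_smul]
    refine (((hlin1.smul ((a ^ 2 : ℝ) : ℂ)).add hlin2).smul ((starRingEnd ℂ) k)).mono ?_
    rw [RCLike.norm_conj, hkn, one_mul, Complex.norm_real, Real.norm_of_nonneg (sq_nonneg a), add_mul]
    refine add_le_add_left ?_ _
    exact mul_le_of_le_one_left (by positivity) (by linarith)
  have hgi : IntegrableOn g (Ioi t) :=
    h.integrableOn_forcing c u hx.continuousOn hD ht
  have hnl_int : IntegrableOn (fun τ => nonlinearForcing c a M τ (u + x τ)) (Ioi t) := by
    refine (hgi.sub (hlin_int.smul ((a ^ 2 : ℝ) : ℂ))).congr (Eventually.of_forall fun τ => ?_)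
    simp only [Pi.sub_apply, Pi.smul_apply, hg, profileForcing, add_sub_cancel_left]
  have hw := h.time_pos
  have hnl := linftyLe_freeSchrodinger_integral_nonlinearForcing c (a := a) (y := fun τ => u + x τ)
    (P := 3 + 2 * (M * t₀ ^ (-(1 / 2) : ℝ))) (N := ‖u‖ + D * t₀ ^ (-(1 / 4) : ℝ))
    h.height_pos ht0 hnl_int (fun τ hτ => by
      have h1 : τ ^ (-(1 / 2) : ℝ) ≤ t₀ ^ (-(1 / 2) : ℝ) :=
        Real.rpow_le_rpow_of_nonpos hw (ht.trans (le_of_lt hτ)) (by norm_num)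
      have h2 : |a| ≤ 1 := by
        rw [← sq_le_one_iff_abs_le_one]; linarith
      have h3 := mul_le_mul_of_nonneg_left h1 h.height_pos.le
      linarith) (fun τ hτ => by
      have h1 : τ ^ (-(1 / 4) : ℝ) ≤ t₀ ^ (-(1 / 4) : ℝ) :=
        Real.rpow_le_rpow_of_nonpos hw (ht.trans (le_of_lt hτ)) (by norm_num)
      have h2 := hD τ (ht.trans (le_of_lt hτ))
      have h3 := mul_le_mul_of_nonneg_left h1 hD0
      exact (norm_add_le _ _).trans (by linarith))
  have hsplit : ∫ τ in Ioi t, g τ = ((a ^ 2 : ℝ) : ℂ) •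
      (∫ τ in Ioi t, resonantIntegrand c (conjL2 (x τ)) τ)
      + ∫ τ in Ioi t, nonlinearForcing c a M τ (u + x τ) := by
    rw [← integral_smul, ← integral_add hlin_int' hnl_int]
    rfl
  refine _root_.linftyLe_gaugedFlow c t ?_
  have hfin : freeSchrodinger t (u + x t) = freeSchrodinger t u + k •
      (((a ^ 2 : ℝ) : ℂ) • freeSchrodinger t (resonantTail c t (conjL2 u))
      + (((a ^ 2 : ℝ) : ℂ) • freeSchrodinger t
        (∫ τ in Ioi t, resonantIntegrand c (conjL2 (x τ)) τ)
      + freeSchrodinger t (∫ τ in Ioi t, nonlinearForcing c a M τ (u + x τ)))) := by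
    rw [freeSchrodinger_add_right]
    congr 1
    rw [← hfix t ht, profileMap, freeSchrodinger_smul, freeSchrodinger_add_right,
      freeSchrodinger_smul, hsplit, freeSchrodinger_add_right, freeSchrodinger_smul]
  rw [hfin]
  have hz := linftyLe_freeSchrodinger ht0.ne' hu
  rw [abs_of_pos ht0] at hz
  refine (hz.add ((((htail t).smul ((a ^ 2 : ℝ) : ℂ)).add
    (((hlin t).smul ((a ^ 2 : ℝ) : ℂ)).add hnl)).smul_of_norm_eq_one hkn)).mono ?_
  rw [Complex.norm_real, Real.norm_of_nonneg (sq_nonneg a)]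
  have hp : 0 ≤ t ^ (-(1 / 2) : ℝ) := by positivity
  have e1 : a ^ 2 * (resonantConst * t ^ (-(1 / 2) : ℝ) * S)
      ≤ resonantConst * t ^ (-(1 / 2) : ℝ) * S :=
    mul_le_of_le_one_left (by positivity) (by linarith)
  have e2 : a ^ 2 * ((2 * resonantConst * S + 4 * resonantConst * (D / 8 + ‖u‖))
        * t ^ (-(1 / 2) : ℝ))
      ≤ (2 * resonantConst * S + 4 * resonantConst * (D / 8 + ‖u‖)) * t ^ (-(1 / 2) : ℝ) :=
    mul_le_of_le_one_left (by positivity) (by linarith)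
  unfold profileSupBound
  rw [← hDdef]
  linarith

end

/-! ### From the fixed point back to the equation. -/

theorem gpNonlinearity_add_eq (σ a τ s : ℝ) (w : ℝ → ℝ → ℂ) :
    gpNonlinearity σ a (fun t s => (a : ℂ) + w t s) τ s = ((σ / τ : ℝ) : ℂ) *
      (((a ^ 2 : ℝ) : ℂ) * w τ s + ((a ^ 2 : ℝ) : ℂ) * (starRingEnd ℂ) (w τ s)
        + ((a : ℂ) * (2 * ((‖w τ s‖ ^ 2 : ℝ) : ℂ) + w τ s ^ 2)
          + ((‖w τ s‖ ^ 2 : ℝ) : ℂ) * w τ s)) := by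
  have h1 : ∀ z : ℂ, ((‖z‖ ^ 2 : ℝ) : ℂ) = z * (starRingEnd ℂ) z := fun z => by
    rw [Complex.mul_conj, Complex.normSq_eq_norm_sq]
  rw [gpNonlinearity, Complex.ofReal_mul, Complex.ofReal_sub, h1, h1, map_add, Complex.conj_ofReal]
  push_cast
  ring

/-- The nonlinear term of the equation, truncated, as an element of `L²`. -/
noncomputable def truncForcing (σ a M τ : ℝ) (w : L2R) : L2R :=
  ((σ / τ : ℝ) : ℂ) • (((a ^ 2 : ℝ) : ℂ) • w + ((a ^ 2 : ℝ) : ℂ) • conjL2 w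
    + truncNonlinearity a (M * τ ^ (-(1 / 2) : ℝ)) w)

theorem truncForcing_ae_eq (σ a : ℝ) {M τ : ℝ} (hM : 0 < M) (hτ : 0 < τ) (w : ℝ → L2R)
    (hw : LinftyLe (w τ) (M * τ ^ (-(1 / 2) : ℝ))) :
    truncForcing σ a M τ (w τ)
      =ᵐ[volume] gpNonlinearity σ a (fun t s => (a : ℂ) + w t s) τ := by
  have hm : 0 < M * τ ^ (-(1 / 2) : ℝ) := by positivity
  unfold truncForcing
  filter_upwards [coeFn_truncNonlinearity_of_le a hm (hw.ae_le hm.le), coeFn_conjL2 (w τ),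
    Lp.coeFn_smul ((σ / τ : ℝ) : ℂ) (((a ^ 2 : ℝ) : ℂ) • w τ + ((a ^ 2 : ℝ) : ℂ) • conjL2 (w τ)
      + truncNonlinearity a (M * τ ^ (-(1 / 2) : ℝ)) (w τ)),
    Lp.coeFn_add (((a ^ 2 : ℝ) : ℂ) • w τ + ((a ^ 2 : ℝ) : ℂ) • conjL2 (w τ))
      (truncNonlinearity a (M * τ ^ (-(1 / 2) : ℝ)) (w τ)),
    Lp.coeFn_add (((a ^ 2 : ℝ) : ℂ) • w τ) (((a ^ 2 : ℝ) : ℂ) • conjL2 (w τ)),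
    Lp.coeFn_smul ((a ^ 2 : ℝ) : ℂ) (w τ), Lp.coeFn_smul ((a ^ 2 : ℝ) : ℂ) (conjL2 (w τ))]
    with s h1 h2 h3 h4 h5 h6 h7
  rw [gpNonlinearity_add_eq σ a τ s (fun t s => w t s), h3, Pi.smul_apply, h4, Pi.add_apply, h5,
    Pi.add_apply, h6, h7, Pi.smul_apply, Pi.smul_apply, h1, h2]
  rfl

theorem hasDerivAt_gaugePhase (c : ℝ) {t : ℝ} (ht : 0 < t) :
    HasDerivAt (gaugePhase c) (((c / t : ℝ) : ℂ) * Complex.I * gaugePhase c t) t := by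
  have h1 : HasDerivAt (fun τ : ℝ => ((c * Real.log τ : ℝ) : ℂ)) ((c * t⁻¹ : ℝ) : ℂ) t :=
    ((Real.hasDerivAt_log ht.ne').const_mul c).ofReal_comp
  refine (h1.mul_const Complex.I).cexp.congr_deriv ?_
  rw [gaugePhase, div_eq_mul_inv]
  ring

/-- Conjugation reverses both the flow and the phase. They therefore double instead of cancelling
when the interaction picture is undone: the source of the oscillation in `resonantIntegrand`. -/
theorem freeSchrodinger_neg_conj_gaugedFlow (c τ : ℝ) (y : L2R) :
    freeSchrodinger (-τ) (conjL2 (gaugedFlow c τ y))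
      = gaugePhase (-c) τ • freeSchrodinger (-(2 * τ)) (conjL2 y) := by
  rw [gaugedFlow, conjL2_smul, conj_gaugePhase, freeSchrodinger_smul, conjL2_freeSchrodinger,
    freeSchrodinger_freeSchrodinger]
  congr 2
  ring

theorem freeSchrodinger_neg_gaugedFlow (c τ : ℝ) (y : L2R) :
    freeSchrodinger (-τ) (gaugedFlow c τ y) = gaugePhase c τ • y := by
  rw [gaugedFlow, freeSchrodinger_smul, freeSchrodinger_freeSchrodinger, neg_add_cancel,
    freeSchrodinger_zero_left]

/-- Differentiating the gauge phase reproduces the term `a²w`; the remaining terms match the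
conjugate and the truncated parts of the forcing. -/
theorem profile_derivative_eq (σ a M : ℝ) {t : ℝ} (u : L2R) (x : ℝ → L2R) :
    gaugePhase (σ * a ^ 2) t • ((Complex.I * σ) •
      (((a ^ 2 : ℝ) : ℂ) • resonantIntegrand (σ * a ^ 2) (conjL2 u) t
        + profileForcing (σ * a ^ 2) a M u x t))
      + (((σ * a ^ 2 / t : ℝ) : ℂ) * Complex.I * gaugePhase (σ * a ^ 2) t) • (u + x t)
    = Complex.I • freeSchrodinger (-t)
      (truncForcing σ a M t (gaugedFlow (σ * a ^ 2) t (u + x t))) := by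
  set c := σ * a ^ 2 with hc
  have hg1 : gaugePhase c t * gaugePhase (-(2 * c)) t = gaugePhase (-c) t := by
    rw [← gaugePhase_add]; congr 1; ring
  have hg2 : gaugePhase c t * gaugePhase (-c) t = 1 := by
    rw [← gaugePhase_add, add_neg_cancel, gaugePhase_zero]
  have hr : resonantIntegrand c (conjL2 u) t + resonantIntegrand c (conjL2 (x t)) t
      = (((t⁻¹ : ℝ) : ℂ) * gaugePhase (-(2 * c)) t) •
        freeSchrodinger (-(2 * t)) (conjL2 (u + x t)) := by
    rw [resonantIntegrand, resonantIntegrand, map_add, freeSchrodinger_add_right, smul_add]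
  have h1 : ((a ^ 2 : ℝ) : ℂ) • resonantIntegrand c (conjL2 u) t + profileForcing c a M u x t
      = ((a ^ 2 : ℝ) : ℂ) • ((((t⁻¹ : ℝ) : ℂ) * gaugePhase (-(2 * c)) t) •
        freeSchrodinger (-(2 * t)) (conjL2 (u + x t))) + nonlinearForcing c a M t (u + x t) := by
    rw [profileForcing, ← add_assoc, ← smul_add, hr]
  rw [h1, truncForcing, freeSchrodinger_smul, freeSchrodinger_add_right, freeSchrodinger_add_right,
    freeSchrodinger_smul, freeSchrodinger_smul, freeSchrodinger_neg_conj_gaugedFlow,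
    freeSchrodinger_neg_gaugedFlow, nonlinearForcing]
  simp only [smul_add, smul_smul]
  have e1 : gaugePhase c t * (Complex.I * σ * (((a ^ 2 : ℝ) : ℂ)
        * (((t⁻¹ : ℝ) : ℂ) * gaugePhase (-(2 * c)) t)))
      = Complex.I * (((σ / t : ℝ) : ℂ) * (((a ^ 2 : ℝ) : ℂ) * gaugePhase (-c) t)) := by
    rw [← hg1]; push_cast; ring
  have e2 : gaugePhase c t * (Complex.I * σ * (((t⁻¹ : ℝ) : ℂ) * gaugePhase (-c) t))
      = Complex.I * ((σ / t : ℝ) : ℂ) := by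
    calc _ = Complex.I * σ * ((t⁻¹ : ℝ) : ℂ) * (gaugePhase c t * gaugePhase (-c) t) := by ring
      _ = _ := by rw [hg2]; push_cast; ring
  have e3 : ((c / t : ℝ) : ℂ) * Complex.I * gaugePhase c t
      = Complex.I * (((σ / t : ℝ) : ℂ) * (((a ^ 2 : ℝ) : ℂ) * gaugePhase c t)) := by
    rw [hc]; push_cast; ring
  simp only [mul_assoc] at e1 e2 e3 ⊢
  rw [e1, e2, e3]
  abel

section

variable {σ a M t₀ : ℝ}

theorem continuousOn_truncForcing {s : Set ℝ} (hs : s ⊆ Ioi 0) (σ a : ℝ) (hM : 0 < M)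
    {w : ℝ → L2R} (hw : ContinuousOn w s) :
    ContinuousOn (fun τ => truncForcing σ a M τ (w τ)) s := by
  unfold truncForcing
  have h1 : ContinuousOn (fun τ : ℝ => σ / τ) s :=
    continuousOn_const.div continuousOn_id fun x hx => (hs hx : (0 : ℝ) < x).ne'
  have h3 : ContinuousOn (fun τ : ℝ => M * τ ^ (-(1 / 2) : ℝ)) s :=
    continuousOn_const.mul (ContinuousOn.rpow_const continuousOn_id
      fun x hx => Or.inl (hs hx : (0 : ℝ) < x).ne')
  have h4 := continuousOn_truncNonlinearity a h3 (fun τ hτ => by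
    have : (0 : ℝ) < τ := hs hτ
    positivity) hw
  have h5 : ContinuousOn (fun τ => conjL2 (w τ)) s := conjL2.continuous.comp_continuousOn hw
  have h6 : ContinuousOn (fun τ => ((σ / τ : ℝ) : ℂ)) s :=
    Complex.continuous_ofReal.comp_continuousOn h1
  exact h6.smul (((hw.const_smul ((a ^ 2 : ℝ) : ℂ)).add (h5.const_smul ((a ^ 2 : ℝ) : ℂ))).add h4)

/-- The derivative of `e^{-iτ∂ₛ²} w(τ)` is `i e^{-iτ∂ₛ²}` applied to the forcing; this is integrated
from `t₀` to `t` and transported by `e^{it∂ₛ²}`. -/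
theorem ProfileSmallness.duhamel (h : ProfileSmallness σ a M t₀) {u : L2R}
    (hu : Integrable u) {x : ℝ → L2R} {D : ℝ} (hx : Continuous x)
    (hfix : ∀ t, t₀ ≤ t → profileMap σ a M u x t = x t)
    (hD : ∀ t, t₀ ≤ t → ‖x t‖ ≤ D * t ^ (-(1 / 4) : ℝ)) {t : ℝ} (ht : t₀ ≤ t) :
    gaugedFlow (σ * a ^ 2) t (u + x t)
      = freeSchrodinger (t - t₀) (gaugedFlow (σ * a ^ 2) t₀ (u + x t₀))
        + Complex.I • ∫ τ in t₀..t, freeSchrodinger (t - τ)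
          (truncForcing σ a M τ (gaugedFlow (σ * a ^ 2) τ (u + x τ))) := by
  set c := σ * a ^ 2 with hc
  set F : ℝ → L2R := fun τ => truncForcing σ a M τ (gaugedFlow c τ (u + x τ)) with hF
  have ht₀ := h.time_pos
  have hFc : ContinuousOn F (Ioi 0) := continuousOn_truncForcing subset_rfl σ a h.height_pos
    (continuousOn_gaugedFlow subset_rfl c (continuous_const.add hx).continuousOn)
  have hsub : uIcc t₀ t ⊆ Ioi 0 := by
    rw [uIcc_of_le ht]; exact fun y hy => ht₀.trans_le hy.1
  have hUFc : ContinuousOn (fun τ => freeSchrodinger (-τ) (F τ)) (uIcc t₀ t) :=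
    continuous_freeSchrodinger.comp_continuousOn (f := fun τ => (-τ, F τ))
      (by have := hFc.mono hsub; fun_prop)
  -- `profileMap` stands in place of `x` because it is differentiable from both sides at `t₀`, while
  -- the two agree only on `[t₀, ∞)`.
  have hder : ∀ τ ∈ uIcc t₀ t, HasDerivAt
      (fun τ => gaugePhase c τ • (u + profileMap σ a M u x τ))
      (Complex.I • freeSchrodinger (-τ) (F τ)) τ := by
    intro τ hτ
    have hτ' : t₀ ≤ τ := by rw [uIcc_of_le ht] at hτ; exact hτ.1
    have h1 := (h.hasDerivAt_map hu hx.continuousOn hD hτ').const_add u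
    refine ((hasDerivAt_gaugePhase c (hsub hτ)).smul h1).congr_deriv ?_
    rw [hfix τ hτ']
    exact profile_derivative_eq σ a M u x
  have hFTC := intervalIntegral.integral_eq_sub_of_hasDerivAt hder
    (hUFc.const_smul Complex.I).intervalIntegrable
  rw [hfix t ht, hfix t₀ le_rfl, intervalIntegral.integral_smul, eq_sub_iff_add_eq] at hFTC
  have h2 : freeSchrodinger t (∫ τ in t₀..t, freeSchrodinger (-τ) (F τ))
      = ∫ τ in t₀..t, freeSchrodinger (t - τ) (F τ) := by
    rw [intervalIntegral.integral_of_le ht, intervalIntegral.integral_of_le ht,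
      freeSchrodinger_integral hUFc.intervalIntegrable.1]
    refine integral_congr_ae (Eventually.of_forall fun τ => ?_)
    simp only
    rw [freeSchrodinger_freeSchrodinger, sub_eq_add_neg]
  have h3 : gaugedFlow c t (u + x t) = freeSchrodinger t (gaugePhase c t • (u + x t)) := by
    rw [freeSchrodinger_smul, gaugedFlow]
  rw [h3, ← hFTC, freeSchrodinger_add_right, freeSchrodinger_smul, h2, add_comm]
  congr 1
  rw [sub_eq_add_neg, ← freeSchrodinger_freeSchrodinger, freeSchrodinger_neg_gaugedFlow]

/-- The fourth power of `τ^{-1/2}` integrates to `t⁻¹`, whose fourth root is `t^{-1/4}`. -/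
theorem normL4Linfty_le {t B : ℝ} (ht : 0 < t) (hB : 0 ≤ B) {r : ℝ → ℝ → ℂ}
    (hr : ∀ τ ∈ Ioi t, eLpNorm (r τ) ∞ volume ≤ ENNReal.ofReal (B * τ ^ (-(1 / 2) : ℝ))) :
    normL4Linfty t r ≤ ENNReal.ofReal (B * t ^ (-(1 / 4) : ℝ)) := by
  have h1 : ∫⁻ τ in Ioi t, eLpNorm (r τ) ∞ volume ^ (4 : ℝ)
      ≤ ENNReal.ofReal (B ^ 4 * t⁻¹) := by
    have hi : IntegrableOn (fun τ : ℝ => B ^ 4 * τ ^ (-2 : ℝ)) (Ioi t) :=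
      (integrableOn_Ioi_rpow_of_lt (by norm_num) ht).const_mul _
    have hv : ∫ τ in Ioi t, B ^ 4 * τ ^ (-2 : ℝ) = B ^ 4 * t⁻¹ := by
      rw [integral_const_mul, integral_Ioi_rpow_of_lt (by norm_num) ht]
      norm_num
      rw [Real.rpow_neg_one]
      simp
    rw [← hv, ofReal_integral_eq_lintegral_ofReal hi (ae_restrict_of_forall_mem measurableSet_Ioi
      fun τ hτ => by
        have : 0 < τ := ht.trans hτ
        positivity)]
    refine setLIntegral_mono' measurableSet_Ioi fun τ hτ => ?_
    have hτ0 : 0 < τ := ht.trans hτ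
    refine (ENNReal.rpow_le_rpow (hr τ hτ) (by norm_num)).trans (le_of_eq ?_)
    rw [ENNReal.ofReal_rpow_of_nonneg (by positivity) (by norm_num),
      Real.mul_rpow hB (by positivity), ← Real.rpow_mul hτ0.le]
    norm_num
  refine (ENNReal.rpow_le_rpow h1 (by norm_num)).trans (le_of_eq ?_)
  rw [ENNReal.ofReal_rpow_of_nonneg (by positivity) (by norm_num),
    Real.mul_rpow (by positivity) (by positivity), ← Real.rpow_natCast, ← Real.rpow_mul hB,
    Real.inv_rpow ht.le, ← Real.rpow_neg ht.le]
  norm_num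

theorem ProfileSmallness.isLongRangeSolution (h : ProfileSmallness σ a M t₀) {u : L2R}
    (hu : Integrable u) {x : ℝ → L2R} {D : ℝ} (hx : Continuous x)
    (hfix : ∀ t, t₀ ≤ t → profileMap σ a M u x t = x t)
    (hD : ∀ t, t₀ ≤ t → ‖x t‖ ≤ D * t ^ (-(1 / 4) : ℝ))
    (hsup : ∀ t, t₀ ≤ t →
      LinftyLe (gaugedFlow (σ * a ^ 2) t (u + x t)) (M * t ^ (-(1 / 2) : ℝ))) :
    IsLongRangeSolution σ a t₀ u
      (fun t s => (a : ℂ) + gaugedFlow (σ * a ^ 2) t (u + x t) s) := by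
  set c := σ * a ^ 2 with hc
  have ht₀ := h.time_pos
  have hIci : Ici t₀ ⊆ Ioi 0 := fun y hy => ht₀.trans_le hy
  have hyc : Continuous fun τ => u + x τ := continuous_const.add hx
  have hwc := continuousOn_gaugedFlow hIci c hyc.continuousOn
  have hFc := continuousOn_truncForcing hIci σ a h.height_pos hwc
  have hr : ∀ t, (fun s => ((a : ℂ) + gaugedFlow c t (u + x t) s) - longRangeProfile σ a u t s)
      =ᵐ[volume] gaugedFlow c t (x t) := by
    intro t
    rw [gaugedFlow_add]
    filter_upwards [Lp.coeFn_add (gaugedFlow c t u) (gaugedFlow c t (x t)),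
      Lp.coeFn_smul (gaugePhase c t) (freeSchrodinger t u)] with s h1 h2
    rw [h1, Pi.add_apply, longRangeProfile]
    have h3 : gaugedFlow c t u s = gaugePhase c t * freeSchrodinger t u s := h2
    rw [h3, gaugePhase, hc]
    ring
  set S := ∫ s, ‖u s‖
  have hS0 : 0 ≤ S := integral_nonneg fun _ => norm_nonneg _
  have hM := h.height_pos
  -- The sup bound is known for `u + x`; subtracting the free part, which obeys the dispersive
  -- estimate, gives it for `x`.
  have hxsup : ∀ t, t₀ ≤ t → LinftyLe (gaugedFlow c t (x t)) ((M + S) * t ^ (-(1 / 2) : ℝ)) := by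
    intro t ht
    have ht0 : 0 < t := ht₀.trans_le ht
    have h1 := linftyLe_freeSchrodinger ht0.ne' hu
    rw [abs_of_pos ht0] at h1
    have h2 : gaugedFlow c t (x t)
        = gaugedFlow c t (u + x t) + (-1 : ℂ) • gaugedFlow c t u := by
      rw [gaugedFlow_add, neg_one_smul]; abel
    rw [h2]
    refine ((hsup t ht).add ((_root_.linftyLe_gaugedFlow c t h1).smul_of_norm_eq_one
      (by simp))).mono (le_of_eq ?_)
    ring
  have hL4 : ∀ t, t₀ ≤ t → normL4Linfty t (fun t s => ((a : ℂ) + gaugedFlow c t (u + x t) s)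
      - longRangeProfile σ a u t s) ≤ ENNReal.ofReal ((M + S) * t ^ (-(1 / 4) : ℝ)) := by
    intro t ht
    refine normL4Linfty_le (ht₀.trans_le ht) (by positivity) fun τ hτ => ?_
    have hτ' : t₀ ≤ τ := ht.trans (le_of_lt hτ)
    have hτ0 : 0 < τ := ht₀.trans_le hτ'
    rw [eLpNorm_congr_ae (hr τ)]
    exact (hxsup τ hτ').eLpNorm_le (by positivity)
  refine ⟨⟨fun t => gaugedFlow c t (u + x t),
    fun τ => truncForcing σ a M τ (gaugedFlow c τ (u + x τ)), ⟨hwc, fun t _ => ?_⟩, ?_, ?_, ?_⟩,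
    ⟨fun t => gaugedFlow c t (x t), continuousOn_gaugedFlow hIci c hx.continuousOn,
      fun t _ => hr t⟩, (hL4 t₀ le_rfl).trans_lt ENNReal.ofReal_lt_top, D + (M + S), ?_⟩
  · simp
  · refine ae_restrict_of_forall_mem measurableSet_Ici fun τ hτ => ?_
    exact truncForcing_ae_eq σ a hM (hIci hτ) (fun τ => gaugedFlow c τ (u + x τ)) (hsup τ hτ)
  · intro t ht
    refine (hFc.mono ?_).intervalIntegrable
    rw [uIcc_of_le ht]
    exact Icc_subset_Ici_self
  · intro t ht
    exact h.duhamel hu hx hfix hD ht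
  · filter_upwards [eventually_ge_atTop t₀] with t ht
    have ht0 : 0 < t := ht₀.trans_le ht
    have hD0 : 0 ≤ D * t ^ (-(1 / 4) : ℝ) := (norm_nonneg _).trans (hD t ht)
    rw [add_mul D, ENNReal.ofReal_add hD0 (by positivity)]
    refine add_le_add ?_ (hL4 t ht)
    rw [eLpNorm_congr_ae (hr t), ← Lp.enorm_def, ← ofReal_norm, norm_gaugedFlow]
    exact ENNReal.ofReal_le_ofReal (hD t ht)

end

/-! ### A Gronwall lemma backwards from infinity, with the critical kernel `b/τ`. -/

section Gronwall

variable {t₀ b C : ℝ} {f K : ℝ → ℝ}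

theorem integrableOn_kernel_mul (ht₀ : 0 < t₀) (hf : ContinuousOn f (Ici t₀))
    (hK : IntegrableOn K (Ioi t₀)) (b : ℝ) {t T : ℝ} (ht : t₀ ≤ t) :
    IntegrableOn (fun τ => (b * τ⁻¹ + K τ) * f τ) (Ioc t T) := by
  have hs : Icc t T ⊆ Ici t₀ := fun x hx => ht.trans hx.1
  have h1 : ContinuousOn (fun τ : ℝ => b * τ⁻¹) (Icc t T) :=
    continuousOn_const.mul (continuousOn_id.inv₀ fun x hx => (ht₀.trans_le (hs hx)).ne')
  have h2 : IntegrableOn K (Icc t T) :=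
    ((integrableOn_Ici_iff_integrableOn_Ioi (by finiteness)).2 hK).mono_set hs
  exact (((h1.integrableOn_Icc).add h2).mul_continuousOn (hf.mono hs) isCompact_Icc).mono_set
    Ioc_subset_Icc_self

/-- Since `b/τ` is not integrable at infinity, the usual Gronwall argument fails. In the norm `N =
sup t^{1/4} f`, finite by the assumed decay, that kernel costs only `4b ≤ 1/4`; far out the tail of
`K` costs another `1/4`, so `N ≤ N/2`. -/
theorem exists_eq_zero_of_le_add_integral (ht₀ : 0 < t₀) (hf : ContinuousOn f (Ici t₀))
    (hf0 : ∀ t, t₀ ≤ t → 0 ≤ f t) (hK0 : ∀ t, t₀ ≤ t → 0 ≤ K t) (hK : IntegrableOn K (Ioi t₀))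
    (hb : b ≤ 1 / 16)
    (h : ∀ t T, t₀ ≤ t → t ≤ T → f t ≤ f T + ∫ τ in Ioc t T, (b * τ⁻¹ + K τ) * f τ)
    (hC : ∀ᶠ t in atTop, f t ≤ C * t ^ (-(1 / 4) : ℝ)) :
    ∃ T₀, t₀ ≤ T₀ ∧ ∀ t, T₀ ≤ t → f t = 0 := by
  have htail : ∀ᶠ t in atTop, ∫ τ in Ioi t, K τ < 1 / 4 := by
    exact (tendsto_integral_Ioi_zero (f := K) (μ := volume) tendsto_id).eventually (gt_mem_nhds (by norm_num))
  obtain ⟨T₀, hT⟩ := eventually_atTop.1 (hC.and (htail.and (eventually_ge_atTop t₀)))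
  have hT₀ : t₀ ≤ T₀ := (hT T₀ le_rfl).2.2
  refine ⟨T₀, hT₀, ?_⟩
  set S : Set ℝ := (fun t => f t * t ^ (1 / 4 : ℝ)) '' Ici T₀ with hS
  have hpow : ∀ t : ℝ, 0 < t → t ^ (-(1 / 4) : ℝ) * t ^ (1 / 4 : ℝ) = 1 := fun t ht => by
    rw [← Real.rpow_add ht]; norm_num
  have hbdd : BddAbove S := by
    refine ⟨C, ?_⟩
    rintro _ ⟨t, ht, rfl⟩
    have ht0 : 0 < t := ht₀.trans_le (hT₀.trans ht)
    calc f t * t ^ (1 / 4 : ℝ) ≤ C * t ^ (-(1 / 4) : ℝ) * t ^ (1 / 4 : ℝ) :=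
          mul_le_mul_of_nonneg_right (hT t ht).1 (by positivity)
      _ = C := by rw [mul_assoc, hpow t ht0, mul_one]
  set N := sSup S with hN
  have hfN : ∀ t, T₀ ≤ t → f t ≤ N * t ^ (-(1 / 4) : ℝ) := fun t ht => by
    have ht0 : 0 < t := ht₀.trans_le (hT₀.trans ht)
    calc f t = f t * t ^ (1 / 4 : ℝ) * t ^ (-(1 / 4) : ℝ) := by
          rw [mul_assoc, mul_comm (t ^ (1 / 4 : ℝ)), hpow t ht0, mul_one]
      _ ≤ _ := mul_le_mul_of_nonneg_right (le_csSup hbdd ⟨t, ht, rfl⟩) (by positivity)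
  have hN0 : 0 ≤ N := by
    refine le_csSup_of_le hbdd ⟨T₀, self_mem_Ici, rfl⟩ ?_
    exact mul_nonneg (hf0 T₀ hT₀) (Real.rpow_nonneg (ht₀.le.trans hT₀) _)
  have hlim : Tendsto f atTop (nhds 0) := by
    refine squeeze_zero' ((eventually_ge_atTop t₀).mono hf0) hC ?_
    simpa using (tendsto_rpow_neg_atTop (by norm_num : (0 : ℝ) < 1 / 4)).const_mul C
  have hhalf : ∀ t, T₀ ≤ t → f t ≤ N / 2 * t ^ (-(1 / 4) : ℝ) := by
    intro t ht
    have ht1 : t₀ ≤ t := hT₀.trans ht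
    have ht0 : 0 < t := ht₀.trans_le ht1
    have hi1 : IntegrableOn (fun τ : ℝ => (N / 16) * τ ^ (-(5 / 4) : ℝ)) (Ioi t) :=
      (integrableOn_Ioi_rpow_of_lt (by norm_num) ht0).const_mul _
    have hi2 : IntegrableOn (fun τ : ℝ => (N * t ^ (-(1 / 4) : ℝ)) * K τ) (Ioi t) :=
      (hK.mono_set (Ioi_subset_Ioi ht1)).const_mul _
    -- The bound is uniform in `T`, so `f T → 0` lets the boundary term disappear.
    have hstep : ∀ T, t ≤ T → f t ≤ f T + N / 2 * t ^ (-(1 / 4) : ℝ) := by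
      intro T htT
      refine (h t T ht1 htT).trans (add_le_add_right ?_ _)
      calc ∫ τ in Ioc t T, (b * τ⁻¹ + K τ) * f τ
          ≤ ∫ τ in Ioc t T, ((N / 16) * τ ^ (-(5 / 4) : ℝ) + (N * t ^ (-(1 / 4) : ℝ)) * K τ) := by
            refine setIntegral_mono_on (integrableOn_kernel_mul ht₀ hf hK b ht1)
              ((hi1.add hi2).mono_set Ioc_subset_Ioi_self) measurableSet_Ioc fun τ hτ => ?_
            have hτ0 : 0 < τ := ht0.trans hτ.1
            have hfτ := hfN τ (ht.trans hτ.1.le)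
            have hf0τ := hf0 τ (ht1.trans hτ.1.le)
            have h1 : τ ^ (-(1 / 4) : ℝ) ≤ t ^ (-(1 / 4) : ℝ) :=
              Real.rpow_le_rpow_of_nonpos ht0 hτ.1.le (by norm_num)
            rw [add_mul]
            refine add_le_add ?_ ?_
            · calc b * τ⁻¹ * f τ ≤ 1 / 16 * τ⁻¹ * (N * τ ^ (-(1 / 4) : ℝ)) := by gcongr
                _ = N / 16 * (τ⁻¹ * τ ^ (-(1 / 4) : ℝ)) := by ring
                _ = _ := by rw [inv_mul_rpow_neg_quarter hτ0]
            · rw [mul_comm]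
              exact mul_le_mul_of_nonneg_right (hfτ.trans (mul_le_mul_of_nonneg_left h1 hN0))
                (hK0 τ (ht1.trans hτ.1.le))
        _ ≤ ∫ τ in Ioi t, ((N / 16) * τ ^ (-(5 / 4) : ℝ) + (N * t ^ (-(1 / 4) : ℝ)) * K τ) := by
            refine setIntegral_mono_set (hi1.add hi2) ?_ Ioc_subset_Ioi_self.eventuallyLE
            refine ae_restrict_of_forall_mem measurableSet_Ioi fun τ hτ => ?_
            have hτ0 : 0 < τ := ht0.trans hτ
            have := hK0 τ (ht1.trans (le_of_lt hτ))
            simp only [Pi.zero_apply]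
            positivity
        _ = N / 4 * t ^ (-(1 / 4) : ℝ) + N * t ^ (-(1 / 4) : ℝ) * ∫ τ in Ioi t, K τ := by
            rw [integral_add hi1 hi2, integral_const_mul, integral_const_mul,
              integral_Ioi_rpow_five_fourths ht0]
            ring
        _ ≤ N / 4 * t ^ (-(1 / 4) : ℝ) + N * t ^ (-(1 / 4) : ℝ) * (1 / 4) := by
            have := (hT t ht).2.1.le
            gcongr
        _ = _ := by ring
    have h2 : Tendsto (fun T => f T + N / 2 * t ^ (-(1 / 4) : ℝ)) atTop
        (nhds (0 + N / 2 * t ^ (-(1 / 4) : ℝ))) := hlim.add_const _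
    rw [zero_add] at h2
    exact ge_of_tendsto h2 ((eventually_ge_atTop t).mono hstep)
  have hNle : N ≤ N / 2 := by
    refine csSup_le ⟨_, T₀, self_mem_Ici, rfl⟩ ?_
    rintro _ ⟨t, ht, rfl⟩
    have ht0 : 0 < t := ht₀.trans_le (hT₀.trans ht)
    calc f t * t ^ (1 / 4 : ℝ) ≤ N / 2 * t ^ (-(1 / 4) : ℝ) * t ^ (1 / 4 : ℝ) :=
          mul_le_mul_of_nonneg_right (hhalf t ht) (by positivity)
      _ = N / 2 := by rw [mul_assoc, hpow t ht0, mul_one]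
  have hN' : N = 0 := by linarith
  intro t ht
  have := hfN t ht
  rw [hN', zero_mul] at this
  exact le_antisymm this (hf0 t (hT₀.trans ht))

/-- Once `f` vanishes far out, a continuation argument brings the zero back to `t₀`: if the infimum
`r` of admissible starting times exceeded `t₀`, the kernel would have mass below `1/2` on some `[t₁,
r]`, and the maximum of `f` there would be at most half of itself. -/
theorem eq_zero_of_le_add_integral (ht₀ : 0 < t₀) (hf : ContinuousOn f (Ici t₀))
    (hf0 : ∀ t, t₀ ≤ t → 0 ≤ f t) (hK0 : ∀ t, t₀ ≤ t → 0 ≤ K t) (hK : IntegrableOn K (Ioi t₀))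
    (hb0 : 0 ≤ b) (hb : b ≤ 1 / 16)
    (h : ∀ t T, t₀ ≤ t → t ≤ T → f t ≤ f T + ∫ τ in Ioc t T, (b * τ⁻¹ + K τ) * f τ)
    (hC : ∀ᶠ t in atTop, f t ≤ C * t ^ (-(1 / 4) : ℝ)) :
    ∀ t, t₀ ≤ t → f t = 0 := by
  obtain ⟨T₀, hT₀, hz⟩ := exists_eq_zero_of_le_add_integral ht₀ hf hf0 hK0 hK hb h hC
  set S : Set ℝ := {t | t₀ ≤ t ∧ ∀ s, t ≤ s → f s = 0} with hS
  have hSne : S.Nonempty := ⟨T₀, hT₀, hz⟩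
  have hSbdd : BddBelow S := ⟨t₀, fun t ht => ht.1⟩
  set r := sInf S with hr
  have hr0 : t₀ ≤ r := le_csInf hSne fun t ht => ht.1
  have hgt : ∀ s, r < s → f s = 0 := fun s hs => by
    obtain ⟨t, ht, hts⟩ := exists_lt_of_csInf_lt hSne hs
    exact ht.2 s hts.le
  have hrz : f r = 0 := by
    have h1 : Tendsto f (nhdsWithin r (Ioi r)) (nhds (f r)) :=
      (hf r hr0).mono (fun x hx => hr0.trans (le_of_lt hx))
    exact tendsto_nhds_unique h1 (tendsto_const_nhds.congr'
      (eventually_mem_nhdsWithin.mono fun s hs => (hgt s hs).symm))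
  rcases hr0.eq_or_lt with heq | hlt
  · intro t ht
    rw [heq] at ht
    rcases ht.eq_or_lt with rfl | h'
    · exact hrz
    · exact hgt t h'
  exfalso
  have hκ : IntegrableOn (fun τ => b * τ⁻¹ + K τ) (Icc t₀ r) := by
    have := integrableOn_kernel_mul (f := fun _ => 1) ht₀ continuousOn_const hK b le_rfl (T := r)
    simp only [mul_one] at this
    exact (integrableOn_Icc_iff_integrableOn_Ioc (by finiteness)).2 this
  have hκ0 : ∀ τ, t₀ ≤ τ → 0 ≤ b * τ⁻¹ + K τ := fun τ hτ => by
    have := hK0 τ hτ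
    have : 0 < τ := ht₀.trans_le hτ
    positivity
  have hcont : ContinuousOn (fun t => ∫ τ in t..r, (b * τ⁻¹ + K τ)) (Icc t₀ r) := by
    have := intervalIntegral.continuousOn_primitive_interval_left (a := t₀) (b := r)
      (f := fun τ => b * τ⁻¹ + K τ) (μ := volume) (by rwa [uIcc_of_le hr0])
    rwa [uIcc_of_le hr0] at this
  have hsmall : ∃ t₁, t₀ ≤ t₁ ∧ t₁ < r ∧ ∫ τ in t₁..r, (b * τ⁻¹ + K τ) < 1 / 2 := by
    have h1 := hcont r (right_mem_Icc.2 hr0)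
    have h2 : ∀ᶠ t in nhdsWithin r (Icc t₀ r), ∫ τ in t..r, (b * τ⁻¹ + K τ) < 1 / 2 :=
      h1.eventually (gt_mem_nhds (by simp))
    have h3 : nhdsWithin r (Ico t₀ r) ≤ nhdsWithin r (Icc t₀ r) :=
      nhdsWithin_mono _ Ico_subset_Icc_self
    have : (nhdsWithin r (Ico t₀ r)).NeBot := by
      rw [nhdsWithin_Ico_eq_nhdsLT hlt]; infer_instance
    obtain ⟨t₁, h4, h5⟩ := ((h2.filter_mono h3).and eventually_mem_nhdsWithin).exists
    exact ⟨t₁, h5.1, h5.2, h4⟩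
  obtain ⟨t₁, ht1, ht1r, hint⟩ := hsmall
  obtain ⟨p, hp, hmax⟩ := isCompact_Icc.exists_isMaxOn (nonempty_Icc.2 ht1r.le)
    (hf.mono fun x hx => ht1.trans hx.1 : ContinuousOn f (Icc t₁ r))
  have hp0 : t₀ ≤ p := ht1.trans hp.1
  have hfp : f p ≤ 1 / 2 * f p := by
    calc f p ≤ f r + ∫ τ in Ioc p r, (b * τ⁻¹ + K τ) * f τ := h p r hp0 hp.2
      _ ≤ ∫ τ in Ioc p r, (b * τ⁻¹ + K τ) * f p := by
          rw [hrz, zero_add]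
          refine setIntegral_mono_on (integrableOn_kernel_mul ht₀ hf hK b hp0)
            ((hκ.mono_set ?_).mul_const _) measurableSet_Ioc fun τ hτ => ?_
          · exact fun x hx => ⟨hp0.trans hx.1.le, hx.2⟩
          · exact mul_le_mul_of_nonneg_left (hmax ⟨hp.1.trans hτ.1.le, hτ.2⟩)
              (hκ0 τ (hp0.trans hτ.1.le))
      _ = (∫ τ in Ioc p r, (b * τ⁻¹ + K τ)) * f p := integral_mul_const _ _
      _ ≤ (∫ τ in Ioc t₁ r, (b * τ⁻¹ + K τ)) * f p := by
          refine mul_le_mul_of_nonneg_right (setIntegral_mono_set (hκ.mono_set fun x hx =>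
            ⟨ht1.trans hx.1.le, hx.2⟩) ?_ (Ioc_subset_Ioc_left hp.1).eventuallyLE) (hf0 p hp0)
          exact ae_restrict_of_forall_mem measurableSet_Ioc fun τ hτ =>
            hκ0 τ (ht1.trans hτ.1.le)
      _ ≤ 1 / 2 * f p := by
          rw [intervalIntegral.integral_of_le ht1r.le] at hint
          exact mul_le_mul_of_nonneg_right hint.le (hf0 p hp0)
  have hfp0 : f p = 0 := by linarith [hf0 p hp0]
  have hmem : t₁ ∈ S := by
    refine ⟨ht1, fun s hs => ?_⟩
    rcases lt_or_ge r s with h1 | h1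
    · exact hgt s h1
    · exact le_antisymm ((hmax ⟨hs, h1⟩).trans hfp0.le) (hf0 s (ht1.trans hs))
  exact absurd (csInf_le hSbdd hmem) (not_le.2 ht1r)

end Gronwall

/-! ### Uniqueness. -/

theorem integrable_freeSchrodinger_comp {μ : Measure ℝ} {G : ℝ → L2R} {θ : ℝ → ℝ}
    (hθ : Continuous θ) (hG : Integrable G μ) :
    Integrable (fun τ => freeSchrodinger (θ τ) (G τ)) μ := by
  have h1 : AEStronglyMeasurable (fun τ => (θ τ, G τ)) μ :=
    hθ.aestronglyMeasurable.prodMk hG.1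
  have h2 : AEStronglyMeasurable (fun τ => freeSchrodinger (θ τ) (G τ)) μ :=
    Continuous.comp_aestronglyMeasurable (g := fun p : ℝ × L2R => freeSchrodinger p.1 p.2)
      (f := fun τ => (θ τ, G τ)) continuous_freeSchrodinger h1
  refine hG.mono h2 (Eventually.of_forall fun τ => ?_)
  rw [norm_freeSchrodinger]

/-- Unitarity lets the Duhamel formula be run backwards from `T` to `t`, the direction imposed by
decay at infinity. -/
theorem norm_le_add_integral_of_duhamel {t₀ : ℝ} {w G : ℝ → L2R}
    (hG : ∀ t ∈ Ici t₀, IntervalIntegrable G volume t₀ t)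
    (h : ∀ t ∈ Ici t₀, w t = freeSchrodinger (t - t₀) (w t₀)
      + Complex.I • ∫ τ in t₀..t, freeSchrodinger (t - τ) (G τ))
    {t T : ℝ} (ht : t₀ ≤ t) (htT : t ≤ T) :
    ‖w t‖ ≤ ‖w T‖ + ∫ τ in Ioc t T, ‖G τ‖ := by
  have hi : ∀ t ∈ Ici t₀, IntervalIntegrable (fun τ => freeSchrodinger (-τ) (G τ)) volume t₀ t := by
    intro t ht
    have h1 := integrable_freeSchrodinger_comp continuous_neg (hG t ht).1
    exact (intervalIntegrable_iff_integrableOn_Ioc_of_le ht).2 h1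
  have he : ∀ t ∈ Ici t₀, freeSchrodinger (-t) (w t) = freeSchrodinger (-t₀) (w t₀)
      + Complex.I • ∫ τ in t₀..t, freeSchrodinger (-τ) (G τ) := by
    intro t ht
    have h2 : freeSchrodinger t (∫ τ in t₀..t, freeSchrodinger (-τ) (G τ))
        = ∫ τ in t₀..t, freeSchrodinger (t - τ) (G τ) := by
      rw [intervalIntegral.integral_of_le ht, intervalIntegral.integral_of_le ht,
        freeSchrodinger_integral (hi t ht).1]
      refine integral_congr_ae (Eventually.of_forall fun τ => ?_)
      simp only
      rw [freeSchrodinger_freeSchrodinger, sub_eq_add_neg]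
    rw [h t ht, ← h2, freeSchrodinger_add_right, freeSchrodinger_smul,
      freeSchrodinger_freeSchrodinger, freeSchrodinger_freeSchrodinger, neg_add_cancel,
      freeSchrodinger_zero_left]
    congr 2
    ring
  have hT : t₀ ≤ T := ht.trans htT
  have hsub : freeSchrodinger (-t) (w t) = freeSchrodinger (-T) (w T)
      - Complex.I • ∫ τ in t..T, freeSchrodinger (-τ) (G τ) := by
    rw [he t ht, he T hT, ← intervalIntegral.integral_interval_sub_left (hi T hT) (hi t ht),
      smul_sub]
    abel
  rw [← norm_freeSchrodinger (-t) (w t), ← norm_freeSchrodinger (-T) (w T), hsub,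
    intervalIntegral.integral_of_le htT]
  refine (norm_sub_le _ _).trans (add_le_add_right ?_ _)
  rw [norm_smul, Complex.norm_I, one_mul]
  refine (norm_integral_le_integral_norm _).trans (le_of_eq ?_)
  simp only [norm_freeSchrodinger]

theorem eLpNorm_top_measurable_of_continuousOn {t₀ : ℝ} {R : ℝ → L2R}
    (hR : ContinuousOn R (Ici t₀)) :
    AEMeasurable (fun τ => eLpNorm (R τ) ∞ volume) (volume.restrict (Ioi t₀)) := by
  have hc : Continuous fun τ => R (max t₀ τ) :=
    hR.comp_continuous (continuous_const.max continuous_id) fun τ => mem_Ici.2 (le_max_left _ _)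
  refine ⟨fun τ => eLpNorm (R (max t₀ τ)) ∞ volume,
    (lowerSemicontinuous_eLpNorm_top.comp hc).measurable, ?_⟩
  refine ae_restrict_of_forall_mem measurableSet_Ioi fun τ hτ => ?_
  simp only
  rw [max_eq_right (le_of_lt hτ)]

/-- Here `ρ τ` is the sup norm of `v - v₁`, in `L⁴` of time by assumption, and the term `τ^{-1/2}`
is the dispersive bound for `v₁ - a`. -/
theorem IsLongRangeSolution.exists_curve {σ a t₀ : ℝ} (ht₀ : 0 < t₀) {u : L2R}
    (hu : Integrable u) {v : ℝ → ℝ → ℂ} (hv : IsLongRangeSolution σ a t₀ u v) :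
    ∃ (w G : ℝ → L2R) (ρ : ℝ → ℝ) (C : ℝ),
      (ContinuousOn w (Ici t₀) ∧ ∀ t ∈ Ici t₀, ∀ᵐ s, v t s = a + w t s) ∧
      (∀ᵐ τ ∂(volume.restrict (Ioi t₀)), G τ =ᵐ[volume] gpNonlinearity σ a v τ) ∧
      (∀ t ∈ Ici t₀, IntervalIntegrable G volume t₀ t) ∧
      (∀ t ∈ Ici t₀, w t = freeSchrodinger (t - t₀) (w t₀)
        + Complex.I • ∫ τ in t₀..t, freeSchrodinger (t - τ) (G τ)) ∧
      (∀ τ, 0 ≤ ρ τ) ∧ AEStronglyMeasurable ρ (volume.restrict (Ioi t₀)) ∧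
      IntegrableOn (fun τ => ρ τ ^ 4) (Ioi t₀) ∧
      (∀ᵐ τ ∂(volume.restrict (Ioi t₀)),
        LinftyLe (w τ) (ρ τ + (∫ s, ‖u s‖) * τ ^ (-(1 / 2) : ℝ))) ∧
      ∀ᶠ t in atTop, ‖w t - gaugedFlow (σ * a ^ 2) t u‖ ≤ C * t ^ (-(1 / 4) : ℝ) := by
  obtain ⟨⟨w, G, ⟨hwc, hwv⟩, hG, hGi, hduh⟩, -, hL4, C, hC⟩ := hv
  set c := σ * a ^ 2 with hc
  have hIci : Ici t₀ ⊆ Ioi 0 := fun y hy => ht₀.trans_le hy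
  set R : ℝ → L2R := fun t => w t - gaugedFlow c t u with hRdef
  have hRc : ContinuousOn R (Ici t₀) :=
    hwc.sub (continuousOn_gaugedFlow hIci c continuousOn_const)
  have hwv' : ∀ t ∈ Ici t₀, ∀ᵐ s, v t s = a + w t s := fun t ht => by
    filter_upwards [hwv t ht] with s hs
    rw [← hs]; ring
  have hRv : ∀ t ∈ Ici t₀, (fun s => v t s - longRangeProfile σ a u t s) =ᵐ[volume] R t := by
    intro t ht
    filter_upwards [hwv' t ht, Lp.coeFn_sub (w t) (gaugedFlow c t u),
      Lp.coeFn_smul (gaugePhase c t) (freeSchrodinger t u)] with s h1 h2 h3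
    have h3' : gaugedFlow c t u s = gaugePhase c t * freeSchrodinger t u s := h3
    rw [h1, h2, Pi.sub_apply, h3', longRangeProfile, gaugePhase, hc]
    ring
  have hmeas := eLpNorm_top_measurable_of_continuousOn hRc
  have hfin : ∫⁻ τ in Ioi t₀, eLpNorm (R τ) ∞ volume ^ (4 : ℝ) ≠ ∞ := by
    intro htop
    refine hL4.ne ?_
    rw [normL4Linfty, setLIntegral_congr_fun measurableSet_Ioi
      (fun τ hτ => by rw [eLpNorm_congr_ae (hRv τ (Ioi_subset_Ici_self hτ))]), htop]
    exact ENNReal.top_rpow_of_pos (by norm_num)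
  refine ⟨w, G, fun τ => (eLpNorm (R τ) ∞ volume).toReal, |C|, ⟨hwc, hwv'⟩,
    ae_restrict_of_ae_restrict_of_subset Ioi_subset_Ici_self hG, hGi, hduh,
    fun _ => ENNReal.toReal_nonneg, hmeas.ennreal_toReal.aestronglyMeasurable, ?_, ?_, ?_⟩
  · refine (integrable_toReal_of_lintegral_ne_top (hmeas.pow_const 4) hfin).congr
      (Eventually.of_forall fun τ => ?_)
    simp only
    rw [← ENNReal.toReal_rpow]
    exact Real.rpow_natCast _ 4
  · filter_upwards [ae_lt_top' (hmeas.pow_const 4) hfin, ae_restrict_mem measurableSet_Ioi]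
      with τ h1 hτ
    have hτ0 : 0 < τ := ht₀.trans hτ
    have h2 : eLpNorm (R τ) ∞ volume ≠ ∞ := fun h => by
      rw [h, ENNReal.top_rpow_of_pos (by norm_num)] at h1
      exact lt_irrefl _ h1
    have h3 : LinftyLe (R τ) (eLpNorm (R τ) ∞ volume).toReal :=
      LinftyLe.of_eLpNorm_le ENNReal.toReal_nonneg (ENNReal.ofReal_toReal h2).ge
    have h4 := linftyLe_freeSchrodinger hτ0.ne' hu
    rw [abs_of_pos hτ0] at h4
    have h5 := h3.add (_root_.linftyLe_gaugedFlow c τ h4)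
    rw [hRdef] at h5 ⊢
    simp only [sub_add_cancel] at h5
    rwa [mul_comm] at h5
  · filter_upwards [hC, eventually_ge_atTop t₀] with t h1 ht
    have ht0 : 0 < t := ht₀.trans_le ht
    have h2 := le_self_add.trans h1
    rw [eLpNorm_congr_ae (hRv t ht), ← Lp.enorm_def, ← ofReal_norm] at h2
    refine (ENNReal.ofReal_le_ofReal_iff (by positivity)).1 (h2.trans (ENNReal.ofReal_le_ofReal ?_))
    exact mul_le_mul_of_nonneg_right (le_abs_self C) (by positivity)

theorem norm_truncForcing_sub_le {σ : ℝ} (hσ : |σ| = 1) (a : ℝ) {M τ : ℝ} (hM : 0 < M)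
    (hτ : 0 < τ) (w w' : L2R) :
    ‖truncForcing σ a M τ w - truncForcing σ a M τ w'‖
      ≤ (2 * a ^ 2 * τ⁻¹ + τ⁻¹ * truncLip a M τ) * ‖w - w'‖ := by
  have h1 : truncForcing σ a M τ w - truncForcing σ a M τ w' = ((σ / τ : ℝ) : ℂ) •
      (((a ^ 2 : ℝ) : ℂ) • (w - w') + ((a ^ 2 : ℝ) : ℂ) • conjL2 (w - w')
        + (truncNonlinearity a (M * τ ^ (-(1 / 2) : ℝ)) w
          - truncNonlinearity a (M * τ ^ (-(1 / 2) : ℝ)) w')) := by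
    rw [truncForcing, truncForcing, ← smul_sub]
    congr 1
    rw [map_sub, smul_sub, smul_sub]
    abel
  have h2 : ‖((σ / τ : ℝ) : ℂ)‖ = τ⁻¹ := by
    rw [Complex.norm_real, Real.norm_eq_abs, abs_div, hσ, abs_of_pos hτ, one_div]
  have h3 : ‖((a ^ 2 : ℝ) : ℂ)‖ = a ^ 2 := by
    rw [Complex.norm_real, Real.norm_of_nonneg (sq_nonneg a)]
  have h4 := norm_truncNonlinearity_sub_le a (m := M * τ ^ (-(1 / 2) : ℝ)) (by positivity) w w'
  rw [h1, norm_smul, h2]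
  calc _ ≤ τ⁻¹ * (a ^ 2 * ‖w - w'‖ + a ^ 2 * ‖w - w'‖
        + 12 * (|a| * (M * τ ^ (-(1 / 2) : ℝ)) + (M * τ ^ (-(1 / 2) : ℝ)) ^ 2) * ‖w - w'‖) := by
        refine mul_le_mul_of_nonneg_left ?_ (by positivity)
        refine (norm_add₃_le).trans (add_le_add_three ?_ ?_ h4)
        · rw [norm_smul, h3]
        · rw [norm_smul, h3, norm_conjL2]
    _ = _ := by rw [truncLip]; ring

/-- Young's inequality, up to constants: an `L⁴` function of time paired with `1/τ`, which lies in
`L^{4/3}` and in `L²` at infinity. -/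
theorem inv_mul_add_sq_le {m τ : ℝ} (hm : 0 ≤ m) (hτ : 0 < τ) :
    τ⁻¹ * (m + m ^ 2) ≤ 2 * m ^ 4 + τ ^ (-(4 / 3) : ℝ) + τ ^ (-2 : ℝ) := by
  have h1 : τ⁻¹ * m ≤ m ^ 4 + τ ^ (-(4 / 3) : ℝ) := by
    rcases le_total m (τ ^ (-(1 / 3) : ℝ)) with h | h
    · have : τ⁻¹ * τ ^ (-(1 / 3) : ℝ) = τ ^ (-(4 / 3) : ℝ) := by
        rw [← Real.rpow_neg_one, ← Real.rpow_add hτ]; norm_num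
      have h2 : τ⁻¹ * m ≤ τ ^ (-(4 / 3) : ℝ) := this ▸ by gcongr
      have : 0 ≤ m ^ 4 := by positivity
      linarith
    · have h2 : τ⁻¹ ≤ m ^ 3 := by
        have h3 : (τ ^ (-(1 / 3) : ℝ)) ^ 3 = τ⁻¹ := by
          rw [← Real.rpow_natCast, ← Real.rpow_mul hτ.le, ← Real.rpow_neg_one]; norm_num
        rw [← h3]
        gcongr
      have h4 : τ⁻¹ * m ≤ m ^ 3 * m := mul_le_mul_of_nonneg_right h2 hm
      have : 0 ≤ τ ^ (-(4 / 3) : ℝ) := by positivity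
      nlinarith
  have h2 : τ⁻¹ * m ^ 2 ≤ m ^ 4 + τ ^ (-2 : ℝ) := by
    have h3 : τ ^ (-2 : ℝ) = τ⁻¹ ^ 2 := by
      rw [Real.rpow_neg hτ.le, inv_pow]; norm_num
    rw [h3]
    nlinarith [sq_nonneg (m ^ 2 - τ⁻¹), mul_nonneg (inv_pos.2 hτ).le (sq_nonneg m)]
  rw [mul_add]
  linarith

theorem integrableOn_inv_mul_add_sq {t₀ : ℝ} (ht₀ : 0 < t₀) {m : ℝ → ℝ} (hm0 : ∀ τ, t₀ < τ → 0 ≤ m τ)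
    (hm : AEStronglyMeasurable m (volume.restrict (Ioi t₀)))
    (hi : IntegrableOn (fun τ => m τ ^ 4) (Ioi t₀)) :
    IntegrableOn (fun τ => τ⁻¹ * (m τ + m τ ^ 2)) (Ioi t₀) := by
  have h1 : IntegrableOn (fun τ => 2 * m τ ^ 4 + τ ^ (-(4 / 3) : ℝ) + τ ^ (-2 : ℝ)) (Ioi t₀) :=
    ((hi.const_mul 2).add (integrableOn_Ioi_rpow_of_lt (by norm_num) ht₀)).add
      (integrableOn_Ioi_rpow_of_lt (by norm_num) ht₀)
  refine Integrable.mono' h1 ?_ (ae_restrict_of_forall_mem measurableSet_Ioi fun τ hτ => ?_)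
  · exact (measurable_inv.aestronglyMeasurable).mul (hm.add (hm.pow 2))
  · have := hm0 τ hτ
    have hτ0 : 0 < τ := ht₀.trans hτ
    rw [Real.norm_of_nonneg (by positivity)]
    exact inv_mul_add_sq_le this hτ0

theorem integrableOn_add_add_pow_four {t₀ S : ℝ} (ht₀ : 0 < t₀) (hS : 0 ≤ S) {ρ ρ' : ℝ → ℝ}
    (h0 : ∀ τ, 0 ≤ ρ τ) (h0' : ∀ τ, 0 ≤ ρ' τ)
    (hm : AEStronglyMeasurable ρ (volume.restrict (Ioi t₀)))
    (hm' : AEStronglyMeasurable ρ' (volume.restrict (Ioi t₀)))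
    (hi : IntegrableOn (fun τ => ρ τ ^ 4) (Ioi t₀))
    (hi' : IntegrableOn (fun τ => ρ' τ ^ 4) (Ioi t₀)) :
    IntegrableOn (fun τ => (ρ τ + ρ' τ + S * τ ^ (-(1 / 2) : ℝ)) ^ 4) (Ioi t₀) := by
  have h1 : IntegrableOn (fun τ : ℝ => 8 * (8 * (ρ τ ^ 4 + ρ' τ ^ 4) + S ^ 4 * τ ^ (-2 : ℝ)))
      (Ioi t₀) :=
    (((hi.add hi').const_mul 8).add
      ((integrableOn_Ioi_rpow_of_lt (by norm_num) ht₀).const_mul _)).const_mul 8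
  refine Integrable.mono' h1 ?_ (ae_restrict_of_forall_mem measurableSet_Ioi fun τ hτ => ?_)
  · refine ((hm.add hm').add (Measurable.aestronglyMeasurable ?_)).pow 4
    fun_prop
  · have hτ0 : 0 < τ := ht₀.trans hτ
    have a1 := h0 τ
    have a2 := h0' τ
    have h2 := add_pow_le (add_nonneg a1 a2)
      (by positivity : 0 ≤ S * τ ^ (-(1 / 2) : ℝ)) 4
    have h3 := add_pow_le a1 a2 4
    have h4 : (τ ^ (-(1 / 2) : ℝ)) ^ 4 = τ ^ (-2 : ℝ) := by
      rw [← Real.rpow_natCast, ← Real.rpow_mul hτ0.le]; norm_num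
    rw [mul_pow, h4] at h2
    rw [Real.norm_of_nonneg (by positivity)]
    norm_num at h2 h3 ⊢
    linarith

/-- The condition on `a` is `2a² ≤ 1/16`, the threshold of the Gronwall lemma; the factor `2` counts
the terms in `w` and in its conjugate. -/
theorem IsLongRangeSolution.ae_eq {σ a t₀ : ℝ} (hσ : |σ| = 1) (ha : a ^ 2 ≤ 1 / 32)
    (ht₀ : 0 < t₀) {u : L2R} (hu : Integrable u) {v v' : ℝ → ℝ → ℂ}
    (hv : IsLongRangeSolution σ a t₀ u v) (hv' : IsLongRangeSolution σ a t₀ u v') :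
    ∀ t ∈ Ici t₀, v' t =ᵐ[volume] v t := by
  obtain ⟨w, G, ρ, C, ⟨hwc, hwv⟩, hG, hGi, hduh, hρ0, hρm, hρi, hwρ, hC⟩ := hv.exists_curve ht₀ hu
  obtain ⟨w', G', ρ', C', ⟨hwc', hwv'⟩, hG', hGi', hduh', hρ0', hρm', hρi', hwρ', hC'⟩ :=
    hv'.exists_curve ht₀ hu
  set S := ∫ s, ‖u s‖
  have hS : 0 ≤ S := integral_nonneg fun _ => norm_nonneg _
  -- A common sup bound for both solutions; the extra `1` keeps it strictly positive, as a
  -- truncation height must be.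
  set m : ℝ → ℝ := fun τ => ρ τ + ρ' τ + (S + 1) * τ ^ (-(1 / 2) : ℝ) with hm
  have hmpos : ∀ τ, t₀ < τ → 0 < m τ := fun τ hτ => by
    have hτ0 : 0 < τ := ht₀.trans hτ
    have := hρ0 τ
    have := hρ0' τ
    simp only [hm]
    positivity
  have hmm : AEStronglyMeasurable m (volume.restrict (Ioi t₀)) :=
    (hρm.add hρm').add (Measurable.aestronglyMeasurable (by fun_prop))
  set K : ℝ → ℝ := fun τ => 12 * (τ⁻¹ * (|m τ| + m τ ^ 2)) with hKdef
  have hK : IntegrableOn K (Ioi t₀) := by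
    have h1 := integrableOn_inv_mul_add_sq ht₀ (fun τ hτ => (hmpos τ hτ).le) hmm
      (integrableOn_add_add_pow_four ht₀ (by positivity) hρ0 hρ0' hρm hρm' hρi hρi')
    refine IntegrableOn.congr_fun (h1.const_mul 12) (fun τ hτ => ?_) measurableSet_Ioi
    simp only [hKdef]
    rw [abs_of_pos (hmpos τ hτ)]
  have hK0 : ∀ τ, t₀ ≤ τ → 0 ≤ K τ := fun τ hτ => by
    have : 0 < τ := ht₀.trans_le hτ
    positivity
  have hdif : ∀ᵐ τ ∂(volume.restrict (Ioi t₀)),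
      ‖G τ - G' τ‖ ≤ (2 * a ^ 2 * τ⁻¹ + K τ) * ‖w τ - w' τ‖ := by
    filter_upwards [hG, hG', hwρ, hwρ', ae_restrict_mem measurableSet_Ioi] with τ h1 h2 h3 h4 hτ
    have hτ0 : 0 < τ := ht₀.trans hτ
    have hτ' : τ ∈ Ici t₀ := Ioi_subset_Ici_self hτ
    -- `M` is chosen separately at each time so that the truncation height equals `m τ`. Both
    -- forcings then coincide with their truncations, whose Lipschitz bound applies.
    set M := m τ * τ ^ (1 / 2 : ℝ) with hM
    have hM0 : 0 < M := mul_pos (hmpos τ hτ) (by positivity)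
    have hMm : M * τ ^ (-(1 / 2) : ℝ) = m τ := by
      rw [hM, mul_assoc, ← Real.rpow_add hτ0]; norm_num
    have hp : 0 ≤ τ ^ (-(1 / 2) : ℝ) := by positivity
    have a1 := hρ0 τ
    have a2 := hρ0' τ
    have h3' : LinftyLe (w τ) (M * τ ^ (-(1 / 2) : ℝ)) := by
      rw [hMm]; exact h3.mono (by simp only [hm]; linarith)
    have h4' : LinftyLe (w' τ) (M * τ ^ (-(1 / 2) : ℝ)) := by
      rw [hMm]; exact h4.mono (by simp only [hm]; linarith)
    have e1 : G τ = truncForcing σ a M τ (w τ) := by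
      refine Lp.ext ?_
      filter_upwards [h1, truncForcing_ae_eq σ a hM0 hτ0 w h3', hwv τ hτ'] with s b1 b2 b3
      rw [b1, b2, gpNonlinearity, gpNonlinearity, b3]
    have e2 : G' τ = truncForcing σ a M τ (w' τ) := by
      refine Lp.ext ?_
      filter_upwards [h2, truncForcing_ae_eq σ a hM0 hτ0 w' h4', hwv' τ hτ'] with s b1 b2 b3
      rw [b1, b2, gpNonlinearity, gpNonlinearity, b3]
    rw [e1, e2]
    refine (norm_truncForcing_sub_le hσ a hM0 hτ0 _ _).trans ?_
    refine mul_le_mul_of_nonneg_right (add_le_add_right ?_ _) (norm_nonneg _)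
    have ha1 : |a| ≤ 1 := abs_le_one_iff_mul_self_le_one.2 (by nlinarith)
    have hmp := hmpos τ hτ
    simp only [truncLip, hMm, hKdef]
    rw [abs_of_pos hmp]
    have h5 : |a| * m τ ≤ m τ := mul_le_of_le_one_left hmp.le ha1
    calc τ⁻¹ * (12 * (|a| * m τ + m τ ^ 2)) ≤ τ⁻¹ * (12 * (m τ + m τ ^ 2)) := by gcongr
      _ = _ := by ring
  have hdc : ContinuousOn (fun t => ‖w t - w' t‖) (Ici t₀) := (hwc.sub hwc').norm
  have hint : ∀ t T, t₀ ≤ t → t ≤ T → ‖w t - w' t‖ ≤ ‖w T - w' T‖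
      + ∫ τ in Ioc t T, (2 * a ^ 2 * τ⁻¹ + K τ) * ‖w τ - w' τ‖ := by
    intro t T ht htT
    have h1 := norm_le_add_integral_of_duhamel (w := fun t => w t - w' t)
      (G := fun τ => G τ - G' τ) (fun t ht => (hGi t ht).sub (hGi' t ht)) (fun t ht => by
        have h2 : ∀ {F : ℝ → L2R}, IntervalIntegrable F volume t₀ t →
            IntervalIntegrable (fun τ => freeSchrodinger (t - τ) (F τ)) volume t₀ t :=
          fun hF => (intervalIntegrable_iff_integrableOn_Ioc_of_le ht).2
            (integrable_freeSchrodinger_comp (continuous_const.sub continuous_id) hF.1)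
        simp only [freeSchrodinger_sub_right]
        rw [intervalIntegral.integral_sub (h2 (hGi t ht)) (h2 (hGi' t ht)), smul_sub,
          hduh t ht, hduh' t ht]
        abel) ht htT
    refine h1.trans (add_le_add_right ?_ _)
    have hsub : Ioc t T ⊆ Ioi t₀ := fun x hx => ht.trans_lt hx.1
    refine integral_mono_of_nonneg (Eventually.of_forall fun _ => norm_nonneg _)
      (integrableOn_kernel_mul ht₀ hdc hK _ ht) ?_
    exact ae_restrict_of_ae_restrict_of_subset hsub hdif
  have hdecay : ∀ᶠ t in atTop, ‖w t - w' t‖ ≤ (C + C') * t ^ (-(1 / 4) : ℝ) := by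
    filter_upwards [hC, hC'] with t h1 h2
    calc ‖w t - w' t‖ = ‖(w t - gaugedFlow (σ * a ^ 2) t u)
          - (w' t - gaugedFlow (σ * a ^ 2) t u)‖ := by rw [sub_sub_sub_cancel_right]
      _ ≤ _ := (norm_sub_le _ _).trans (by linarith)
  have hzero := eq_zero_of_le_add_integral ht₀ hdc (fun _ _ => norm_nonneg _) hK0 hK
    (by positivity) (by linarith) hint hdecay
  intro t ht
  have h1 : w t = w' t := sub_eq_zero.1 (norm_eq_zero.1 (hzero t ht))
  filter_upwards [hwv t ht, hwv' t ht] with s b1 b2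
  rw [b1, b2, h1]

/-! ### Choice of the constants and the main theorem. -/

theorem exists_profileSmallness {σ t₀ : ℝ} (hσ : |σ| = 1) (ht₀ : 0 < t₀) :
    ∃ M : ℝ, 0 < M ∧ ∀ a : ℝ, |a| < 1 / 8 → ProfileSmallness σ a M t₀ := by
  set q := t₀ ^ (-(1 / 4) : ℝ) with hq
  have hq0 : 0 < q := by positivity
  -- Small enough that `24 M q` and `24 M q²` are at most `24/1000`: the first gives `truncLip ≤
  -- τ^{-1/4}`, the second, with `a² ≤ 1/64`, the bound `1/8`.
  set M := 1 / (1000 * (1 + q) ^ 2) with hM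
  have hM0 : 0 < M := by positivity
  have hMe : M * (1000 * (1 + q) ^ 2) = 1 := by rw [hM]; field_simp
  have hMq : M * q ≤ 1 / 1000 := by nlinarith [mul_pos hM0 hq0, mul_pos hM0 (mul_pos hq0 hq0)]
  have hMq2 : M * q ^ 2 ≤ 1 / 1000 := by nlinarith [mul_pos hM0 hq0]
  refine ⟨M, hM0, fun a ha => ?_⟩
  have hlip : ∀ τ, t₀ ≤ τ → ∃ p, p = τ ^ (-(1 / 4) : ℝ) ∧ 0 < p ∧ p ≤ q ∧
      truncLip a M τ ≤ 24 * (M * p ^ 2) := by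
    intro τ hτ
    have hτ0 : 0 < τ := ht₀.trans_le hτ
    have hp0 : 0 < τ ^ (-(1 / 4) : ℝ) := by positivity
    have hpq : τ ^ (-(1 / 4) : ℝ) ≤ q := Real.rpow_le_rpow_of_nonpos ht₀ hτ (by norm_num)
    refine ⟨_, rfl, hp0, hpq, ?_⟩
    have h2 : τ ^ (-(1 / 2) : ℝ) = (τ ^ (-(1 / 4) : ℝ)) ^ 2 := by
      rw [← Real.rpow_natCast, ← Real.rpow_mul hτ0.le]; norm_num
    rw [truncLip, h2]
    set p := τ ^ (-(1 / 4) : ℝ)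
    have h3 : M * p ^ 2 ≤ M * q ^ 2 := by gcongr
    have h4 : 0 < M * p ^ 2 := by positivity
    nlinarith
  refine ⟨ht₀, hM0, hσ, fun τ hτ => ?_, fun τ hτ => ?_⟩
  · obtain ⟨p, -, hp0, hpq, h⟩ := hlip τ hτ
    have h3 : M * p ^ 2 ≤ M * q ^ 2 := by gcongr
    have h4 : a ^ 2 ≤ 1 / 64 := by
      rw [← sq_abs]; nlinarith [abs_nonneg a]
    linarith
  · obtain ⟨p, hp, hp0, hpq, h⟩ := hlip τ hτ
    rw [← hp]
    have h3 : M * p ≤ M * q := by gcongr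
    nlinarith

/-- The bound is continuous, vanishes at `S = E = 0` and is increasing in both arguments, so the
diagonal decides. It does not involve `a`, hence `δ` does not either. -/
theorem exists_profileSupBound_le (t₀ : ℝ) {M : ℝ} (ht₀ : 0 < t₀) (hM : 0 < M) :
    ∃ δ : ℝ, 0 < δ ∧ ∀ S E : ℝ, 0 ≤ S → 0 ≤ E → S + E < δ → profileSupBound M t₀ S E ≤ M := by
  have h1 : Continuous fun N => profileSupBound M t₀ N N := by
    unfold profileSupBound; fun_prop
  have h2 : ∀ᶠ N in nhdsWithin (0 : ℝ) (Ioi 0), profileSupBound M t₀ N N < M :=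
    (h1.tendsto 0).mono_left nhdsWithin_le_nhds |>.eventually
      (gt_mem_nhds (by simpa [profileSupBound] using hM))
  obtain ⟨δ, hδ, hδ0⟩ := (h2.and eventually_mem_nhdsWithin).exists
  refine ⟨δ, hδ0, fun S E hS hE h => le_trans ?_ hδ.le⟩
  have hC := resonantConst_nonneg
  have hSδ : S ≤ δ := by linarith
  have hEδ : E ≤ δ := by linarith
  unfold profileSupBound
  gcongr

theorem exists_isLongRangeSolution {σ a M t₀ : ℝ} (h : ProfileSmallness σ a M t₀) {u : L2R}
    (hu : Integrable u) (hM : profileSupBound M t₀ (∫ s, ‖u s‖) ‖u‖ ≤ M) :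
    ∃ v : ℝ → ℝ → ℂ, IsLongRangeSolution σ a t₀ u v := by
  obtain ⟨x, hx, hfix, hD⟩ := h.exists_fixedPoint hu
  refine ⟨_, h.isLongRangeSolution hu hx hfix hD fun t ht => ?_⟩
  refine (h.linftyLe_gaugedFlow hu hx hfix hD ht).mono (mul_le_mul_of_nonneg_right hM ?_)
  exact Real.rpow_nonneg (h.time_pos.le.trans ht) _

theorem mainTheorem5 (σ : ℝ) (hσ : σ = 1 ∨ σ = -1) (t₀ : ℝ) (ht₀ : 0 < t₀) :
    ∃ a₀ : ℝ, 0 < a₀ ∧ ∃ δ : ℝ, 0 < δ ∧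
      ∀ a : ℝ, |a| < a₀ →
      ∀ u : L2R, MemLp u 1 volume →
        eLpNorm u 1 volume + eLpNorm u 2 volume < ENNReal.ofReal δ →
        ∃ v : ℝ → ℝ → ℂ, IsLongRangeSolution σ a t₀ u v ∧
          ∀ v' : ℝ → ℝ → ℂ, IsLongRangeSolution σ a t₀ u v' →
            ∀ t ∈ Ici t₀, v' t =ᵐ[volume] v t := by
  have hσ1 : |σ| = 1 := by rcases hσ with rfl | rfl <;> simp
  obtain ⟨M, hM0, hM⟩ := exists_profileSmallness hσ1 ht₀
  obtain ⟨δ, hδ0, hδ⟩ := exists_profileSupBound_le t₀ ht₀ hM0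
  -- `a² < 1/64` serves both the contraction and the uniqueness threshold `1/32`.
  refine ⟨1 / 8, by norm_num, δ, hδ0, fun a ha u hu1 hsmall => ?_⟩
  have hu : Integrable u := memLp_one_iff_integrable.1 hu1
  have h1 : eLpNorm u 1 volume = ENNReal.ofReal (∫ s, ‖u s‖) := by
    rw [eLpNorm_one_eq_lintegral_enorm, ofReal_integral_norm_eq_lintegral_enorm hu]
  have h2 : eLpNorm u 2 volume = ENNReal.ofReal ‖u‖ := by
    rw [← Lp.enorm_def, ofReal_norm]
  have hS : 0 ≤ ∫ s, ‖u s‖ := integral_nonneg fun _ => norm_nonneg _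
  rw [h1, h2, ← ENNReal.ofReal_add hS (norm_nonneg u), ENNReal.ofReal_lt_ofReal_iff hδ0] at hsmall
  obtain ⟨v, hv⟩ := exists_isLongRangeSolution (hM a ha) hu
    (hδ _ _ hS (norm_nonneg u) hsmall)
  have ha2 : a ^ 2 ≤ 1 / 32 := by rw [← sq_abs]; nlinarith [abs_nonneg a]
  exact ⟨v, hv, fun v' hv' => hv.ae_eq hσ1 ha2 ht₀ hu hv'⟩
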